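/- Let $k$ be a field. Let $K_0(\mathrm{Var}_k)$ be the Grothendieck ring of varieties: the abelian group generated by the isomorphism classes $[X]$ of separated $k$-schemes $X$ of finite type, modulo the relations $[X]=[Z]+[X\setminus Z]$ for closed subschemes $Z\subset X$, with product induced by the fibre product over $k$; put $\mathbb{L}=[\mathbb{A}^1_k]$. Let $G$ be a finite $k$-group, i.e. a finite smooth group scheme over $k$. For a $G$-scheme $X$ over $k$, the quotient $X/G$ is the $k$-scheme $Y$ with an affine $G$-invariant morphism $q\colon X\to Y$ such that $\mathcal{O}_Y=(q_*\mathcal{O}_X)^G$ (it exists for quasi-projective $X$). (a) Let $X$ be a quasi-projective $k$-scheme with a $G$-action, and let $\pi\colon P\to X$ be a $G$-equivariant $\mathbb{G}_m$-torsor, i.e. an fppf $\mathbb{G}_{m}$-torsor over $X$ with a $G$-action on $P$ that commutes with the $\mathbb{G}_m$-action and for which $\pi$ is $G$-equivariant. Then $X/G$ and $P/G$ are separated and of finite type over $k$, and $$[P/G]=(\mathbb{L}-1)\,[X/G]\quad\text{in } K_0(\mathrm{Var}_k).$$ (b) Let $W$ be a finite $k$-scheme with a $G$-action such that $W/G=\operatorname{Spec}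 k$ (with the structure morphism of $W$ as quotient map), let $V$ be (the total space of) a $G$-equivariant vector bundle of finite rank on $W$, and let $\mathbb{P}(V)$ be its projectivization, parametrizing lines in $V$, with the induced $G$-action. Then $V/G$ and $\mathbb{P}(V)/G$ are separated and of finite type over $k$, and $$[V/G]=(\mathbb{L}-1)\,[\mathbb{P}(V)/G]+1\quad\text{in } K_0(\mathrm{Var}_k).$$ In particular, in $K_0(\mathrm{Var}_k)/(\mathbb{L})$ one has $[\mathbb{P}(V)/G]=1$ if and only if $[V/G]=0$. -/

import Mathlib

open CategoryTheory MonoidalCategory CartesianMonoidalCategory AlgebraicGeometry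

universe u

noncomputable section

namespace GrothendieckQuotient

/-! ### Schemes over a field -/

/-- The category of `k`-schemes. Its monoidal structure is the fibre product over `k`. -/
abbrev SchemeOver (k : Type u) [Field k] : Type (u + 1) := Over (Spec (CommRingCat.of k))

/-- `Spec A` as a `k`-scheme, for a `k`-algebra `A`. -/
abbrev specOver (k : Type u) [Field k] (A : Type u) [CommRing A] [Algebra k A] : SchemeOver k :=
  Over.mk (Spec.map (CommRingCat.ofHom (algebraMap k A)))

/-- Separated `k`-schemes of finite type. -/
structure IsSepFiniteType {k : Type u} [Field k] (X : SchemeOver k) : Prop where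
  isSeparated : IsSeparated X.hom
  locallyOfFiniteType : LocallyOfFiniteType X.hom
  quasiCompact : QuasiCompact X.hom

theorem isSepFiniteType_specOver (k : Type u) [Field k] (A : Type u) [CommRing A] [Algebra k A]
    [Algebra.FiniteType k A] : IsSepFiniteType (specOver k A) where
  isSeparated := by dsimp [specOver]; infer_instance
  locallyOfFiniteType := by
    dsimp [specOver]
    rw [HasRingHomProperty.Spec_iff (P := @LocallyOfFiniteType)]
    simpa [RingHom.finiteType_algebraMap]
  quasiCompact := by dsimp [specOver]; infer_instance

attribute [local instance] MvPolynomial.gradedAlgebra in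
/-- Projective `n`-space over `k`, as a `k`-scheme. -/
def projectiveSpace (k : Type u) [Field k] (n : ℕ) : SchemeOver k :=
  Over.mk (Proj.toSpecZero (MvPolynomial.homogeneousSubmodule (Fin (n + 1)) k) ≫
    Spec.map (CommRingCat.ofHom
      (algebraMap k (MvPolynomial.homogeneousSubmodule (Fin (n + 1)) k 0))))

/-- A `k`-scheme is quasi-projective if it is isomorphic to a locally closed subscheme of some
projective space over `k`. (Such a scheme is automatically of finite type.) -/
def IsQuasiProjective {k : Type u} [Field k] (X : SchemeOver k) : Prop :=
  ∃ (n : ℕ) (i : X ⟶ projectiveSpace k n), IsImmersion i.left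

/-! ### The Grothendieck ring of varieties -/

/-- The generators of `K₀(Var_k)`: separated `k`-schemes of finite type. -/
abbrev SepFiniteType (k : Type u) [Field k] : Type (u + 1) :=
  {X : SchemeOver k // IsSepFiniteType X}

/-- The defining relations of `K₀(Var_k)`: isomorphic schemes have the same class, the class of
`X` is the sum of the classes of a closed subscheme `Z` and of its open complement `U`, and products
of classes are given by the fibre product over `k` (the empty product being `Spec k`). -/
inductive K0Rel (k : Type u) [Field k] :
    FreeCommRing (SepFiniteType k) → FreeCommRing (SepFiniteType k) → Prop
  | iso (X Y : SepFiniteType k) (e : X.1 ≅ Y.1) :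
      K0Rel k (FreeCommRing.of X) (FreeCommRing.of Y)
  | scissors (X Z U : SepFiniteType k) (i : Z.1 ⟶ X.1) (j : U.1 ⟶ X.1)
      (hi : IsClosedImmersion i.left) (hj : IsOpenImmersion j.left)
      (h : Set.range j.left = (Set.range i.left)ᶜ) :
      K0Rel k (FreeCommRing.of X) (FreeCommRing.of Z + FreeCommRing.of U)
  | prod (X Y Z : SepFiniteType k) (e : Z.1 ≅ X.1 ⊗ Y.1) :
      K0Rel k (FreeCommRing.of Z) (FreeCommRing.of X * FreeCommRing.of Y)
  | one (X : SepFiniteType k) (e : X.1 ≅ 𝟙_ (SchemeOver k)) :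
      K0Rel k (FreeCommRing.of X) 1

/-- The Grothendieck ring of varieties `K₀(Var_k)`. Since the isomorphism classes form a
commutative monoid under the fibre product, and the scissor relations are stable under products,
this is the abelian group generated by the isomorphism classes modulo the scissor relations, with
the multiplication induced by the fibre product. -/
abbrev K0Var (k : Type u) [Field k] : Type (u + 1) :=
  FreeCommRing (SepFiniteType k) ⧸ Ideal.span {z | ∃ x y, K0Rel k x y ∧ z = x - y}

/-- The class `[X]` in `K₀(Var_k)`. -/
def K0Var.cls {k : Type u} [Field k] (X : SchemeOver k) (hX : IsSepFiniteType X) : K0Var k :=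
  Ideal.Quotient.mk _ (FreeCommRing.of ⟨X, hX⟩)

/-- The class `𝕃` of the affine line. -/
def lefschetz (k : Type u) [Field k] : K0Var k :=
  K0Var.cls (specOver k (Polynomial k)) (isSepFiniteType_specOver k (Polynomial k))

/-! ### Group actions and quotients -/

section Actions

variable {k : Type u} [Field k] (G : SchemeOver k) [GrpObj G]

/-- The action map `G × X ⟶ X` of a `G`-scheme `X`. -/
abbrev actMap (X : SchemeOver k) [ModObj G X] : G ⊗ X ⟶ X := ModObj.smul (M := G) (X := X)

variable {G} in
/-- The action of a `T`-valued point of `G` on a `T`-valued point of `X`. -/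
abbrev act {X T : SchemeOver k} [ModObj G X] (g : T ⟶ G) (x : T ⟶ X) : T ⟶ X :=
  lift g x ≫ actMap G X

/-- A morphism of `G`-schemes is `G`-equivariant. -/
def IsEquivariant {X Y : SchemeOver k} [ModObj G X] [ModObj G Y] (f : X ⟶ Y) : Prop :=
  actMap G X ≫ f = (G ◁ f) ≫ actMap G Y

/-- A finite `k`-group: a group scheme which is finite and smooth over `k`. -/
structure IsFiniteGroup : Prop where
  isFinite : IsFinite G.hom
  smooth : Smooth G.hom

/-- `q : X ⟶ Y` exhibits `Y` as the quotient `X/G` by a finite `k`-group `G`: the morphism `q` is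
affine and `G`-invariant, and `𝒪_Y` is the sheaf of `G`-invariants of `q_* 𝒪_X`. That is, `Y` is
locally `Spec (A ^ G)`, where `Spec A` is the preimage in `X`. A section `f` of `q_* 𝒪_X` over `U`
is invariant if its pullbacks to `G × X` along the action and along the projection agree (both are
defined over the same open subset, because `q` is invariant). -/
structure IsQuotient {X Y : SchemeOver k} [ModObj G X] (q : X ⟶ Y) : Prop where
  isAffineHom : IsAffineHom q.left
  invariant : actMap G X ≫ q = snd G X ≫ q
  injective (U : Y.left.Opens) : Function.Injective (q.left.app U)
  mem_range_iff (U : Y.left.Opens) (f : Γ(X.left, q.left ⁻¹ᵁ U)) :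
    f ∈ Set.range (q.left.app U) ↔
      ∀ (V : (G ⊗ X).left.Opens) (h₁ : V ≤ (actMap G X).left ⁻¹ᵁ (q.left ⁻¹ᵁ U))
        (h₂ : V ≤ (snd G X).left ⁻¹ᵁ (q.left ⁻¹ᵁ U)),
        (actMap G X).left.appLE _ V h₁ f = (snd G X).left.appLE _ V h₂ f

/-! ### Equivariant torsors under the multiplicative group -/

/-- The multiplicative group `𝔾ₘ = Spec k[T, T⁻¹]` over `k`. -/
def Gm (k : Type u) [Field k] : SchemeOver k := specOver k (LaurentPolynomial k)

/-- The group structure of `𝔾ₘ`, given by the usual Hopf algebra structure of `k[T, T⁻¹]`. -/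
instance (k : Type u) [Field k] : GrpObj (Gm k) :=
  inferInstanceAs (GrpObj ((Spec (CommRingCat.of (LaurentPolynomial k))).asOver
    (Spec (CommRingCat.of k))))

/-- `π : P ⟶ X` is a `𝔾ₘ`-torsor over `X`: it is an fppf covering, `𝔾ₘ` acts on `P` over `X`, and
`𝔾ₘ × P ⟶ P ×_X P`, `(t, p) ↦ (t p, p)`, is an isomorphism. -/
structure IsGmTorsor {P X : SchemeOver k} [ModObj (Gm k) P] (π : P ⟶ X) : Prop where
  flat : Flat π.left
  surjective : Surjective π.left
  locallyOfFinitePresentation : LocallyOfFinitePresentation π.left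
  isPullback : IsPullback (actMap (Gm k) P) (snd (Gm k) P) π π

/-- A `G`-equivariant `𝔾ₘ`-torsor: `G` acts on `P` and `X`, compatibly with `π`, and the action of
`G` on `P` commutes with that of `𝔾ₘ`. -/
structure IsEquivariantGmTorsor {P X : SchemeOver k} [ModObj (Gm k) P] [ModObj G P] [ModObj G X]
    (π : P ⟶ X) : Prop extends IsGmTorsor π where
  equivariant : IsEquivariant G π
  act_comm {T : SchemeOver k} (g : T ⟶ G) (t : T ⟶ Gm k) (p : T ⟶ P) :
    act g (act t p) = act t (act g p)

end Actions

/-! ### Vector bundles over a finite scheme and their projectivizations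

A finite `k`-scheme `W` is `Spec A` for a finite `k`-algebra `A`, and a vector bundle on `W` is given
by a finitely generated projective `A`-module `M` (its module of sections). -/

section Sym

variable (A : Type u) [CommRing A] (M : Type u) [AddCommGroup M] [Module A M]

/-- The symmetric algebra on the dual of `M`: the algebra of functions on the total space. -/
abbrev Sym : Type u := SymmetricAlgebra A (Module.Dual A M)

/-- The grading of the symmetric algebra by degree. -/
def symGrading (n : ℕ) : Submodule A (Sym A M) :=
  LinearMap.range (SymmetricAlgebra.ι A (Module.Dual A M)) ^ n

instance : SetLike.GradedMonoid (symGrading A M) :=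
  inferInstanceAs (SetLike.GradedMonoid
    (fun n : ℕ => LinearMap.range (SymmetricAlgebra.ι A (Module.Dual A M)) ^ n))

open scoped DirectSum in
/-- The inclusion of the linear functions, as degree one elements. -/
def symGradingι : Module.Dual A M →ₗ[A] ⨁ i : ℕ, symGrading A M i :=
  DirectSum.lof A ℕ (fun i => symGrading A M i) 1 ∘ₗ
    (SymmetricAlgebra.ι A (Module.Dual A M)).codRestrict _
      fun m => by simpa only [symGrading, pow_one] using LinearMap.mem_range_self _ m

instance : GradedAlgebra (symGrading A M) :=
  GradedAlgebra.ofAlgHom _ (SymmetricAlgebra.lift (symGradingι A M))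
    (by
      apply SymmetricAlgebra.algHom_ext
      ext m
      simp [symGradingι, DirectSum.lof_eq_of])
    fun i x => by
    obtain ⟨x, hx⟩ := x
    dsimp only [Subtype.coe_mk, DirectSum.lof_eq_of]
    induction hx using Submodule.pow_induction_on_left' with
    | algebraMap r =>
      rw [AlgHom.commutes, DirectSum.algebraMap_apply]; rfl
    | add x y i hx hy ihx ihy =>
      rw [map_add, ihx, ihy, ← map_add]
      rfl
    | mem_mul m hm i x hx ih =>
      obtain ⟨m, rfl⟩ := hm
      rw [map_mul, ih, SymmetricAlgebra.lift_ι_apply]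
      change DirectSum.of (fun i => symGrading A M i) 1 _ * _ = _
      rw [DirectSum.of_mul_of]
      exact DirectSum.of_eq_of_gradedMonoid_eq (Sigma.subtype_ext (add_comm _ _) rfl)

end Sym

section Bundles

variable (k : Type u) [Field k] (A : Type u) [CommRing A] [Algebra k A]
  (M : Type u) [AddCommGroup M] [Module A M]

/-- The total space `V = Spec (Sym M^∨)` of the vector bundle on `Spec A` with module of sections
`M`, as a `k`-scheme. -/
abbrev totalSpace : SchemeOver k :=
  Over.mk (Spec.map (CommRingCat.ofHom (algebraMap A (Sym A M))) ≫
    Spec.map (CommRingCat.ofHom (algebraMap k A)))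

/-- The bundle projection `V ⟶ Spec A`. -/
def bundleProj : totalSpace k A M ⟶ specOver k A :=
  Over.homMk (Spec.map (CommRingCat.ofHom (algebraMap A (Sym A M))))

/-- The projectivization `ℙ(V) = Proj (Sym M^∨)`, parametrizing lines in `V`, as a `k`-scheme. -/
abbrev projBundle : SchemeOver k :=
  Over.mk (Proj.toSpecZero (symGrading A M) ≫
    Spec.map (CommRingCat.ofHom (algebraMap A (symGrading A M 0))) ≫
    Spec.map (CommRingCat.ofHom (algebraMap k A)))

variable {k A M}

/-- Evaluation of functions on `V` at a `T`-valued point `v` of `V`. -/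
def evalAt {T : SchemeOver k} (v : T ⟶ totalSpace k A M) : Sym A M →+* Γ(T.left, ⊤) :=
  ((Scheme.ΓSpecIso (CommRingCat.of (Sym A M))).inv ≫ v.left.appTop).hom

/-- The point `v` of `V` lies in the complement of the zero section, by the strong condition that
the linear functions generate the unit ideal at `v`; over an affine base this is no restriction. -/
abbrev NowhereZero {T : SchemeOver k} (v : T ⟶ totalSpace k A M) : Prop :=
  (HomogeneousIdeal.irrelevant (symGrading A M)).toIdeal.map (evalAt v) = ⊤

/-- The point `[v]` of `ℙ(V)` defined by a nowhere zero point `v` of `V`. -/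
def toProj {T : SchemeOver k} (v : T ⟶ totalSpace k A M) (hv : NowhereZero v) :
    T ⟶ projBundle k A M :=
  Over.homMk (Proj.fromOfGlobalSections (symGrading A M) (evalAt v) hv) (by
    have key : T.left.toSpecΓ ≫ Spec.map (CommRingCat.ofHom (evalAt v)) = v.left := by
      have h := Scheme.toSpecΓ_naturality v.left
      rw [evalAt, CommRingCat.ofHom_hom, Spec.map_comp, ← Category.assoc, ← h, Category.assoc]
      have : (totalSpace k A M).left.toSpecΓ ≫
          Spec.map (Scheme.ΓSpecIso (CommRingCat.of (Sym A M))).inv = 𝟙 _ :=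
        toSpecΓ_SpecMap_ΓSpecIso_inv _
      rw [this, Category.comp_id]
    have h0 : CommRingCat.ofHom (algebraMap A (Sym A M)) =
        CommRingCat.ofHom (algebraMap A (symGrading A M 0)) ≫
          CommRingCat.ofHom (algebraMap (symGrading A M 0) (Sym A M)) := rfl
    refine Eq.trans ?_ (Over.w v)
    change _ = v.left ≫ Spec.map (CommRingCat.ofHom (algebraMap A (Sym A M))) ≫ _
    refine Eq.trans ?_ (congrArg (· ≫ _) key)
    dsimp only [Over.mk_hom]
    rw [Proj.fromOfGlobalSections_toSpecZero_assoc]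
    refine Eq.trans ?_ (congrArg (fun f => _ ≫ Spec.map f ≫ _) h0).symm
    simp only [CommRingCat.ofHom_comp, Spec.map_comp, Category.assoc])

variable (G : SchemeOver k) [GrpObj G]

/-- An action of `G` on the total space `V` over an action on the base `W = Spec A` makes `V` a
`G`-equivariant vector bundle: the projection is equivariant, and `G` acts linearly, i.e. the action
`G × V ⟶ V` is a morphism of vector bundles over `G × W ⟶ W`. The latter means that the pullback of
a linear function `l ∈ M^∨` on `V` is a linear function on the vector bundle `G × V` over `G × W`,
i.e. a combination of linear functions on `V` with coefficients in the functions on `G × W`. -/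
structure IsEquivariantBundle [ModObj G (specOver k A)] [ModObj G (totalSpace k A M)] : Prop where
  equivariant : IsEquivariant G (bundleProj k A M)
  linear (l : Module.Dual A M) :
    ∃ (n : ℕ) (c : Fin n → Γ((G ⊗ specOver k A).left, ⊤)) (m : Fin n → Module.Dual A M),
      evalAt (actMap G (totalSpace k A M)) (SymmetricAlgebra.ι A _ l) =
        ∑ i, (G ◁ bundleProj k A M).left.appTop (c i) *
          evalAt (snd G (totalSpace k A M)) (SymmetricAlgebra.ι A _ (m i))

/-- The action of `G` on `ℙ(V)` is the one induced by its action on `V`: `g [v] = [g v]`. -/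
def IsInducedAction [ModObj G (totalSpace k A M)] [ModObj G (projBundle k A M)] : Prop :=
  ∀ (T : SchemeOver k) (g : T ⟶ G) (v : T ⟶ totalSpace k A M) (hv : NowhereZero v)
    (hgv : NowhereZero (act g v)), act g (toProj v hv) = toProj (act g v) hgv

end Bundles

end GrothendieckQuotient

end

open GrothendieckQuotient

/-! Locally write `X/G = Spec R₀` and `P/G = Spec R`. As `G` and `𝔾ₘ` commute, the action of `𝔾ₘ` on
`P` grades `R` by `ℤ`. Faithfully flat descent along `P → X` identifies the degree zero part with
`R₀`, and the elements of positive degree generate the unit ideal. In general `P/G → X/G` is no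
longer a torsor, because stabilizers act on the fibres through characters, but the grading suffices.

Over a prime `p` of `R₀`, the degrees `n` for which some product of elements of degrees `n` and `-n`
avoids `p` form a subgroup `dℤ` with `d > 0`. After inverting some `s ∉ p`, an element `u` of degree
`d` becomes a unit, and `(R₀/p)_s[u, u⁻¹] → (R/pR)_s` is injective, and surjective up to nilpotents
(`exists_affCls_away_of_isPrime`). Classes ignore nilpotents, so the factor `𝕃 - 1` appears over a
dense open subset of `Spec (R₀/p)`. Noetherian induction extends this to every closed subscheme
`Spec (R₀/J)` (`affCls_quotient_map`). Having it for every `J` is what allows gluing: each chart of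
a finite affine cover adds a closed subscheme of itself, the part not covered before
(`cls_openSub_finsetSup`).

The finite group enters through the characteristic polynomial of multiplication by the pullback of a
function under the action (`exists_monic_of_isInvariantOpen`). It annihilates the function, its
coefficients are invariant, and the lower ones lie in any ideal whose extension contains that
pullback. From this follow integrality and surjectivity of quotient maps, the descent of invariant
opens, of affineness and of finite type, and the fact that positive weights still generate the unit
ideal on `P/G`.

For (b) the same comparison of weights (`cls_openSub_of_weights`) applies to the charts `D(f) →
D₊(f)`, for `f` a homogeneous invariant form of positive degree. By the characteristic polynomial
again, such forms have only the zero section as common zeros (`IsEquivariantBundle.exists_pow_mem`).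
The rest of `V/G` is the image of `W/G = Spec k` and contributes `1`. Modulo `𝕃` the formula reads
`[V/G] = 1 - [ℙ(V)/G]`. -/

noncomputable section

namespace GrothendieckQuotient

/-! ### Classes of affine schemes in the Grothendieck ring -/

section Affine

variable (k : Type u) [Field k]

/-- The class in `K₀(Var_k)` of the spectrum of a `k`-algebra of finite type. -/
def affCls (A : Type u) [CommRing A] [Algebra k A] [Algebra.FiniteType k A] : K0Var k :=
  K0Var.cls (specOver k A) (isSepFiniteType_specOver k A)

variable {k}

theorem mk_eq_of_rel {x y : FreeCommRing (SepFiniteType k)} (h : K0Rel k x y) :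
    (Ideal.Quotient.mk _ x : K0Var k) = Ideal.Quotient.mk _ y :=
  Ideal.Quotient.eq.mpr (Ideal.subset_span ⟨x, y, h, rfl⟩)

theorem cls_congr {X Y : SchemeOver k} (e : X ≅ Y) (hX : IsSepFiniteType X)
    (hY : IsSepFiniteType Y) : K0Var.cls X hX = K0Var.cls Y hY :=
  mk_eq_of_rel (.iso ⟨X, hX⟩ ⟨Y, hY⟩ e)

theorem cls_scissors {X Z U : SchemeOver k} (hX : IsSepFiniteType X) (hZ : IsSepFiniteType Z)
    (hU : IsSepFiniteType U) (i : Z ⟶ X) (j : U ⟶ X) (hi : IsClosedImmersion i.left)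
    (hj : IsOpenImmersion j.left) (h : Set.range j.left = (Set.range i.left)ᶜ) :
    K0Var.cls X hX = K0Var.cls Z hZ + K0Var.cls U hU :=
  (mk_eq_of_rel (.scissors ⟨X, hX⟩ ⟨Z, hZ⟩ ⟨U, hU⟩ i j hi hj h)).trans (map_add _ _ _)

theorem cls_prod {X Y Z : SchemeOver k} (hX : IsSepFiniteType X) (hY : IsSepFiniteType Y)
    (hZ : IsSepFiniteType Z) (e : Z ≅ X ⊗ Y) :
    K0Var.cls Z hZ = K0Var.cls X hX * K0Var.cls Y hY :=
  (mk_eq_of_rel (.prod ⟨X, hX⟩ ⟨Y, hY⟩ ⟨Z, hZ⟩ e)).trans (map_mul _ _ _)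

theorem cls_one {X : SchemeOver k} (hX : IsSepFiniteType X) (e : X ≅ 𝟙_ (SchemeOver k)) :
    K0Var.cls X hX = 1 :=
  (mk_eq_of_rel (.one ⟨X, hX⟩ e)).trans (map_one _)

/-- The empty scheme is its own closed subscheme and its own complement, so its class `c` satisfies
`c = c + c`. -/
theorem cls_of_isEmpty {X : SchemeOver k} (hX : IsSepFiniteType X) [IsEmpty X.left] :
    K0Var.cls X hX = 0 := by
  have h := cls_scissors hX hX hX (𝟙 X) (𝟙 X) (by dsimp; infer_instance)
    (by dsimp; infer_instance) (Subsingleton.elim _ _)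
  simpa using h

/-- The morphism of `k`-schemes defined by a homomorphism of `k`-algebras. -/
def specOverMap {A B : Type u} [CommRing A] [Algebra k A] [CommRing B] [Algebra k B]
    (f : A →ₐ[k] B) : specOver k B ⟶ specOver k A :=
  Over.homMk (Spec.map (CommRingCat.ofHom f.toRingHom)) (by
    dsimp [specOver]
    rw [← Spec.map_comp, ← CommRingCat.ofHom_comp]
    congr 2
    exact f.comp_algebraMap)

@[simp]
theorem specOverMap_left {A B : Type u} [CommRing A] [Algebra k A] [CommRing B] [Algebra k B]
    (f : A →ₐ[k] B) : (specOverMap f).left = Spec.map (CommRingCat.ofHom f.toRingHom) := rfl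

/-- The isomorphism of `k`-schemes defined by an isomorphism of `k`-algebras. -/
def specOverIso {A B : Type u} [CommRing A] [Algebra k A] [CommRing B] [Algebra k B]
    (e : A ≃ₐ[k] B) : specOver k B ≅ specOver k A where
  hom := specOverMap e.toAlgHom
  inv := specOverMap e.symm.toAlgHom
  hom_inv_id := by
    ext1
    simp only [Over.comp_left, specOverMap_left, ← Spec.map_comp, ← CommRingCat.ofHom_comp,
      Over.id_left]
    refine Eq.trans (congrArg Spec.map ?_) (Spec.map_id _)
    ext x; simp
  inv_hom_id := by
    ext1
    simp only [Over.comp_left, specOverMap_left, ← Spec.map_comp, ← CommRingCat.ofHom_comp,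
      Over.id_left]
    refine Eq.trans (congrArg Spec.map ?_) (Spec.map_id _)
    ext x; simp

section

variable {A B C : Type u} [CommRing A] [Algebra k A] [Algebra.FiniteType k A]
  [CommRing B] [Algebra k B] [Algebra.FiniteType k B]
  [CommRing C] [Algebra k C] [Algebra.FiniteType k C]

theorem affCls_congr (e : A ≃ₐ[k] B) : affCls k A = affCls k B :=
  (cls_congr (specOverIso e) _ _).symm

theorem affCls_of_subsingleton [Subsingleton A] : affCls k A = 0 := by
  have : IsEmpty (specOver k A).left := inferInstanceAs (IsEmpty (PrimeSpectrum A))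
  exact cls_of_isEmpty _

/-- Only the supports have to be complementary, hence the radicals in `hker`. -/
theorem affCls_scissors [Algebra A C] [IsScalarTower k A C] (f : A →ₐ[k] B) (a : A)
    [IsLocalization.Away a C] (hf : Function.Surjective f)
    (hker : (RingHom.ker f).radical = (Ideal.span {a}).radical) :
    affCls k A = affCls k B + affCls k C := by
  refine cls_scissors _ _ _ (specOverMap f) (specOverMap (IsScalarTower.toAlgHom k A C)) ?_ ?_ ?_
  · exact IsClosedImmersion.spec_of_surjective _ hf
  · exact IsOpenImmersion.of_isLocalization a
  · have h1 : Set.range (specOverMap (IsScalarTower.toAlgHom k A C)).left =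
        (PrimeSpectrum.basicOpen a : Set (PrimeSpectrum A)) :=
      PrimeSpectrum.localization_away_comap_range C a
    have h2 : Set.range (specOverMap f).left = PrimeSpectrum.zeroLocus (RingHom.ker f) :=
      range_comap_of_surjective _ f.toRingHom hf
    rw [h1, h2, PrimeSpectrum.basicOpen_eq_zeroLocus_compl, ← PrimeSpectrum.zeroLocus_span,
      ← PrimeSpectrum.zeroLocus_radical (RingHom.ker f),
      ← PrimeSpectrum.zeroLocus_radical (Ideal.span {a}), hker]
    rfl

/-- Classes do not see nilpotents: this is the scissor relation with `a = 0`, where the open part is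
empty. -/
theorem affCls_of_surjective_of_ker_le (f : A →ₐ[k] B) (hf : Function.Surjective f)
    (hker : RingHom.ker f ≤ nilradical A) : affCls k A = affCls k B := by
  have : Subsingleton (Localization.Away (0 : A)) :=
    IsLocalization.subsingleton (M := Submonoid.powers (0 : A)) ⟨1, by simp⟩
  have h := affCls_scissors (C := Localization.Away (0 : A)) f 0 hf (by
    rw [Ideal.span_singleton_zero]
    apply le_antisymm
    · exact (Ideal.radical_mono hker).trans (by rw [nilradical, Ideal.radical_idem]; rfl)
    · exact Ideal.radical_mono bot_le)
  rwa [affCls_of_subsingleton (A := Localization.Away (0 : A)), add_zero] at h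

theorem affCls_quotient_add_away_quotient (I : Ideal A) (a : A) :
    affCls k (A ⧸ I) = affCls k (A ⧸ (I ⊔ Ideal.span {a})) +
      affCls k (Localization.Away (Ideal.Quotient.mk I a)) := by
  refine affCls_scissors (Ideal.Quotient.factorₐ k le_sup_left) (Ideal.Quotient.mk I a)
    (Ideal.Quotient.factor_surjective le_sup_left) (congrArg Ideal.radical ?_)
  refine (Ideal.Quotient.factor_ker le_sup_left).trans ?_
  rw [Ideal.map_sup, Ideal.map_quotient_self, bot_sup_eq, Ideal.map_span, Set.image_singleton]

/-- Inclusion-exclusion for `V(I) = V(I, a) ∪ V(I, b)`. Where `a` is invertible, `ab ∈ I` forces `b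
∈ I`, so adjoining `b` changes nothing there. -/
theorem affCls_quotient_of_mul_mem {I : Ideal A} {a b : A} (hab : a * b ∈ I) :
    affCls k (A ⧸ I) = affCls k (A ⧸ (I ⊔ Ideal.span {a})) +
      affCls k (A ⧸ (I ⊔ Ideal.span {b})) -
      affCls k (A ⧸ (I ⊔ Ideal.span {b} ⊔ Ideal.span {a})) := by
  rw [affCls_quotient_add_away_quotient I a,
    affCls_quotient_add_away_quotient (I ⊔ Ideal.span {b}) a]
  suffices h : affCls k (Localization.Away (Ideal.Quotient.mk I a)) =
      affCls k (Localization.Away (Ideal.Quotient.mk (I ⊔ Ideal.span {b}) a)) by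
    rw [h]; ring
  let f : A ⧸ I →ₐ[k] A ⧸ (I ⊔ Ideal.span {b}) := Ideal.Quotient.factorₐ k le_sup_left
  have hf : Function.Surjective f := Ideal.Quotient.factor_surjective le_sup_left
  have : IsLocalization.Away (f (Ideal.Quotient.mk I a))
      (Localization.Away (Ideal.Quotient.mk (I ⊔ Ideal.span {b}) a)) :=
    inferInstanceAs (IsLocalization.Away (Ideal.Quotient.mk (I ⊔ Ideal.span {b}) a) _)
  refine affCls_of_surjective_of_ker_le (IsLocalization.Away.mapₐ _
    (Localization.Away (Ideal.Quotient.mk (I ⊔ Ideal.span {b}) a)) f (Ideal.Quotient.mk I a))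
    (IsLocalization.Away.mapₐ_surjective_of_surjective _ hf) fun x hx => ?_
  obtain ⟨y, ⟨_, n, rfl⟩, rfl⟩ :=
    IsLocalization.exists_mk'_eq (Submonoid.powers (Ideal.Quotient.mk I a)) x
  have hy : algebraMap _ (Localization.Away (Ideal.Quotient.mk (I ⊔ Ideal.span {b}) a)) (f y) = 0 := by
    have h1 : IsLocalization.Away.mapₐ _ (Localization.Away
        (Ideal.Quotient.mk (I ⊔ Ideal.span {b}) a)) f (Ideal.Quotient.mk I a)
        (algebraMap _ (Localization.Away (Ideal.Quotient.mk I a)) y) = 0 := by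
      rw [← IsLocalization.mk'_spec (Localization.Away (Ideal.Quotient.mk I a)) y
        (⟨_, n, rfl⟩ : Submonoid.powers (Ideal.Quotient.mk I a)), map_mul, (RingHom.mem_ker).mp hx, zero_mul]
    rwa [IsLocalization.Away.mapₐ_apply, IsLocalization.Away.map, IsLocalization.map_eq] at h1
  rw [IsLocalization.map_eq_zero_iff (Submonoid.powers (Ideal.Quotient.mk (I ⊔ Ideal.span {b}) a))]
    at hy
  obtain ⟨⟨_, m, rfl⟩, hm⟩ := hy
  suffices h : IsLocalization.mk' (Localization.Away (Ideal.Quotient.mk I a)) y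
      (⟨_, n, rfl⟩ : Submonoid.powers (Ideal.Quotient.mk I a)) = 0 by rw [h]; exact zero_mem _
  rw [IsLocalization.mk'_eq_zero_iff]
  -- One more factor `a` turns the multiple of `b` in `a ^ m * y` into a multiple of `a * b ∈ I`.
  refine ⟨⟨_, m + 1, rfl⟩, ?_⟩
  obtain ⟨y, rfl⟩ := Ideal.Quotient.mk_surjective y
  have hm' : Ideal.Quotient.mk (I ⊔ Ideal.span {b}) (a ^ m * y) = 0 := by simpa [f] using hm
  rw [Ideal.Quotient.eq_zero_iff_mem, Submodule.mem_sup] at hm'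
  obtain ⟨i, hi, c, hc, e⟩ := hm'
  obtain ⟨c, rfl⟩ := Ideal.mem_span_singleton'.mp hc
  have : Ideal.Quotient.mk I (a ^ (m + 1) * y) = 0 := by
    rw [Ideal.Quotient.eq_zero_iff_mem]
    have : a ^ (m + 1) * y = a * i + c * (a * b) := by
      rw [pow_succ, mul_right_comm, ← e]; ring
    rw [this]
    exact add_mem (I.mul_mem_left _ hi) (I.mul_mem_left _ hab)
  simpa using this

instance : IsScalarTower k (Polynomial A) (LaurentPolynomial A) :=
  .of_algebraMap_eq fun x => by
    rw [LaurentPolynomial.algebraMap_eq_toLaurent, Polynomial.algebraMap_apply,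
      Polynomial.toLaurent_C, LaurentPolynomial.algebraMap_apply]

instance : Algebra.FiniteType k (LaurentPolynomial A) :=
  have : Algebra.FiniteType (Polynomial A) (LaurentPolynomial A) :=
    IsLocalization.finiteType_of_monoid_fg (Submonoid.powers Polynomial.X) _
  .trans (S := Polynomial A) (.trans (S := A) inferInstance inferInstance) this

theorem affCls_polynomial : affCls k (Polynomial A) = lefschetz k * affCls k A := by
  rw [mul_comm]
  refine cls_prod _ _ _ ?_
  refine specOverIso (polyEquivTensor k A).symm ≪≫ ?_
  exact Over.isoMk (pullbackSpecIso k A (Polynomial k)).symm (by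
    refine (pullbackSpecIso_inv_fst_assoc k A (Polynomial k) _).trans ?_
    exact (Spec.map_comp _ _).symm)

/-- Cut the section `X = 0` out of `Spec A[X]`. -/
theorem affCls_laurent : affCls k (LaurentPolynomial A) = (lefschetz k - 1) * affCls k A := by
  have h := affCls_scissors (k := k) (C := LaurentPolynomial A)
    (Polynomial.aeval (0 : A) |>.restrictScalars k) (Polynomial.X : Polynomial A)
    (fun a => ⟨Polynomial.C a, by simp⟩) (congrArg Ideal.radical ?_)
  · rw [affCls_polynomial] at h
    linear_combination -h
  · ext p
    rw [RingHom.mem_ker, Ideal.mem_span_singleton, Polynomial.X_dvd_iff]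
    simp [Polynomial.coeff_zero_eq_aeval_zero]

end
end Affine

/-! ### Graded rings with a unit ideal in positive degrees -/

section Graded

set_option linter.unusedSectionVars false

variable {k : Type u} [Field k] {R₀ R : Type u} [CommRing R₀] [CommRing R] [Algebra R₀ R]
  (𝒜 : ℤ → Submodule R₀ R) [GradedAlgebra 𝒜]

theorem algebraMap_mem_zero (r : R₀) : algebraMap R₀ R r ∈ 𝒜 0 :=
  SetLike.algebraMap_mem_graded 𝒜 r

/-- An ideal generated in degree zero is homogeneous. -/
theorem decompose_mem_map {J : Ideal R₀} {x : R} (hx : x ∈ J.map (algebraMap R₀ R)) (n : ℤ) :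
    (DirectSum.decompose 𝒜 x n : R) ∈ J.map (algebraMap R₀ R) :=
  Ideal.homogeneous_span 𝒜 _ (by rintro _ ⟨r, -, rfl⟩; exact ⟨0, algebraMap_mem_zero 𝒜 r⟩) n hx

theorem exists_mem_of_mem_map (h0 : ∀ x ∈ 𝒜 0, x ∈ Set.range (algebraMap R₀ R))
    {J : Ideal R₀} {x : R} (hx : x ∈ J.map (algebraMap R₀ R)) :
    ∃ j ∈ J, algebraMap R₀ R j = (DirectSum.decompose 𝒜 x 0 : R) := by
  -- Allowing an arbitrary multiplier `r` makes the claim stable under passing to the `R`-span.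
  suffices h : ∀ r, ∃ j ∈ J, algebraMap R₀ R j = (DirectSum.decompose 𝒜 (r * x) 0 : R) by
    simpa using h 1
  refine Submodule.span_induction ?_ (fun r => ⟨0, zero_mem _, by simp⟩) ?_ ?_ hx
  · rintro _ ⟨j, hj, rfl⟩ r
    obtain ⟨c, hc⟩ := h0 _ (DirectSum.decompose 𝒜 r 0).2
    refine ⟨c * j, J.mul_mem_left _ hj, ?_⟩
    rw [DirectSum.coe_decompose_mul_of_right_mem_zero 𝒜 (algebraMap_mem_zero 𝒜 j), map_mul, hc]
  · rintro x y - - hx hy r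
    obtain ⟨j, hj, ej⟩ := hx r
    obtain ⟨l, hl, el⟩ := hy r
    exact ⟨j + l, add_mem hj hl, by simp [mul_add, ej, el]⟩
  · rintro a x - hx r
    simpa [mul_assoc] using hx (r * a)

/-- `R₀` is a direct summand of `R`, so extending and contracting an ideal gives it back. -/
theorem mem_of_algebraMap_mem_map (h0 : ∀ x ∈ 𝒜 0, x ∈ Set.range (algebraMap R₀ R))
    (hinj : Function.Injective (algebraMap R₀ R))
    {J : Ideal R₀} {r : R₀} (hx : algebraMap R₀ R r ∈ J.map (algebraMap R₀ R)) : r ∈ J := by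
  obtain ⟨j, hj, e⟩ := exists_mem_of_mem_map 𝒜 h0 hx
  rw [DirectSum.decompose_of_mem_same 𝒜 (algebraMap_mem_zero 𝒜 r)] at e
  rwa [← hinj e]

/-- A degree `n` pairs nontrivially with `-n` modulo `p`. -/
def IsGoodDegree (p : Ideal R₀) (n : ℤ) : Prop :=
  ∃ x ∈ 𝒜 n, ∃ y ∈ 𝒜 (-n), ∃ s ∉ p, x * y = algebraMap R₀ R s

variable {𝒜}

theorem IsGoodDegree.add {p : Ideal R₀} [p.IsPrime] {m n : ℤ} (hm : IsGoodDegree 𝒜 p m)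
    (hn : IsGoodDegree 𝒜 p n) : IsGoodDegree 𝒜 p (m + n) := by
  obtain ⟨x, hx, y, hy, s, hs, e⟩ := hm
  obtain ⟨x', hx', y', hy', s', hs', e'⟩ := hn
  refine ⟨x * x', SetLike.mul_mem_graded hx hx', y * y', ?_, s * s', ?_, ?_⟩
  · rw [neg_add]; exact SetLike.mul_mem_graded hy hy'
  · exact fun h => (Ideal.IsPrime.mem_or_mem ‹_› h).elim hs hs'
  · rw [map_mul, ← e, ← e']; ring

theorem IsGoodDegree.neg {p : Ideal R₀} {n : ℤ} (hn : IsGoodDegree 𝒜 p n) :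
    IsGoodDegree 𝒜 p (-n) := by
  obtain ⟨x, hx, y, hy, s, hs, e⟩ := hn
  exact ⟨y, hy, x, by rwa [neg_neg], s, hs, by rw [mul_comm, e]⟩

/-- The degree zero component of `r * x`, for `x` of degree `n > 0`, is a product of elements of
degrees `-n` and `n`. If all of these lay in `p`, so would the degree zero component of everything
in the unit ideal, including `1`. -/
theorem exists_isGoodDegree (h0 : ∀ x ∈ 𝒜 0, x ∈ Set.range (algebraMap R₀ R))
    (hinj : Function.Injective (algebraMap R₀ R))
    (hpos : Ideal.span {x : R | ∃ n > 0, x ∈ 𝒜 n} = ⊤) (p : Ideal R₀) [p.IsPrime] :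
    ∃ n > 0, IsGoodDegree 𝒜 p n := by
  by_contra! H
  suffices h : ∀ x ∈ Ideal.span {x : R | ∃ n > 0, x ∈ 𝒜 n}, ∀ r, ∃ j ∈ p,
      algebraMap R₀ R j = (DirectSum.decompose 𝒜 (r * x) 0 : R) by
    obtain ⟨j, hj, e⟩ := h 1 (by rw [hpos]; trivial) 1
    rw [mul_one, DirectSum.decompose_of_mem_same 𝒜 SetLike.GradedOne.one_mem,
      ← map_one (algebraMap R₀ R)] at e
    exact Ideal.IsPrime.one_notMem ‹_› (hinj e ▸ hj)
  intro x hx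
  refine Submodule.span_induction ?_ (fun r => ⟨0, zero_mem _, by simp⟩) ?_ ?_ hx
  · rintro x ⟨n, hn, hx⟩ r
    have e := DirectSum.coe_decompose_mul_add_of_right_mem 𝒜 (i := -n) (a := r) hx
    rw [neg_add_cancel] at e
    obtain ⟨c, hc⟩ := h0 _ (DirectSum.decompose 𝒜 (r * x) 0).2
    refine ⟨c, ?_, hc⟩
    by_contra hcp
    exact H n hn ⟨x, hx, _, (DirectSum.decompose 𝒜 r (-n)).2, c, hcp, by rw [hc, e, mul_comm]⟩
  · rintro x y - - hx hy r
    obtain ⟨j, hj, ej⟩ := hx r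
    obtain ⟨l, hl, el⟩ := hy r
    exact ⟨j + l, add_mem hj hl, by simp [mul_add, ej, el]⟩
  · rintro a x - hx r
    simpa [mul_assoc] using hx (r * a)

/-- There is a least positive good degree, and it divides every good degree. -/
theorem exists_isGoodDegree_dvd (h0 : ∀ x ∈ 𝒜 0, x ∈ Set.range (algebraMap R₀ R))
    (hinj : Function.Injective (algebraMap R₀ R))
    (hpos : Ideal.span {x : R | ∃ n > 0, x ∈ 𝒜 n} = ⊤) (p : Ideal R₀) [p.IsPrime] :
    ∃ d > 0, IsGoodDegree 𝒜 p d ∧ ∀ n, IsGoodDegree 𝒜 p n → d ∣ n := by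
  have hz : IsGoodDegree 𝒜 p 0 := ⟨1, SetLike.GradedOne.one_mem, 1,
    by rw [neg_zero]; exact SetLike.GradedOne.one_mem, 1, Ideal.IsPrime.one_notMem ‹_›, by simp⟩
  -- Good degrees are closed under sums, by multiplying witnesses, and under negation, by swapping
  -- them; so they form a cyclic group.
  let S : AddSubgroup ℤ :=
    { carrier := {n | IsGoodDegree 𝒜 p n}
      zero_mem' := hz
      add_mem' := fun h h' => h.add h'
      neg_mem' := fun h => h.neg }
  obtain ⟨d, hd⟩ := Int.subgroup_cyclic S
  obtain ⟨n, hn, hn'⟩ := exists_isGoodDegree h0 hinj hpos p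
  have key : ∀ n, IsGoodDegree 𝒜 p n ↔ d ∣ n := fun n => by
    rw [← Int.mem_zmultiples_iff, AddSubgroup.zmultiples_eq_closure, ← hd]; rfl
  have hd0 : d ≠ 0 := by
    rintro rfl
    exact hn.ne' (zero_dvd_iff.mp ((key n).mp hn'))
  exact ⟨|d|, abs_pos.mpr hd0, (key _).mpr ((dvd_abs d d).mpr dvd_rfl),
    fun n h => (abs_dvd d n).mpr ((key n).mp h)⟩

variable [Algebra k R₀] [Algebra k R] [IsScalarTower k R₀ R] [Algebra.FiniteType k R₀]
  [Algebra.FiniteType k R]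

/-- Modulo the nilradical of `B` the map `g` becomes surjective, and injectivity of `g` makes the
kernel nil. -/
theorem affCls_of_injective_of_isNilpotent_sub {A B : Type u} [CommRing A] [Algebra k A]
    [Algebra.FiniteType k A] [CommRing B] [Algebra k B] [Algebra.FiniteType k B]
    (g : A →ₐ[k] B) (hg : Function.Injective g) (h : ∀ b, ∃ a, IsNilpotent (b - g a)) :
    affCls k A = affCls k B := by
  let q := Ideal.Quotient.mkₐ k (nilradical B)
  have hq : affCls k B = affCls k (B ⧸ nilradical B) :=
    affCls_of_surjective_of_ker_le q (Ideal.Quotient.mkₐ_surjective k _)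
      (Ideal.mk_ker (I := nilradical B)).le
  rw [hq]
  refine affCls_of_surjective_of_ker_le (q.comp g) (fun y => ?_) fun x hx => ?_
  · obtain ⟨b, rfl⟩ := Ideal.Quotient.mkₐ_surjective k _ y
    obtain ⟨a, ha⟩ := h b
    exact ⟨a, (Ideal.Quotient.eq.mpr ha).symm⟩
  · have : IsNilpotent (g x) := mem_nilradical.mp (Ideal.Quotient.eq_zero_iff_mem.mp hx)
    exact (IsNilpotent.map_iff hg).mp this

attribute [local instance] Polynomial.algebra in
-- Inverting `aX` inverts both `a` and `X`, so the localization is the Laurent polynomial ring over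
-- `A_a`.
theorem affCls_away_C_mul_X {A : Type u} [CommRing A] [Algebra k A] [Algebra.FiniteType k A]
    (a : A) : affCls k (Localization.Away (Polynomial.C a * Polynomial.X)) =
      (lefschetz k - 1) * affCls k (Localization.Away a) := by
  rw [← affCls_laurent]
  let S := Localization.Away a
  let i : Algebra (Polynomial A) (LaurentPolynomial S) :=
    ((algebraMap (Polynomial S) (LaurentPolynomial S)).comp
      (algebraMap (Polynomial A) (Polynomial S))).toAlgebra
  have : IsScalarTower (Polynomial A) (Polynomial S) (LaurentPolynomial S) := .of_algebraMap_eq' rfl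
  have : IsScalarTower k (Polynomial A) (LaurentPolynomial S) := .of_algebraMap_eq fun x => by
    change _ = algebraMap (Polynomial S) (LaurentPolynomial S)
      (algebraMap (Polynomial A) (Polynomial S) (algebraMap k (Polynomial A) x))
    rw [Polynomial.algebraMap_apply, Polynomial.algebraMap_def, Polynomial.coe_mapRingHom,
      Polynomial.map_C, LaurentPolynomial.algebraMap_eq_toLaurent, Polynomial.toLaurent_C,
      LaurentPolynomial.algebraMap_apply, ← IsScalarTower.algebraMap_apply]
  have h1 : IsLocalization.Away (Polynomial.C a) (Polynomial S) := by
    have := Polynomial.isLocalization (Submonoid.powers a) S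
    rwa [Submonoid.map_powers] at this
  have h2 : IsLocalization.Away (algebraMap (Polynomial A) (Polynomial S) Polynomial.X)
      (LaurentPolynomial S) := by
    rw [Polynomial.algebraMap_def, Polynomial.coe_mapRingHom, Polynomial.map_X]
    infer_instance
  have h3 : IsLocalization.Away (Polynomial.C a * Polynomial.X) (LaurentPolynomial S) :=
    IsLocalization.Away.mul' (Polynomial S) _ _ _
  exact affCls_congr ((IsLocalization.algEquiv
    (Submonoid.powers (Polynomial.C a * Polynomial.X)) _ (LaurentPolynomial S)).restrictScalars k)

/-- The homomorphism `(R₀ / p)[X] → R / p R` with `X ↦ u`. -/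
def quotientEvalHom (p : Ideal R₀) (u : R) :
    Polynomial (R₀ ⧸ p) →ₐ[k] R ⧸ p.map (algebraMap R₀ R) :=
  { Polynomial.eval₂RingHom (Ideal.quotientMap (p.map (algebraMap R₀ R)) (algebraMap R₀ R)
      Ideal.le_comap_map) (Ideal.Quotient.mk _ u) with
    commutes' := fun x => by
      change Polynomial.eval₂ _ _ (algebraMap k _ x) = _
      rw [Polynomial.algebraMap_apply, Polynomial.eval₂_C,
        IsScalarTower.algebraMap_apply k R₀ (R₀ ⧸ p), Ideal.Quotient.algebraMap_eq,
        Ideal.quotientMap_mk, ← IsScalarTower.algebraMap_apply k R₀ R]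
      rfl }

theorem quotientEvalHom_X (p : Ideal R₀) (u : R) :
    quotientEvalHom (k := k) p u Polynomial.X = Ideal.Quotient.mk _ u :=
  Polynomial.eval₂_X _ _

theorem quotientEvalHom_C (p : Ideal R₀) (u : R) (c : R₀) :
    quotientEvalHom (k := k) p u (Polynomial.C (Ideal.Quotient.mk p c)) =
      Ideal.Quotient.mk _ (algebraMap R₀ R c) :=
  Polynomial.eval₂_C _ _

theorem quotientEvalHom_map_mk (p : Ideal R₀) (u : R) (P : Polynomial R₀) :
    quotientEvalHom (k := k) p u (P.map (Ideal.Quotient.mk p)) =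
      Ideal.Quotient.mk _ (Polynomial.aeval u P) := by
  induction P using Polynomial.induction_on' with
  | add P Q hP hQ => rw [Polynomial.map_add, map_add, hP, hQ, map_add, map_add]
  | monomial n c =>
    rw [Polynomial.map_monomial, ← Polynomial.C_mul_X_pow_eq_monomial, map_mul, map_pow,
      quotientEvalHom_X, quotientEvalHom_C, Polynomial.aeval_monomial, map_mul, map_pow]

/-- The terms `c_i u ^ i` have distinct degrees `i * d`, so if their sum is in `pR`, each of them
is. Multiplying by `v ^ i` gives `c_i s ^ i ∈ pR ∩ R₀ = p`, and `s ∉ p`. -/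
theorem quotientEvalHom_injective (h0 : ∀ x ∈ 𝒜 0, x ∈ Set.range (algebraMap R₀ R))
    (hinj : Function.Injective (algebraMap R₀ R)) (p : Ideal R₀) [p.IsPrime] {d : ℤ} (hd : 0 < d)
    {u v : R} (hu : u ∈ 𝒜 d) {s : R₀} (hs : s ∉ p)
    (huv : u * v = algebraMap R₀ R s) :
    Function.Injective (quotientEvalHom (k := k) p u) := by
  rw [injective_iff_map_eq_zero]
  intro P hP
  obtain ⟨P, rfl⟩ := Polynomial.map_surjective _ Ideal.Quotient.mk_surjective P
  rw [quotientEvalHom_map_mk, Ideal.Quotient.eq_zero_iff_mem] at hP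
  ext i
  rw [Polynomial.coeff_map, Polynomial.coeff_zero, Ideal.Quotient.eq_zero_iff_mem]
  have hmem : ∀ j : ℕ, algebraMap R₀ R (P.coeff j) * u ^ j ∈ 𝒜 (j * d) := fun j => by
    have := SetLike.mul_mem_graded (algebraMap_mem_zero 𝒜 (P.coeff j)) (SetLike.pow_mem_graded j hu)
    rwa [zero_add, nsmul_eq_mul] at this
  have h1 := decompose_mem_map 𝒜 hP (i * d)
  have h2 : (DirectSum.decompose 𝒜 (Polynomial.aeval u P) (i * d) : R) =
      algebraMap R₀ R (P.coeff i) * u ^ i := by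
    rw [Polynomial.aeval_eq_sum_range, DirectSum.decompose_sum, DFinsupp.finsetSum_apply,
      AddSubmonoidClass.coe_finsetSum, Finset.sum_eq_single i]
    · rw [Algebra.smul_def, DirectSum.decompose_of_mem_same 𝒜 (hmem i)]
    · intro j _ hj
      rw [Algebra.smul_def, DirectSum.decompose_of_mem_ne 𝒜 (hmem j)]
      intro h
      exact hj (Nat.cast_injective (mul_right_cancel₀ hd.ne' h))
    · intro hi
      rw [Polynomial.coeff_eq_zero_of_natDegree_lt (by simpa [Nat.lt_succ_iff] using hi)]
      simp
  rw [h2] at h1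
  have h3 : algebraMap R₀ R (P.coeff i * s ^ i) ∈ p.map (algebraMap R₀ R) := by
    have := Ideal.mul_mem_right (v ^ i) _ h1
    rwa [mul_assoc, ← mul_pow, huv, ← map_pow, ← map_mul] at this
  exact (Ideal.IsPrime.mem_or_mem ‹_› (mem_of_algebraMap_mem_map 𝒜 h0 hinj h3)).resolve_right
    fun h => hs (Ideal.IsPrime.mem_of_pow_mem ‹_› _ h)

/-- With `u` of least positive good degree `d` and `uv = s`, the map `(R₀/p)[X]_{sX} → (R/pR)_s`, `X
↦ u`, is injective. It is onto up to nilpotents: for homogeneous `r`, the power `r ^ d` times a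
suitable power of `u` or `v` is some `c ∈ R₀`. If `c ∈ p`, then `r` is nilpotent. If not, the degree
of `r` is good, hence a multiple of `d`, and `r` itself is reached. -/
theorem exists_affCls_away_of_isPrime (h0 : ∀ x ∈ 𝒜 0, x ∈ Set.range (algebraMap R₀ R))
    (hinj : Function.Injective (algebraMap R₀ R))
    (hpos : Ideal.span {x : R | ∃ n > 0, x ∈ 𝒜 n} = ⊤) (p : Ideal R₀) [p.IsPrime] :
    ∃ s ∉ p, affCls k (Localization.Away
        (Ideal.Quotient.mk (p.map (algebraMap R₀ R)) (algebraMap R₀ R s))) =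
      (lefschetz k - 1) * affCls k (Localization.Away (Ideal.Quotient.mk p s)) := by
  obtain ⟨d, hd, ⟨u, hu, v, hv, s, hs, huv⟩, hdvd⟩ := exists_isGoodDegree_dvd h0 hinj hpos p
  refine ⟨s, hs, ?_⟩
  rw [← affCls_away_C_mul_X]
  symm
  set s' : R₀ ⧸ p := Ideal.Quotient.mk p s with hs'
  let φ := quotientEvalHom (k := k) p u
  let L := Localization.Away
        (Ideal.Quotient.mk (p.map (algebraMap R₀ R)) (algebraMap R₀ R s))
  let ι : R →+* L := (algebraMap _ L).comp (Ideal.Quotient.mk (p.map (algebraMap R₀ R)))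
  have hιs : IsUnit (ι (algebraMap R₀ R s)) := 
    IsLocalization.Away.algebraMap_isUnit (S := L)
      (Ideal.Quotient.mk (p.map (algebraMap R₀ R)) (algebraMap R₀ R s))
  have hιp : ∀ c ∈ p, ι (algebraMap R₀ R c) = 0 := fun c hc => by
    have : Ideal.Quotient.mk (p.map (algebraMap R₀ R)) (algebraMap R₀ R c) = 0 :=
      Ideal.Quotient.eq_zero_iff_mem.mpr (Ideal.mem_map_of_mem _ hc)
    simp [ι, this]
  have hιu : IsUnit (ι u) := isUnit_of_mul_isUnit_left (y := ι v) (by rwa [← map_mul, huv])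
  have hιv : IsUnit (ι v) := isUnit_of_mul_isUnit_right (x := ι u) (by rwa [← map_mul, huv])
  -- Inverting `s` already makes `u` a unit, so `L` also inverts the image of `sX`.
  have : IsLocalization.Away (φ (Polynomial.C s' * Polynomial.X)) L := by
    have e : φ (Polynomial.C s' * Polynomial.X) =
        Ideal.Quotient.mk _ (algebraMap R₀ R s) * Ideal.Quotient.mk _ u := by
      rw [map_mul, quotientEvalHom_X, hs', quotientEvalHom_C]
    rw [e]
    exact IsLocalization.Away.mul_of_isUnit _ _ hιu
  let g : Localization.Away (Polynomial.C s' * Polynomial.X) →ₐ[k] L :=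
    IsLocalization.Away.mapₐ _ L φ (Polynomial.C s' * Polynomial.X)
  have hg : ∀ P, g (algebraMap _ _ P) = algebraMap _ L (φ P) := fun P => by
    simp only [g, IsLocalization.Away.mapₐ_apply, IsLocalization.Away.map]
    exact IsLocalization.map_eq _ P
  have hC : ∀ c, ι (algebraMap R₀ R c) ∈ g.range := fun c =>
    ⟨algebraMap _ _ (Polynomial.C (Ideal.Quotient.mk p c)), by
      rw [AlgHom.toRingHom_eq_coe, RingHom.coe_coe, hg, quotientEvalHom_C]; rfl⟩
  have hX : ι u ∈ g.range := ⟨algebraMap _ _ Polynomial.X, by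
      rw [AlgHom.toRingHom_eq_coe, RingHom.coe_coe, hg, quotientEvalHom_X]; rfl⟩
  obtain ⟨z, hz, hz'⟩ : ∃ z ∈ g.range, ι u * z * ι (algebraMap R₀ R s) = 1 := by
    refine ⟨_, ⟨IsLocalization.Away.invSelf (Polynomial.C s' * Polynomial.X), rfl⟩, ?_⟩
    have e : algebraMap _ L (φ (Polynomial.C s' * Polynomial.X)) =
        ι (algebraMap R₀ R s) * ι u := by
      rw [map_mul, quotientEvalHom_X, hs', quotientEvalHom_C, map_mul]; rfl
    have := congrArg g (IsLocalization.Away.mul_invSelf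
      (S := Localization.Away (Polynomial.C s' * Polynomial.X)) (Polynomial.C s' * Polynomial.X))
    rw [map_mul, hg, e, map_one] at this
    rw [← this, AlgHom.toRingHom_eq_coe, RingHom.coe_coe]
    ring
  obtain ⟨u', hu'r, hu'⟩ : ∃ u' ∈ g.range, ι u * u' = 1 :=
    ⟨z * ι (algebraMap R₀ R s), mul_mem hz (hC s), by rw [← hz']; ring⟩
  -- It is not known that `v` comes from the source, but its inverse does: from `uv = s` and `u z s
  -- = 1` one gets `v · (u z u) = 1`.
  obtain ⟨v', hv'r, hv'⟩ : ∃ v' ∈ g.range, ι v * v' = 1 :=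
    ⟨ι u * z * ι u, mul_mem (mul_mem hX hz) hX, by
      have huv' : ι u * ι v = ι (algebraMap R₀ R s) := by rw [← map_mul, huv]
      linear_combination hz' + ι u * z * huv'⟩
  -- `w` is the power of `u` or `v` that moves degree `n * d` to zero.
  have hdivide : ∀ (n : ℤ) (r : R), r ∈ 𝒜 (n * d) → ∃ (w : R) (w' : L) (c : R₀), w ∈ 𝒜 (-(n * d)) ∧
      w' ∈ g.range ∧ ι w * w' = 1 ∧ r * w = algebraMap R₀ R c := by
    intro n r hr
    suffices h : ∃ (w : R) (w' : L), w ∈ 𝒜 (-(n * d)) ∧ w' ∈ g.range ∧ ι w * w' = 1 by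
      obtain ⟨w, w', hw, hw', e⟩ := h
      obtain ⟨c, hc⟩ := h0 (r * w) (by simpa using SetLike.mul_mem_graded hr hw)
      exact ⟨w, w', c, hw, hw', e, hc.symm⟩
    obtain ⟨m, rfl | rfl⟩ := n.eq_nat_or_neg
    · refine ⟨v ^ m, v' ^ m, ?_, pow_mem hv'r _, by rw [map_pow, ← mul_pow, hv', one_pow]⟩
      simpa using SetLike.pow_mem_graded m hv
    · refine ⟨u ^ m, u' ^ m, ?_, pow_mem hu'r _, by rw [map_pow, ← mul_pow, hu', one_pow]⟩
      simpa using SetLike.pow_mem_graded m hu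
  refine affCls_of_injective_of_isNilpotent_sub g
    (IsLocalization.Away.mapₐ_injective_of_injective _
      (quotientEvalHom_injective h0 hinj p hd hu hs huv)) ?_
  · have hhom : ∀ (n : ℤ) (r : R), r ∈ 𝒜 n → ι r ∈ g.range ∨ IsNilpotent (ι r) := by
      intro n r hr
      obtain ⟨w, w', c, hw, hw', hww', e⟩ := hdivide n (r ^ d.toNat) (by
        have := SetLike.pow_mem_graded d.toNat hr
        rwa [nsmul_eq_mul, Int.toNat_of_nonneg hd.le, mul_comm] at this)
      by_cases hc : c ∈ p
      · right
        refine ⟨d.toNat, ?_⟩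
        rw [← map_pow, ← mul_one (ι _), ← hww', ← mul_assoc, ← map_mul, e, hιp c hc, zero_mul]
      · left
        -- `r` pairs with `r ^ (d - 1) * w` to `c ∉ p`.
        have hn : IsGoodDegree 𝒜 p n := by
          have hd1 : (d.toNat - 1) + 1 = d.toNat := by omega
          refine ⟨r, hr, r ^ (d.toNat - 1) * w, ?_, c, hc, ?_⟩
          · have := SetLike.mul_mem_graded (SetLike.pow_mem_graded (d.toNat - 1) hr) hw
            convert this using 2
            rw [nsmul_eq_mul, Nat.cast_sub (by omega), Int.toNat_of_nonneg hd.le]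
            push_cast; ring
          · rw [← e, ← mul_assoc, ← pow_succ', hd1]
        obtain ⟨m, rfl⟩ := hdvd n hn
        obtain ⟨w, w', c, hw, hw', hww', e⟩ := hdivide m r (by rwa [mul_comm])
        have : ι r = ι (algebraMap R₀ R c) * w' := by
          rw [← e, map_mul, mul_assoc, hww', mul_one]
        rw [this]
        exact mul_mem (hC c) hw'
    have hR : ∀ r : R, ∃ a, IsNilpotent (ι r - g a) := by
      intro r
      induction r using DirectSum.Decomposition.inductionOn 𝒜 with
      | zero => exact ⟨0, by simp⟩
      | @homogeneous n r =>
        obtain ⟨a, ha⟩ | h := hhom n r r.2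
        · exact ⟨a, by rw [← ha]; simp⟩
        · exact ⟨0, by simpa using h⟩
      | add x y hx hy =>
        obtain ⟨a, ha⟩ := hx
        obtain ⟨b, hb⟩ := hy
        refine ⟨a + b, ?_⟩
        rw [map_add, map_add, add_sub_add_comm]
        exact (Commute.all _ _).isNilpotent_add ha hb
    intro y
    obtain ⟨b, ⟨_, m, rfl⟩, rfl⟩ := IsLocalization.exists_mk'_eq (Submonoid.powers
      (Ideal.Quotient.mk (p.map (algebraMap R₀ R)) (algebraMap R₀ R s))) y
    obtain ⟨r, rfl⟩ := Ideal.Quotient.mk_surjective b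
    obtain ⟨a, ha⟩ := hR r
    obtain ⟨e, he⟩ := mul_mem hX hz
    have he' : g e * ι (algebraMap R₀ R s) = 1 := by
      rw [← hz', ← he]; rfl
    refine ⟨a * e ^ m, ?_⟩
    have hmk : IsLocalization.mk' L (Ideal.Quotient.mk (p.map (algebraMap R₀ R)) r)
        (⟨_, m, rfl⟩ : Submonoid.powers
          (Ideal.Quotient.mk (p.map (algebraMap R₀ R)) (algebraMap R₀ R s))) = ι r * g e ^ m := by
      rw [IsLocalization.mk'_eq_iff_eq_mul]
      have : algebraMap _ L (Ideal.Quotient.mk (p.map (algebraMap R₀ R)) (algebraMap R₀ R s) ^ m) =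
        ι (algebraMap R₀ R s) ^ m := map_pow _ _ _
      change ι r = _ * algebraMap _ L (Ideal.Quotient.mk (p.map (algebraMap R₀ R))
        (algebraMap R₀ R s) ^ m)
      rw [this, mul_assoc, ← mul_pow, he', one_pow, mul_one]
    change IsNilpotent (IsLocalization.mk' L _ _ - _)
    rw [hmk, map_mul, map_pow, ← sub_mul]
    exact (Commute.all _ _).isNilpotent_mul_right ha

/-- Noetherian induction on `J`. A prime `J` is handled on the open set where some `s ∉ J` is
invertible, leaving the larger ideal `J + (s)`. Any other proper `J` contains a product `ab` with
`a, b ∉ J`, and inclusion-exclusion reduces it to larger ideals. -/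
theorem affCls_quotient_map (h0 : ∀ x ∈ 𝒜 0, x ∈ Set.range (algebraMap R₀ R))
    (hinj : Function.Injective (algebraMap R₀ R))
    (hpos : Ideal.span {x : R | ∃ n > 0, x ∈ 𝒜 n} = ⊤) (J : Ideal R₀) :
    affCls k (R ⧸ J.map (algebraMap R₀ R)) = (lefschetz k - 1) * affCls k (R₀ ⧸ J) := by
  have : IsNoetherianRing R₀ := Algebra.FiniteType.isNoetherianRing k R₀
  have hcongr : ∀ {I J : Ideal R}, I = J → affCls k (R ⧸ I) = affCls k (R ⧸ J) := by
    rintro I _ rfl; rfl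
  have hmap : ∀ (I : Ideal R₀) (a : R₀), (I ⊔ Ideal.span {a}).map (algebraMap R₀ R) =
      I.map (algebraMap R₀ R) ⊔ Ideal.span {algebraMap R₀ R a} := fun I a => by
    rw [Ideal.map_sup, Ideal.map_span, Set.image_singleton]
  induction J using IsNoetherian.induction with | _ J ih
  have hlt : ∀ {a}, a ∉ J → J < J ⊔ Ideal.span {a} := fun {a} ha =>
    lt_of_le_of_ne le_sup_left fun h => ha (h ▸ Ideal.mem_sup_right (Ideal.mem_span_singleton_self a))
  by_cases hJ : J = ⊤
  · subst hJ
    have : Subsingleton (R ⧸ (⊤ : Ideal R₀).map (algebraMap R₀ R)) := by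
      rw [Ideal.map_top]; infer_instance
    rw [affCls_of_subsingleton, affCls_of_subsingleton, mul_zero]
  by_cases hp : Ideal.IsPrime J
  · obtain ⟨s, hs, e⟩ := exists_affCls_away_of_isPrime (k := k) h0 hinj hpos J
    rw [affCls_quotient_add_away_quotient J s, affCls_quotient_add_away_quotient _
      (algebraMap R₀ R s), e, mul_add, ← ih _ (hlt hs), hcongr (hmap J s)]
  · obtain ⟨a, ha, b, hb, hab⟩ : ∃ a ∉ J, ∃ b ∉ J, a * b ∈ J := by
      rw [Ideal.isPrime_iff] at hp
      push Not at hp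
      obtain ⟨a, b, h1, h2, h3⟩ := hp hJ
      exact ⟨a, h2, b, h3, h1⟩
    rw [affCls_quotient_of_mul_mem hab, affCls_quotient_of_mul_mem (A := R)
      (a := algebraMap R₀ R a) (b := algebraMap R₀ R b)
      (by rw [← map_mul]; exact Ideal.mem_map_of_mem _ hab),
      ← hcongr (hmap J a), ← hcongr (hmap J b), ih _ (hlt ha), ih _ (hlt hb),
      ← hcongr ((hmap _ a).trans (by rw [hmap J b])), ih _ ((hlt hb).trans_le le_sup_left)]
    ring

end Graded

/-! ### Gluing classes over affine open subsets -/

section Gluing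

variable {k : Type u} [Field k]

/-- The structure of a `k`-algebra on the sections of a `k`-scheme. -/
instance sectionsAlgebra (Y : SchemeOver k) (U : Y.left.Opens) : Algebra k Γ(Y.left, U) :=
  ((Scheme.ΓSpecIso (CommRingCat.of k)).inv ≫ Y.hom.appLE ⊤ U le_top).hom.toAlgebra

theorem algebraMap_sections (Y : SchemeOver k) (U : Y.left.Opens) :
    algebraMap k Γ(Y.left, U) =
      ((Scheme.ΓSpecIso (CommRingCat.of k)).inv ≫ Y.hom.appLE ⊤ U le_top).hom := rfl

theorem fromSpec_comp_hom (Y : SchemeOver k) {U : Y.left.Opens} (hU : IsAffineOpen U) :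
    hU.fromSpec ≫ Y.hom = Spec.map (CommRingCat.ofHom (algebraMap k Γ(Y.left, U))) := by
  rw [algebraMap_sections, CommRingCat.ofHom_hom, Spec.map_comp,
    ← IsAffineOpen.SpecMap_appLE_fromSpec Y.hom (isAffineOpen_top _) hU le_top,
    IsAffineOpen.fromSpec_top, Scheme.isoSpec_Spec_inv]

/-- The inclusion of an affine open subscheme, as a morphism of `k`-schemes. -/
def fromSpecOver (Y : SchemeOver k) {U : Y.left.Opens} (hU : IsAffineOpen U) :
    specOver k Γ(Y.left, U) ⟶ Y :=
  Over.homMk hU.fromSpec (fromSpec_comp_hom Y hU)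

/-- An open subscheme of a `k`-scheme, as a `k`-scheme. -/
abbrev openSub (Y : SchemeOver k) (U : Y.left.Opens) : SchemeOver k := Over.mk (U.ι ≫ Y.hom)

theorem IsSepFiniteType.isNoetherian {Y : SchemeOver k} (hY : IsSepFiniteType Y) :
    IsNoetherian Y.left := by
  have := hY.locallyOfFiniteType
  have := hY.quasiCompact
  have : IsLocallyNoetherian Y.left := LocallyOfFiniteType.isLocallyNoetherian Y.hom
  have : CompactSpace Y.left := QuasiCompact.compactSpace_of_compactSpace Y.hom
  exact {}

theorem IsSepFiniteType.openSub {Y : SchemeOver k} (hY : IsSepFiniteType Y) (U : Y.left.Opens) :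
    IsSepFiniteType (openSub Y U) := by
  have := hY.isSeparated
  have := hY.locallyOfFiniteType
  have := hY.quasiCompact
  have := hY.isNoetherian
  exact ⟨by dsimp; infer_instance, by dsimp; infer_instance, by dsimp; infer_instance⟩

theorem IsSepFiniteType.finiteType {Y : SchemeOver k} (hY : IsSepFiniteType Y) {U : Y.left.Opens}
    (hU : IsAffineOpen U) : Algebra.FiniteType k Γ(Y.left, U) := by
  have := hY.locallyOfFiniteType
  rw [← RingHom.finiteType_algebraMap, algebraMap_sections, CommRingCat.hom_comp]
  exact (Y.hom.finiteType_appLE (isAffineOpen_top _) hU le_top).comp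
    (RingHom.FiniteType.of_surjective _
      (ConcreteCategory.bijective_of_isIso (Scheme.ΓSpecIso (CommRingCat.of k)).inv).2)

theorem cls_openSub_top {Y : SchemeOver k} (hY : IsSepFiniteType Y) :
    K0Var.cls (openSub Y ⊤) (hY.openSub ⊤) = K0Var.cls Y hY :=
  cls_congr (Over.isoMk (Scheme.topIso Y.left)) _ _

theorem cls_openSub_bot {Y : SchemeOver k} (hY : IsSepFiniteType Y) :
    K0Var.cls (openSub Y ⊥) (hY.openSub ⊥) = 0 := by
  have : IsEmpty (openSub Y ⊥).left := ⟨fun x => x.2⟩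
  exact cls_of_isEmpty _

/-- `U \ V` is closed in `U ∪ V` with open complement `V`. By `hJ` it is the zero locus of `J` in
`U`; the scheme structure that `J` puts on it is irrelevant. -/
theorem cls_openSub_sup {Y : SchemeOver k} (hY : IsSepFiniteType Y) (V : Y.left.Opens)
    {U : Y.left.Opens} (hU : IsAffineOpen U) (J : Ideal Γ(Y.left, U))
    (hJ : ∀ x ∈ U, x ∈ V ↔ ∃ a ∈ J, x ∈ Y.left.basicOpen a)
    [Algebra.FiniteType k Γ(Y.left, U)] :
    K0Var.cls (openSub Y (U ⊔ V)) (hY.openSub _) =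
      affCls k (Γ(Y.left, U) ⧸ J) + K0Var.cls (openSub Y V) (hY.openSub _) := by
  let i₀ : specOver k (Γ(Y.left, U) ⧸ J) ⟶ Y :=
    specOverMap (Ideal.Quotient.mkₐ k J) ≫ fromSpecOver Y hU
  have hr₀ : Set.range i₀.left = {x | x ∈ U ∧ x ∉ V} := by
    have h1 : i₀.left = Spec.map (CommRingCat.ofHom (Ideal.Quotient.mk J)) ≫ hU.fromSpec := rfl
    have h2 : Set.range (Spec.map (CommRingCat.ofHom (Ideal.Quotient.mk J))) =
        PrimeSpectrum.zeroLocus (RingHom.ker (Ideal.Quotient.mk J)) :=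
      range_comap_of_surjective _ _ Ideal.Quotient.mk_surjective
    rw [h1, Scheme.Hom.comp_base, TopCat.coe_comp, Set.range_comp, h2, Ideal.mk_ker,
      IsAffineOpen.fromSpec_image_zeroLocus]
    ext x
    simp only [Set.mem_inter_iff, Scheme.mem_zeroLocus_iff, SetLike.mem_coe, Set.mem_ofPred_eq]
    constructor
    · rintro ⟨h1, h2⟩
      exact ⟨h2, fun hV => by obtain ⟨a, ha, hx⟩ := (hJ x h2).mp hV; exact h1 a ha hx⟩
    · rintro ⟨h1, h2⟩
      exact ⟨fun a ha hx => h2 ((hJ x h1).mpr ⟨a, ha, hx⟩), h1⟩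
  have hle : Set.range i₀.left ⊆ Set.range (U ⊔ V).ι := by
    rw [hr₀, Scheme.Opens.range_ι]
    exact fun x hx => Or.inl hx.1
  have hι : IsImmersion i₀.left := by
    have : IsClosedImmersion (Spec.map (CommRingCat.ofHom (Ideal.Quotient.mk J))) :=
      IsClosedImmersion.spec_of_surjective _ Ideal.Quotient.mk_surjective
    exact inferInstanceAs
      (IsImmersion (Spec.map (CommRingCat.ofHom (Ideal.Quotient.mk J)) ≫ hU.fromSpec))
  let i : specOver k (Γ(Y.left, U) ⧸ J) ⟶ openSub Y (U ⊔ V) :=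
    Over.homMk (IsOpenImmersion.lift (U ⊔ V).ι i₀.left hle) (by
      dsimp
      rw [IsOpenImmersion.lift_fac_assoc]
      exact Over.w i₀)
  let j : openSub Y V ⟶ openSub Y (U ⊔ V) := Over.homMk (Y.left.homOfLE le_sup_right)
  have hir : Set.range i.left = {x | x.1 ∉ V} := by
    have : (U ⊔ V).ι '' Set.range i.left = Set.range i₀.left := by
      rw [← Set.range_comp, ← TopCat.coe_comp, ← Scheme.Hom.comp_base]
      exact congrArg (fun f => Set.range f.base) (IsOpenImmersion.lift_fac (U ⊔ V).ι i₀.left hle)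
    rw [← Set.preimage_image_eq (Set.range i.left) (U ⊔ V).ι.isOpenEmbedding.injective, this, hr₀]
    ext ⟨x, hx⟩
    exact ⟨fun h => h.2, fun h => ⟨hx.resolve_right h, h⟩⟩
  have hjr : Set.range j.left = {x | x.1 ∈ V} := by
    have : (U ⊔ V).ι '' Set.range j.left = V := by
      rw [← Set.range_comp, ← TopCat.coe_comp, ← Scheme.Hom.comp_base]
      exact (congrArg (fun f => Set.range f.base) (Scheme.homOfLE_ι _ le_sup_right)).trans
        (Scheme.Opens.range_ι V)
    rw [← Set.preimage_image_eq (Set.range j.left) (U ⊔ V).ι.isOpenEmbedding.injective, this]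
    rfl
  refine cls_scissors _ _ _ i j ?_ 
    (inferInstanceAs (IsOpenImmersion (Y.left.homOfLE le_sup_right))) ?_
  -- A preimmersion is a closed immersion as soon as its range is closed, and the range is the
  -- complement of `V` in `U ∪ V`.
  · rw [IsClosedImmersion.iff_isPreimmersion]
    constructor
    · have : IsPreimmersion (i.left ≫ (U ⊔ V).ι) := by
        have : i.left ≫ (U ⊔ V).ι = i₀.left := IsOpenImmersion.lift_fac _ _ _
        rw [this]; infer_instance
      exact IsPreimmersion.of_comp i.left (U ⊔ V).ι
    · rw [hir]
      exact (V.2.preimage (U ⊔ V).ι.continuous).isClosed_compl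
  · rw [hir, hjr]; ext; simp

theorem fromSpec_mem_basicOpen_iff {X : Scheme.{u}} {U : X.Opens} (hU : IsAffineOpen U)
    (P : PrimeSpectrum Γ(X, U)) (a : Γ(X, U)) :
    hU.fromSpec P ∈ X.basicOpen a ↔ a ∉ P.asIdeal := by
  have h : P ∈ hU.fromSpec ⁻¹ᵁ X.basicOpen a ↔ P ∈ PrimeSpectrum.basicOpen a := by
    rw [hU.fromSpec_preimage_basicOpen]; rfl
  exact h

theorem mem_basicOpen_iff_primeIdealOf {X : Scheme.{u}} {U : X.Opens} (hU : IsAffineOpen U)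
    {x : X} (hx : x ∈ U) (a : Γ(X, U)) :
    x ∈ X.basicOpen a ↔ a ∉ (hU.primeIdealOf ⟨x, hx⟩).asIdeal := by
  rw [← fromSpec_mem_basicOpen_iff hU, hU.fromSpec_primeIdealOf]

/-- A correspondence of affine open subsets: the classes of the unions agree up to the factor
`𝕃 - 1` if this holds over every closed subscheme of each member. -/
theorem cls_openSub_finsetSup {Y Q : SchemeOver k} (hY : IsSepFiniteType Y)
    (hQ : IsSepFiniteType Q) {ι : Type*} (U : ι → Y.left.Opens) (W : ι → Q.left.Opens)
    (hU : ∀ i, IsAffineOpen (U i)) (hW : ∀ i, IsAffineOpen (W i))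
    [∀ i, Algebra.FiniteType k Γ(Y.left, U i)] [∀ i, Algebra.FiniteType k Γ(Q.left, W i)]
    (φ : ∀ i, Γ(Y.left, U i) →+* Γ(Q.left, W i))
    (hφ : ∀ i (J : Ideal Γ(Y.left, U i)), affCls k (Γ(Q.left, W i) ⧸ J.map (φ i)) =
      (lefschetz k - 1) * affCls k (Γ(Y.left, U i) ⧸ J))
    (hUW : ∀ i j, ∀ w ∈ W i, w ∈ W j ↔
      ∃ a : Γ(Y.left, U i), Y.left.basicOpen a ≤ U j ∧ w ∈ Q.left.basicOpen (φ i a))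
    (s : Finset ι) :
    K0Var.cls (openSub Q (s.sup W)) (hQ.openSub _) =
      (lefschetz k - 1) * K0Var.cls (openSub Y (s.sup U)) (hY.openSub _) := by
  classical
  -- `y` is the image of `w` under the morphism of affine schemes given by `φ i`.
  have hpt : ∀ i, ∀ w ∈ W i, ∃ y ∈ U i, ∀ a, y ∈ Y.left.basicOpen a ↔
      w ∈ Q.left.basicOpen (φ i a) := by
    intro i w hw
    let P := PrimeSpectrum.comap (φ i) ((hW i).primeIdealOf ⟨w, hw⟩)
    refine ⟨(hU i).fromSpec P, ?_, fun a => ?_⟩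
    · have := Set.mem_range_self (f := (hU i).fromSpec) P
      rwa [(hU i).range_fromSpec] at this
    · rw [fromSpec_mem_basicOpen_iff, mem_basicOpen_iff_primeIdealOf (hW i) hw]
      rfl
  induction s using Finset.induction_on with
  | empty => 
    change K0Var.cls (openSub Q ⊥) _ = _ * K0Var.cls (openSub Y ⊥) _
    rw [cls_openSub_bot hQ, cls_openSub_bot hY, mul_zero]
  | insert i s _ ih =>
    have hcY : K0Var.cls (openSub Y ((insert i s).sup U)) (hY.openSub _) =
      K0Var.cls (openSub Y (U i ⊔ s.sup U)) (hY.openSub _) := by simp only [Finset.sup_insert]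
    have hcQ : K0Var.cls (openSub Q ((insert i s).sup W)) (hQ.openSub _) =
      K0Var.cls (openSub Q (W i ⊔ s.sup W)) (hQ.openSub _) := by simp only [Finset.sup_insert]
    -- `J` cuts out of `U i` what the members of `s` leave uncovered; `hJQ` says that its extension
    -- does the same in `W i`.
    let J : Ideal Γ(Y.left, U i) :=
      { carrier := {a | Y.left.basicOpen a ≤ s.sup U}
        zero_mem' := by simp
        add_mem' := fun {a b} ha hb => (Y.left.basicOpen_add_le a b).trans (sup_le ha hb)
        smul_mem' := fun c a ha => by
          rw [Set.mem_ofPred_eq, smul_eq_mul, Scheme.basicOpen_mul]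
          exact inf_le_right.trans ha }
    have hmemU : ∀ y, y ∈ s.sup U ↔ ∃ j ∈ s, y ∈ U j := fun y => by
      rw [Finset.sup_eq_iSup]; simp
    have hmemW : ∀ y, y ∈ s.sup W ↔ ∃ j ∈ s, y ∈ W j := fun y => by
      rw [Finset.sup_eq_iSup]; simp
    have hJY : ∀ x ∈ U i, x ∈ s.sup U ↔ ∃ a ∈ J, x ∈ Y.left.basicOpen a := by
      intro x hx
      constructor
      · intro hxs
        obtain ⟨a, ha, hxa⟩ := (hU i).exists_basicOpen_le ⟨x, hxs⟩ hx
        exact ⟨a, ha, hxa⟩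
      · rintro ⟨a, ha, hxa⟩
        exact ha hxa
    have hJQ : ∀ x ∈ W i, x ∈ s.sup W ↔ ∃ a ∈ J.map (φ i), x ∈ Q.left.basicOpen a := by
      intro w hw
      constructor
      · rw [hmemW]
        rintro ⟨j, hj, hwj⟩
        obtain ⟨a, ha, hwa⟩ := (hUW i j w hw).mp hwj
        exact ⟨_, Ideal.mem_map_of_mem _ (show a ∈ J from ha.trans (Finset.le_sup hj)), hwa⟩
      · rintro ⟨b, hb, hwb⟩
        by_contra hws
        obtain ⟨y, hy, hya⟩ := hpt i w hw
        refine (mem_basicOpen_iff_primeIdealOf (hW i) hw b).mp hwb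
          (Ideal.map_le_iff_le_comap.mpr (fun a ha => ?_) hb)
        by_contra hc
        rw [Ideal.mem_comap, ← mem_basicOpen_iff_primeIdealOf, ← hya] at hc
        obtain ⟨j, hj, hyj⟩ := (hmemU y).mp (ha hc)
        obtain ⟨c, hc, hyc⟩ := (hU i).exists_basicOpen_le ⟨y, hyj⟩ hy
        exact hws ((hmemW w).mpr ⟨j, hj, (hUW i j w hw).mpr ⟨c, hc, (hya c).mp hyc⟩⟩)
    rw [hcY, hcQ, cls_openSub_sup hY _ (hU i) J hJY, cls_openSub_sup hQ _ (hW i) _ hJQ, ih, hφ]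
    ring

end Gluing

/-! ### Characteristic polynomials for a finite free groupoid -/

section Charpoly

open Polynomial

/-- The family `e` is a basis of `E` as a module over `C` by means of `s : C →+* E`. -/
def IsBasisOver {C E ι : Type*} [CommRing C] [CommRing E] (s : C →+* E) (e : ι → E) : Prop :=
  Function.Bijective fun c : ι →₀ C => c.sum fun i a => s a * e i

/-- The basis underlying `IsBasisOver`. -/
abbrev IsBasisOver.basis {C E ι : Type*} [CommRing C] [CommRing E] {s : C →+* E} {e : ι → E}
    (h : IsBasisOver s e) : letI := s.toAlgebra; Module.Basis ι C E :=
  letI := s.toAlgebra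
  .ofRepr (LinearEquiv.ofBijective (Finsupp.linearCombination C e) h).symm

theorem IsBasisOver.basis_apply {C E ι : Type*} [CommRing C] [CommRing E] {s : C →+* E} {e : ι → E}
    (h : IsBasisOver s e) (i : ι) : h.basis i = e i := by
  let := s.toAlgebra
  have := Finsupp.linearCombination_single C (v := e) (1 : C) i
  rw [one_smul] at this
  exact this

theorem isBasisOver_of_basis {C E ι : Type*} [CommRing C] [CommRing E] (s : C →+* E) :
    letI := s.toAlgebra; ∀ b : Module.Basis ι C E, IsBasisOver s b := by
  let := s.toAlgebra
  intro b
  have : (fun c : ι →₀ C => c.sum fun i a => s a * b i) = b.repr.symm :=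
    funext fun c => (b.repr_symm_apply c).symm
  rw [IsBasisOver, this]
  exact b.repr.symm.bijective

variable {C E ι : Type*} [CommRing C] [CommRing E] [Fintype ι] [DecidableEq ι]

/-- The matrix of multiplication by `x`. -/
def IsBasisOver.mulMatrix {s : C →+* E} {e : ι → E} (h : IsBasisOver s e) (x : E) : Matrix ι ι C :=
  letI := s.toAlgebra
  Algebra.leftMulMatrix h.basis x

theorem IsBasisOver.mul_eq {s : C →+* E} {e : ι → E} (h : IsBasisOver s e) (x : E) (j : ι) :
    x * e j = ∑ i, s (h.mulMatrix x i j) * e i := by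
  let := s.toAlgebra
  have := h.basis.sum_repr (x * e j)
  rw [← this]
  refine Finset.sum_congr rfl fun i _ => ?_
  rw [h.basis_apply, mulMatrix, Algebra.leftMulMatrix_eq_repr_mul, h.basis_apply]
  rfl

theorem IsBasisOver.mulMatrix_eq {s : C →+* E} {e : ι → E} (h : IsBasisOver s e) (x : E)
    (M : Matrix ι ι C) (hM : ∀ j, x * e j = ∑ i, s (M i j) * e i) : h.mulMatrix x = M := by
  let := s.toAlgebra
  ext i j
  rw [mulMatrix, Algebra.leftMulMatrix_eq_repr_mul, h.basis_apply, hM]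
  have : ∑ i, s (M i j) * e i = ∑ i, M i j • h.basis i :=
    Finset.sum_congr rfl fun i _ => by rw [h.basis_apply]; rfl
  rw [this, Module.Basis.repr_sum_self]

theorem IsBasisOver.charpoly_eq {s : C →+* E} {e e' : ι → E} (h : IsBasisOver s e)
    (h' : IsBasisOver s e') (x : E) : (h.mulMatrix x).charpoly = (h'.mulMatrix x).charpoly := by
  let := s.toAlgebra
  have : Module.Free C E := .of_basis h.basis
  have : Module.Finite C E := .of_basis h.basis
  rw [mulMatrix, mulMatrix, Algebra.leftMulMatrix_apply, Algebra.leftMulMatrix_apply,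
    LinearMap.charpoly_toMatrix, LinearMap.charpoly_toMatrix]

theorem IsBasisOver.eval₂_charpoly {s : C →+* E} {e : ι → E} (h : IsBasisOver s e) (x : E) :
    (h.mulMatrix x).charpoly.eval₂ s x = 0 := by
  let := s.toAlgebra
  have : Module.Free C E := .of_basis h.basis
  have : Module.Finite C E := .of_basis h.basis
  have h1 := LinearMap.aeval_self_charpoly (Algebra.lmul C E x)
  rw [← LinearMap.charpoly_toMatrix _ h.basis, ← Algebra.leftMulMatrix_apply,
    Polynomial.aeval_algHom_apply] at h1
  have h2 := congrArg (fun f => f 1) h1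
  simp only [Algebra.coe_lmul_eq_mul, LinearMap.mul_apply', mul_one, LinearMap.zero_apply] at h2
  exact h2

theorem IsBasisOver.mulMatrix_mem {s : C →+* E} {e : ι → E} (h : IsBasisOver s e) {J : Ideal C}
    {x : E} (hx : x ∈ J.map s) (i j : ι) : h.mulMatrix x i j ∈ J := by
  let := s.toAlgebra
  refine Submodule.span_induction (p := fun x _ => ∀ i j, h.mulMatrix x i j ∈ J) ?_ ?_ ?_ ?_ hx i j
  · rintro _ ⟨a, ha, rfl⟩ i j
    rw [h.mulMatrix_eq (s a) (Matrix.diagonal fun _ => a) fun j => by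
      rw [Finset.sum_eq_single j (fun i _ hi => by rw [Matrix.diagonal_apply_ne _ hi]; simp)
        (by simp), Matrix.diagonal_apply_eq]]
    rw [Matrix.diagonal_apply]
    split_ifs
    exacts [ha, J.zero_mem]
  · intro i j
    rw [mulMatrix, map_zero]
    exact J.zero_mem
  · intro x y _ _ hx hy i j
    have := J.add_mem (hx i j) (hy i j)
    rw [mulMatrix, map_add]
    exact this
  · intro a x _ hx i j
    have : h.mulMatrix (a * x) = h.mulMatrix a * h.mulMatrix x := map_mul _ _ _
    rw [smul_eq_mul, this, Matrix.mul_apply]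
    exact J.sum_mem fun l _ => J.mul_mem_left _ (hx _ _)

/-- Here `C` and `E` are the functions on objects and on arrows, `s` and `ρ` the two maps to
objects, `E₂` the functions on composable arrows, and `ε` the identities. Take the characteristic
polynomial `f` of multiplication by `ρ c` on `E` over `C`. Applying `ε` to Cayley-Hamilton gives
`f(c) = 0`. The base changes of `f` along `ρ` and along `s` are characteristic polynomials of the
same element of `E₂` in two bases, so they coincide. If `ρ c ∈ J E`, the matrix has entries in `J`.
-/
theorem exists_monic_of_groupoid {E₂ : Type*} [CommRing E₂] {s ρ : C →+* E} {p m₁ m₂ : E →+* E₂}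
    {ε : E →+* C} {e : ι → E} (h : IsBasisOver s e) (h₁ : IsBasisOver p (m₁ ∘ e))
    (h₂ : IsBasisOver p (m₂ ∘ e)) (c₁ : m₁.comp s = p.comp ρ) (c₂ : m₂.comp s = p.comp s)
    (c₃ : m₁.comp ρ = m₂.comp ρ) (hεs : ε.comp s = .id C) (hερ : ε.comp ρ = .id C)
    (c : C) (J : Ideal C) (hc : ρ c ∈ J.map s) :
    ∃ f : C[X], f.Monic ∧ f.eval c = 0 ∧ (∀ n, ρ (f.coeff n) = s (f.coeff n)) ∧
      ∀ n < f.natDegree, f.coeff n ∈ J := by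
  set M := h.mulMatrix (ρ c) with hM
  refine ⟨M.charpoly, M.charpoly_monic, ?_, fun n => ?_, fun n hn => ?_⟩
  · have := congrArg ε (h.eval₂_charpoly (ρ c))
    rw [Polynomial.hom_eval₂, hεs, ← RingHom.comp_apply, hερ, map_zero] at this
    exact this
  · have e₁ : h₁.mulMatrix (m₁ (ρ c)) = M.map ρ := h₁.mulMatrix_eq _ _ fun j => by
      rw [Function.comp_apply, ← map_mul, h.mul_eq, map_sum]
      refine Finset.sum_congr rfl fun i _ => ?_
      rw [map_mul, ← RingHom.comp_apply, c₁]; rfl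
    have e₂ : h₂.mulMatrix (m₂ (ρ c)) = M.map s := h₂.mulMatrix_eq _ _ fun j => by
      rw [Function.comp_apply, ← map_mul, h.mul_eq, map_sum]
      refine Finset.sum_congr rfl fun i _ => ?_
      rw [map_mul, ← RingHom.comp_apply, c₂]; rfl
    have e₃ : m₁ (ρ c) = m₂ (ρ c) := RingHom.congr_fun c₃ c
    have e₄ := h₁.charpoly_eq h₂ (m₁ (ρ c))
    rw [e₁, e₃, e₂, Matrix.charpoly_map, Matrix.charpoly_map] at e₄
    simpa using congrArg (fun f => f.coeff n) e₄
  · have hMJ : ∀ i j, M i j ∈ J := h.mulMatrix_mem hc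
    -- Modulo `J` the matrix vanishes and its characteristic polynomial is a power of `X`.
    have hmap : M.map (Ideal.Quotient.mk J) = 0 := by
      ext i j
      exact Ideal.Quotient.eq_zero_iff_mem.mpr (hMJ i j)
    have := Matrix.charpoly_map M (Ideal.Quotient.mk J)
    rw [hmap, Matrix.charpoly_zero] at this
    rw [← Ideal.Quotient.eq_zero_iff_mem, ← Polynomial.coeff_map, ← this, Polynomial.coeff_X_pow, if_neg]
    rintro rfl
    -- Over the zero ring `natDegree` is `0`, so there is no lower coefficient.
    rcases subsingleton_or_nontrivial C with hC | hC
    · simp [Polynomial.natDegree_of_subsingleton] at hn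
    exact hn.ne M.charpoly_natDegree_eq_dim.symm

end Charpoly

/-! ### Pullback of functions along morphisms of schemes over a field -/

section Pullback

variable {k : Type u} [Field k]

/-- Pullback of functions along a morphism of `k`-schemes. -/
def pull {X Y : SchemeOver k} (f : X ⟶ Y) {U : Y.left.Opens} {V : X.left.Opens}
    (h : V ≤ f.left ⁻¹ᵁ U) : Γ(Y.left, U) →+* Γ(X.left, V) :=
  (f.left.appLE U V h).hom

variable {X Y Z : SchemeOver k}

theorem le_preimage_comp (f : X ⟶ Y) (g : Y ⟶ Z) {U : Z.left.Opens} {V : Y.left.Opens}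
    {W : X.left.Opens} (h : V ≤ g.left ⁻¹ᵁ U) (h' : W ≤ f.left ⁻¹ᵁ V) :
    W ≤ (f ≫ g).left ⁻¹ᵁ U :=
  h'.trans (f.left.preimage_mono h)

theorem le_preimage_top (f : X ⟶ Y) (W : X.left.Opens) : W ≤ f.left ⁻¹ᵁ ⊤ := le_top

theorem le_preimage_id (W : X.left.Opens) : W ≤ (𝟙 X : X ⟶ X).left ⁻¹ᵁ W := le_rfl

theorem le_preimage_congr {f g : X ⟶ Y} (e : f = g) {U : Y.left.Opens} {V : X.left.Opens}
    (h : V ≤ f.left ⁻¹ᵁ U) : V ≤ g.left ⁻¹ᵁ U := e ▸ h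

theorem pull_pull (f : X ⟶ Y) (g : Y ⟶ Z) {U : Z.left.Opens} {V : Y.left.Opens}
    {W : X.left.Opens} (h : V ≤ g.left ⁻¹ᵁ U) (h' : W ≤ f.left ⁻¹ᵁ V) (a : Γ(Z.left, U)) :
    pull f h' (pull g h a) = pull (f ≫ g) (le_preimage_comp f g h h') a :=
  congr($(Scheme.Hom.appLE_comp_appLE f.left g.left U V W h h').hom a)

theorem pull_congr {f g : X ⟶ Y} (e : f = g) {U : Y.left.Opens} {V : X.left.Opens}
    (h : V ≤ f.left ⁻¹ᵁ U) (a : Γ(Y.left, U)) :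
    pull f h a = pull g (le_preimage_congr e h) a := by
  subst e; rfl

theorem pull_id {U : X.left.Opens} (h : U ≤ (𝟙 X : X ⟶ X).left ⁻¹ᵁ U) (a : Γ(X.left, U)) :
    pull (𝟙 X) h a = a := by
  have : (𝟙 X.left : X.left ⟶ X.left).appLE U U h = 𝟙 _ := by
    rw [Scheme.Hom.appLE, Scheme.Hom.id_app]
    exact (Category.id_comp _).trans (X.left.presheaf.map_id _)
  exact congr(($this).hom a)

theorem pull_algebraMap (f : X ⟶ Y) {U : Y.left.Opens} {V : X.left.Opens}
    (h : V ≤ f.left ⁻¹ᵁ U) (a : k) : pull f h (algebraMap k _ a) = algebraMap k _ a := by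
  rw [algebraMap_sections, algebraMap_sections]
  have := Scheme.Hom.appLE_comp_appLE f.left Y.hom ⊤ U V le_top h
  simp only [Over.w f] at this
  rw [← this]
  rfl

theorem basicOpen_pull (f : X ⟶ Y) {U : Y.left.Opens} {V : X.left.Opens}
    (h : V ≤ f.left ⁻¹ᵁ U) (a : Γ(Y.left, U)) :
    X.left.basicOpen (pull f h a) = V ⊓ f.left ⁻¹ᵁ Y.left.basicOpen a :=
  Scheme.basicOpen_appLE f.left V U h a

theorem isPullback_left (G Z : SchemeOver k) :
    IsPullback (fst G Z).left (snd G Z).left G.hom Z.hom :=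
  IsPullback.of_hasPullback G.hom Z.hom

theorem isAffineHom_snd_left (G Z : SchemeOver k) [IsAffineHom G.hom] :
    IsAffineHom (snd G Z).left :=
  MorphismProperty.of_isPullback (isPullback_left G Z) inferInstance

/-- The functions on `G × O` are `Γ(G) ⊗ₖ Γ(O)`, so a `k`-basis of `Γ(G)` stays a basis over `Γ(O)`.
-/
theorem isBasisOver_pull (G Z : SchemeOver k) [IsAffine G.left] {ι : Type*}
    (b : Module.Basis ι k Γ(G.left, ⊤)) {O : Z.left.Opens} (hO : IsAffineOpen O)
    {O' : (G ⊗ Z).left.Opens} (hO' : O' = (snd G Z).left ⁻¹ᵁ O) :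
    IsBasisOver (pull (snd G Z) hO'.le)
      (fun i => pull (fst G Z) (le_preimage_top (fst G Z) O') (b i)) := by
  have H : IsPullback (snd G Z).left (fst G Z).left Z.hom G.hom :=
    (isPullback_left G Z).flip
  have hp := (isIso_pushoutSection_iff H (US := ⊤) (UT := ⊤) (UX := O) (UY := O') le_top le_top
    (by rw [hO']; exact (inf_top_eq _).symm)).mp
    (isIso_pushoutSection_of_isAffineOpen H _ _ _ (isAffineOpen_top _) (isAffineOpen_top _) hO)
  let := (pull (snd G Z) hO'.le).toAlgebra
  let : Algebra Γ(G.left, ⊤) Γ((G ⊗ Z).left, O') :=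
    (pull (fst G Z) (le_preimage_top (fst G Z) O')).toAlgebra
  have : IsScalarTower k Γ(Z.left, O) Γ((G ⊗ Z).left, O') :=
    .of_algebraMap_eq fun x => (pull_algebraMap _ _ _).symm
  have : IsScalarTower k Γ(G.left, ⊤) Γ((G ⊗ Z).left, O') :=
    .of_algebraMap_eq fun x => (pull_algebraMap _ _ _).symm
  have hp' : IsPushout (CommRingCat.ofHom (algebraMap k Γ(Z.left, O)))
      (CommRingCat.ofHom (algebraMap k Γ(G.left, ⊤)))
      (CommRingCat.ofHom (algebraMap Γ(Z.left, O) Γ((G ⊗ Z).left, O')))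
      (CommRingCat.ofHom (algebraMap Γ(G.left, ⊤) Γ((G ⊗ Z).left, O'))) :=
    hp.of_iso (Scheme.ΓSpecIso (CommRingCat.of k)) (Iso.refl _) (Iso.refl _) (Iso.refl _)
      (by rw [algebraMap_sections, CommRingCat.ofHom_hom, Iso.hom_inv_id_assoc]; simp)
      (by rw [algebraMap_sections, CommRingCat.ofHom_hom, Iso.hom_inv_id_assoc]; simp)
      (by simp; rfl) (by simp; rfl)
  have := CommRingCat.isPushout_iff_isPushout.mp hp'
  have hb := isBasisOver_of_basis (pull (snd G Z) hO'.le) (this.out.basis b)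
  convert hb using 1
  funext i
  rw [IsBaseChange.basis_apply]
  rfl

end Pullback

/-! ### Group actions, invariant opens and invariant functions -/

section Action

open MonObj

variable {k : Type u} [Field k] {G : SchemeOver k} [GrpObj G] {X T : SchemeOver k} [ModObj G X]

theorem one_act (x : T ⟶ X) : act (1 : T ⟶ G) x = x := by
  have h : lift (1 : T ⟶ G) x = lift (toUnit T) x ≫ (η[G] ▷ X) := by
    rw [lift_whiskerRight]; rfl
  have := ModObj.one_smul (M := G) X
  rw [act, h, Category.assoc]
  erw [this]
  exact lift_leftUnitor_hom _ _

theorem mul_act (g h : T ⟶ G) (x : T ⟶ X) : act (g * h) x = act g (act h x) := by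
  have e : lift (g * h) x = lift (lift g h) x ≫ (μ[G] ▷ X) := by
    rw [lift_whiskerRight]; rfl
  have := ModObj.mul_smul (M := G) X
  rw [act, e, Category.assoc]
  erw [this]
  change lift (lift g h) x ≫ (α_ G G X).hom ≫ G ◁ actMap G X ≫ actMap G X = _
  rw [lift_lift_associator_hom_assoc, lift_whiskerLeft_assoc]

theorem comp_act {T' : SchemeOver k} (f : T' ⟶ T) (g : T ⟶ G) (x : T ⟶ X) :
    f ≫ act g x = act (f ≫ g) (f ≫ x) := by
  rw [act, ← Category.assoc, comp_lift]

theorem actMap_eq : actMap G X = act (fst G X) (snd G X) := by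
  rw [act, lift_fst_snd, Category.id_comp]

/-- An open subscheme is invariant if its preimages under the action and the projection agree. -/
def IsInvariantOpen (G : SchemeOver k) [GrpObj G] {X : SchemeOver k} [ModObj G X]
    (O : X.left.Opens) : Prop :=
  (actMap G X).left ⁻¹ᵁ O = (snd G X).left ⁻¹ᵁ O

/-- The functions on an invariant open subscheme which are invariant. -/
def invariants {O : X.left.Opens} (hO : IsInvariantOpen G O) : Subring Γ(X.left, O) :=
  RingHom.eqLocus (pull (actMap G X) hO.ge) (pull (snd G X) le_rfl)

theorem mem_invariants {O : X.left.Opens} (hO : IsInvariantOpen G O) (a : Γ(X.left, O)) :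
    a ∈ invariants hO ↔ pull (actMap G X) hO.ge a = pull (snd G X) le_rfl a := Iff.rfl

theorem IsBasisOver.comp_bijective {C E E' I : Type*} [CommRing C] [CommRing E] [CommRing E']
    {s : C →+* E} {e : I → E}
    (h : IsBasisOver s e) (τ : E →+* E') (hτ : Function.Bijective τ) :
    IsBasisOver (τ.comp s) (τ ∘ e) := by
  have := hτ.comp h
  rw [IsBasisOver]
  convert this using 1
  funext c
  simp [Finsupp.sum, map_sum]

theorem preimage_left_comp {X Y Z : SchemeOver k} (f : X ⟶ Y) (g : Y ⟶ Z) (U : Z.left.Opens) :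
    f.left ⁻¹ᵁ (g.left ⁻¹ᵁ U) = (f ≫ g).left ⁻¹ᵁ U := rfl

/-- `exists_monic_of_groupoid` for the action groupoid: `M₁` is `(g, h, x) ↦ (g, hx)` and `M₂` is
`(g, h, x) ↦ (gh, x)`, and both become `ghx` under the action. With `J = ⊤` only the integral
equation remains. -/
theorem exists_monic_of_isInvariantOpen [IsFinite G.hom] {O : X.left.Opens} (hO : IsAffineOpen O)
    (hinv : IsInvariantOpen G O) (c : Γ(X.left, O)) (J : Ideal Γ(X.left, O))
    (hc : pull (actMap G X) hinv.ge c ∈ J.map (pull (snd G X) le_rfl)) :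
    ∃ f : Polynomial Γ(X.left, O), f.Monic ∧ f.eval c = 0 ∧
      (∀ n, f.coeff n ∈ invariants hinv) ∧ ∀ n < f.natDegree, f.coeff n ∈ J := by
  have : IsAffine G.left := isAffine_of_isAffineHom G.hom
  have : Module.Finite k Γ(G.left, ⊤) := by
    rw [← RingHom.finite_algebraMap, algebraMap_sections, CommRingCat.hom_comp,
      show G.hom.appLE ⊤ ⊤ le_top = G.hom.appTop from Scheme.Hom.appLE_eq_app _]
    exact RingHom.Finite.comp G.hom.finite_appTop (.of_surjective _
      (ConcreteCategory.bijective_of_isIso (Scheme.ΓSpecIso (CommRingCat.of k)).inv).2)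
  let b := Module.finBasis k Γ(G.left, ⊤)
  let O₁ := (snd G X).left ⁻¹ᵁ O
  let O₂ := (snd G (G ⊗ X)).left ⁻¹ᵁ O₁
  have hO₁ : IsAffineOpen O₁ := by
    have := isAffineHom_snd_left G X
    exact hO.preimage (snd G X).left
  let M₁ : G ⊗ (G ⊗ X) ⟶ G ⊗ X := lift (fst _ _) (snd _ _ ≫ actMap G X)
  let M₂ : G ⊗ (G ⊗ X) ⟶ G ⊗ X := lift (fst _ _ * (snd _ _ ≫ fst _ _)) (snd _ _ ≫ snd _ _)
  -- The shear `(g, h, x) ↦ (gh, h, x)` is an automorphism over the last two factors; it carries the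
  -- standard basis to the one pulled back along `M₂`.
  let τ : G ⊗ (G ⊗ X) ⟶ G ⊗ (G ⊗ X) := lift (fst _ _ * (snd _ _ ≫ fst _ _)) (snd _ _)
  let τ' : G ⊗ (G ⊗ X) ⟶ G ⊗ (G ⊗ X) := lift (fst _ _ * (snd _ _ ≫ fst _ _)⁻¹) (snd _ _)
  have hττ' : τ ≫ τ' = 𝟙 _ := by
    simp only [τ, τ', comp_lift, MonObj.comp_mul, GrpObj.comp_inv, lift_fst, lift_snd,
      lift_snd_assoc, mul_inv_cancel_right, lift_fst_snd]
  have hτ'τ : τ' ≫ τ = 𝟙 _ := by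
    simp only [τ, τ', comp_lift, MonObj.comp_mul, lift_fst, lift_snd,
      lift_snd_assoc, inv_mul_cancel_right, lift_fst_snd]
  have hM₁ : O₂ ≤ M₁.left ⁻¹ᵁ O₁ := by
    rw [preimage_left_comp, lift_snd, ← preimage_left_comp, hinv]
  have hM₂ : O₂ ≤ M₂.left ⁻¹ᵁ O₁ := by
    rw [preimage_left_comp, lift_snd, ← preimage_left_comp]
  have hτ : O₂ ≤ τ.left ⁻¹ᵁ O₂ := by
    rw [preimage_left_comp, lift_snd]
  have hτ' : O₂ ≤ τ'.left ⁻¹ᵁ O₂ := by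
    rw [preimage_left_comp, lift_snd]
  let σ : X ⟶ G ⊗ X := lift 1 (𝟙 X)
  have hσ : O ≤ σ.left ⁻¹ᵁ O₁ := by
    rw [preimage_left_comp, lift_snd]; exact le_preimage_id O
  refine exists_monic_of_groupoid (p := pull (snd G (G ⊗ X)) (le_refl O₂)) (m₁ := pull M₁ hM₁)
    (m₂ := pull M₂ hM₂) (ε := pull σ hσ) (isBasisOver_pull G X b hO rfl) ?_ ?_ ?_ ?_ ?_ ?_ ?_ c J hc
  · convert isBasisOver_pull G (G ⊗ X) b hO₁ rfl using 1
    funext i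
    rw [Function.comp_apply, pull_pull]
    exact pull_congr (by simp [M₁]) _ _
  · have hbij : Function.Bijective (pull τ hτ) := by
      refine Function.bijective_iff_has_inverse.mpr ⟨pull τ' hτ', fun x => ?_, fun x => ?_⟩
      · rw [pull_pull, pull_congr hτ'τ, pull_id]
      · rw [pull_pull, pull_congr hττ', pull_id]
    convert (isBasisOver_pull G (G ⊗ X) b hO₁ rfl).comp_bijective (pull τ hτ) hbij using 1
    · ext x
      rw [RingHom.comp_apply, pull_pull]
      exact pull_congr (by simp [τ]) _ _
    · funext i
      simp only [Function.comp_apply, pull_pull]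
      exact pull_congr (by simp [τ, M₂]) _ _
  all_goals
    ext x
    simp only [RingHom.comp_apply, pull_pull, RingHom.id_apply]
  · exact pull_congr (by simp [M₁]) _ _
  · exact pull_congr (by simp [M₂]) _ _
  · refine pull_congr ?_ _ _
    rw [actMap_eq, comp_act, comp_act]
    simp only [M₁, M₂, lift_fst, lift_snd, mul_act]
    rw [← comp_act, ← actMap_eq]
  · rw [pull_congr (show σ ≫ snd G X = 𝟙 X by simp [σ]), pull_id]
  · rw [pull_congr (show σ ≫ actMap G X = 𝟙 X by exact one_act _), pull_id]

end Action

/-! ### Quotients by finite groups -/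

section FiniteQuotient

variable {k : Type u} [Field k] {G : SchemeOver k} [GrpObj G] {X Y : SchemeOver k} [ModObj G X]

/-- Choose `b` with `x ∈ D(b) ⊆ O`, and let `J` be generated by the functions whose nonvanishing
locus lies in `O`. Since `O` is invariant, the pullback of some power `b ^ m` under the action lies
in the extension of `J`. So the lower coefficients of the characteristic polynomial of `b ^ m` are
invariant and lie in `J`. They cannot all vanish at `x`, where `b` does not. -/
theorem exists_invariant_basicOpen [IsFinite G.hom] {D O : X.left.Opens} (hD : IsAffineOpen D)
    (hDinv : IsInvariantOpen G D) (hOinv : IsInvariantOpen G O) (hOD : O ≤ D) {x : X.left}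
    (hx : x ∈ O) :
    ∃ a ∈ invariants hDinv, x ∈ X.left.basicOpen a ∧ X.left.basicOpen a ≤ O := by
  obtain ⟨b, hbO, hxb⟩ := hD.exists_basicOpen_le ⟨x, hx⟩ (hOD hx)
  have := isAffineHom_snd_left G X
  have hD₁ : IsAffineOpen ((snd G X).left ⁻¹ᵁ D) := hD.preimage (snd G X).left
  set J : Ideal Γ(X.left, D) := Ideal.span {c | X.left.basicOpen c ≤ O} with hJ
  have hJO : ∀ c ∈ J, X.left.basicOpen c ≤ O := by
    intro c hc y hy
    have hyD := X.left.basicOpen_le c hy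
    by_contra hyO
    refine (mem_basicOpen_iff_primeIdealOf hD hyD c).mp hy (Ideal.span_le.mpr (fun c' hc' => ?_) hc)
    by_contra h
    exact hyO (hc' ((mem_basicOpen_iff_primeIdealOf hD hyD c').mpr h))
  -- A prime of the functions on `G × D` that misses the pullback of `b` is a point moved into `O`
  -- by the action, hence projecting to `O`, where some generator of `J` is nonzero.
  have hrad : pull (actMap G X) hDinv.ge b ∈
      (J.map (pull (snd G X) (le_refl ((snd G X).left ⁻¹ᵁ D)))).radical := by
    rw [Ideal.radical_eq_sInf, Ideal.mem_sInf]
    rintro P ⟨hJP, hP⟩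
    by_contra hb
    rw [← fromSpec_mem_basicOpen_iff hD₁ ⟨P, hP⟩, basicOpen_pull] at hb
    have hmem : hD₁.fromSpec ⟨P, hP⟩ ∈ (snd G X).left ⁻¹ᵁ O := by
      rw [← hOinv]
      exact hbO hb.2
    obtain ⟨c, hcO, hc⟩ := hD.exists_basicOpen_le
      ⟨(snd G X).left (hD₁.fromSpec ⟨P, hP⟩), hmem⟩ (hOD hmem)
    have hc' : hD₁.fromSpec ⟨P, hP⟩ ∈ (G ⊗ X).left.basicOpen
        (pull (snd G X) (le_refl ((snd G X).left ⁻¹ᵁ D)) c) := by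
      rw [basicOpen_pull]
      exact ⟨hOD hmem, hc⟩
    rw [fromSpec_mem_basicOpen_iff] at hc'
    exact hc' (hJP (Ideal.mem_map_of_mem _ (Ideal.subset_span hcO)))
  obtain ⟨m, hm⟩ := hrad
  rw [← map_pow] at hm
  obtain ⟨f, hf, hf0, hfinv, hfJ⟩ := exists_monic_of_isInvariantOpen hD hDinv (b ^ m) J hm
  have hxD := hOD hx
  rw [mem_basicOpen_iff_primeIdealOf hD hxD] at hxb
  have : ∃ n < f.natDegree, f.coeff n ∉ (hD.primeIdealOf ⟨x, hxD⟩).asIdeal := by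
    by_contra! h
    rw [Polynomial.eval_eq_sum_range, Finset.sum_range_succ, hf.coeff_natDegree, one_mul] at hf0
    have h1 : ∑ i ∈ Finset.range f.natDegree, f.coeff i * (b ^ m) ^ i ∈
        (hD.primeIdealOf ⟨x, hxD⟩).asIdeal :=
      Ideal.sum_mem _ fun i hi => Ideal.mul_mem_right _ _ (h i (Finset.mem_range.mp hi))
    rw [eq_neg_of_add_eq_zero_left hf0, neg_mem_iff, ← pow_mul] at h1
    exact hxb (Ideal.IsPrime.mem_of_pow_mem inferInstance _ h1)
  obtain ⟨n, hn, hxn⟩ := this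
  exact ⟨f.coeff n, hfinv n, (mem_basicOpen_iff_primeIdealOf hD hxD _).mpr hxn, hJO _ (hfJ n hn)⟩

variable {q : X ⟶ Y}

theorem IsQuotient.isInvariantOpen (hq : IsQuotient G q) (U : Y.left.Opens) :
    IsInvariantOpen G (q.left ⁻¹ᵁ U) := by
  rw [IsInvariantOpen, preimage_left_comp, preimage_left_comp, hq.invariant]

theorem pull_eq_app (f : X ⟶ Y) (U : Y.left.Opens) (a : Γ(Y.left, U)) :
    pull f (le_refl (f.left ⁻¹ᵁ U)) a = f.left.app U a :=
  congr($(Scheme.Hom.appLE_eq_app f.left (U := U)).hom a)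

theorem IsQuotient.pull_injective (hq : IsQuotient G q) {U : Y.left.Opens} {O : X.left.Opens}
    (h : O = q.left ⁻¹ᵁ U) : Function.Injective (pull q h.le) := by
  subst h
  intro a b hab
  rw [pull_eq_app, pull_eq_app] at hab
  exact hq.injective U hab

theorem pull_map {f : X ⟶ Y} {U : Y.left.Opens} {V V' : X.left.Opens} (h : V ≤ f.left ⁻¹ᵁ U)
    (hV : V' ≤ V) (a : Γ(Y.left, U)) :
    X.left.presheaf.map (homOfLE hV).op (pull f h a) = pull f (hV.trans h) a :=
  congr($(Scheme.Hom.appLE_map f.left h (homOfLE hV).op).hom a)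

theorem IsQuotient.mem_range_pull (hq : IsQuotient G q) {U : Y.left.Opens} {O : X.left.Opens}
    (hO : IsInvariantOpen G O) (h : O = q.left ⁻¹ᵁ U) (a : Γ(X.left, O)) :
    a ∈ Set.range (pull q h.le) ↔ a ∈ invariants hO := by
  subst h
  have : Set.range (pull q (le_refl (q.left ⁻¹ᵁ U))) = Set.range (q.left.app U) :=
    congrArg Set.range (funext fun a => pull_eq_app q U a)
  rw [this, hq.mem_range_iff, mem_invariants]
  refine ⟨fun H => H _ _ _, fun H V h₁ h₂ => ?_⟩
  have := congrArg ((G ⊗ X).left.presheaf.map (homOfLE h₂).op) H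
  rwa [pull_map, pull_map] at this

theorem IsQuotient.isIntegral_pull [IsFinite G.hom] (hq : IsQuotient G q) {U : Y.left.Opens}
    {O : X.left.Opens} (hO : IsAffineOpen O) (h : O = q.left ⁻¹ᵁ U) :
    (pull q h.le).IsIntegral := by
  intro c
  have hinv : IsInvariantOpen G O := h ▸ hq.isInvariantOpen U
  obtain ⟨f, hf, hf0, hfinv, -⟩ := exists_monic_of_isInvariantOpen hO hinv c ⊤
    (by rw [Ideal.map_top]; trivial)
  have : f ∈ Polynomial.lifts (pull q h.le) :=
    (Polynomial.lifts_iff_coeff_lifts _).mpr fun n => (hq.mem_range_pull hinv h _).mpr (hfinv n)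
  rcases subsingleton_or_nontrivial Γ(X.left, O) with hs | hs
  · exact ⟨Polynomial.X, Polynomial.monic_X, Subsingleton.elim _ _⟩
  obtain ⟨g, hg, -, hgm⟩ := Polynomial.lifts_and_degree_eq_and_monic this hf
  exact ⟨g, hgm, by rw [Polynomial.eval₂_eq_eval_map, hg, hf0]⟩

theorem IsQuotient.isIntegralHom [IsFinite G.hom] (hq : IsQuotient G q) :
    IsIntegralHom q.left := by
  have := hq.isAffineHom
  refine ⟨fun U hU => ?_⟩
  rw [← Scheme.Hom.appLE_eq_app]
  exact hq.isIntegral_pull (hU.preimage q.left) rfl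

/-- An open set with empty preimage has its functions embedded in the zero ring, so it is empty and
`q` is dominant; being integral, `q` is also closed. -/
theorem IsQuotient.surjective [IsFinite G.hom] (hq : IsQuotient G q) : Surjective q.left := by
  have := hq.isIntegralHom
  have : IsDominant q.left := by
    refine ⟨dense_iff_inter_open.mpr fun U hU ⟨y, hy⟩ => ?_⟩
    by_contra hne
    have he : q.left ⁻¹ᵁ ⟨U, hU⟩ = ⊥ := by
      ext x
      refine ⟨fun hx => hne ⟨q.left x, hx, x, rfl⟩, fun hx => hx.elim⟩
    have h1 : Subsingleton Γ(X.left, q.left ⁻¹ᵁ ⟨U, hU⟩) := by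
      rw [he]; infer_instance
    have h2 : Subsingleton Γ(Y.left, ⟨U, hU⟩) := (hq.injective ⟨U, hU⟩).subsingleton
    have h3 : (⟨U, hU⟩ : Y.left.Opens) = ⊥ := by
      rw [← Scheme.basicOpen_of_isUnit (f := (0 : Γ(Y.left, ⟨U, hU⟩)) ) _ (by
        rw [Subsingleton.elim (0 : Γ(Y.left, ⟨U, hU⟩)) 1]; exact isUnit_one), Scheme.basicOpen_zero]
    have : y ∈ (⟨U, hU⟩ : Y.left.Opens) := hy
    rw [h3] at this
    exact this
  exact surjective_of_isDominant_of_isClosed_range _ q.left.isClosedMap.isClosed_range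

/-- Over an affine open of `Y`, the set `O` is a union of nonvanishing loci of invariant functions,
and these functions come from `Y`. -/
theorem IsQuotient.exists_opens [IsFinite G.hom] (hq : IsQuotient G q) {O : X.left.Opens}
    (hO : IsInvariantOpen G O) : ∃ W : Y.left.Opens, q.left ⁻¹ᵁ W = O := by
  have hqa := hq.isAffineHom
  have key : ∀ x ∈ O, ∃ W : Y.left.Opens, x ∈ q.left ⁻¹ᵁ W ∧ q.left ⁻¹ᵁ W ≤ O := by
    intro x hx
    obtain ⟨U, hU, hxU, -⟩ := exists_isAffineOpen_mem_and_subset (x := q.left x)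
      (U := (⊤ : Y.left.Opens)) trivial
    have hDinv := hq.isInvariantOpen U
    have hinv : IsInvariantOpen G (O ⊓ q.left ⁻¹ᵁ U) := by
      rw [IsInvariantOpen, Scheme.Hom.preimage_inf, Scheme.Hom.preimage_inf, hO, hDinv]
    obtain ⟨a, ha, hxa, haO⟩ := exists_invariant_basicOpen (hU.preimage q.left) hDinv hinv
      inf_le_right ⟨hx, hxU⟩
    obtain ⟨b, rfl⟩ := (hq.mem_range_pull hDinv rfl a).mpr ha
    rw [basicOpen_pull] at hxa haO
    refine ⟨Y.left.basicOpen b, hxa.2, fun y hy => (haO ⟨?_, hy⟩).1⟩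
    exact Y.left.basicOpen_le b hy
  choose W hW hWO using key
  refine ⟨⨆ x : O, W x.1 x.2, le_antisymm ?_ fun x hx => ?_⟩
  · rw [Scheme.Hom.preimage_iSup]
    exact iSup_le fun x => hWO _ _
  · rw [Scheme.Hom.preimage_iSup]
    exact TopologicalSpace.Opens.mem_iSup.mpr ⟨⟨x, hx⟩, hW x hx⟩

theorem IsQuotient.preimage_le_preimage_iff [IsFinite G.hom] (hq : IsQuotient G q)
    {U V : Y.left.Opens} : q.left ⁻¹ᵁ U ≤ q.left ⁻¹ᵁ V ↔ U ≤ V := by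
  refine ⟨fun h y hy => ?_, fun h => q.left.preimage_mono h⟩
  obtain ⟨x, rfl⟩ := hq.surjective.surj y
  exact h hy

/-- It suffices that the functions `r` on `W` with `D(r)` affine generate the unit ideal. This can
be tested upstairs, the extension being integral and injective. At any point upstairs there is a
nonvanishing invariant function supported over an affine neighbourhood of the image, and it comes
from such an `r`. -/
theorem IsQuotient.isAffineOpen [IsFinite G.hom] (hq : IsQuotient G q) {W : Y.left.Opens}
    (hW : IsAffineOpen (q.left ⁻¹ᵁ W)) : IsAffineOpen W := by
  have hinv := hq.isInvariantOpen W
  refine isAffineOpen_of_isAffineOpen_basicOpen W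
    {r | IsAffineOpen (Y.left.basicOpen r)} ?_ fun _ h => h
  rw [← Ideal.map_eq_top_iff (pull q le_rfl) (hq.pull_injective rfl) (hq.isIntegral_pull hW rfl)]
  by_contra hne
  obtain ⟨P, hP, hle⟩ := Ideal.exists_le_maximal _ hne
  have hPp : P.IsPrime := hP.isPrime
  let x := hW.fromSpec ⟨P, hPp⟩
  have hxW : x ∈ q.left ⁻¹ᵁ W := by
    have : x ∈ Set.range hW.fromSpec := ⟨_, rfl⟩
    rwa [hW.range_fromSpec] at this
  obtain ⟨U, hU, hxU, hUW⟩ := exists_isAffineOpen_mem_and_subset (x := q.left x) (U := W) hxW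
  obtain ⟨a, ha, hxa, haO⟩ := exists_invariant_basicOpen hW hinv (hq.isInvariantOpen U)
    (q.left.preimage_mono hUW) hxU
  obtain ⟨r, rfl⟩ := (hq.mem_range_pull hinv rfl a).mpr ha
  rw [fromSpec_mem_basicOpen_iff] at hxa
  refine hxa (hle (Ideal.mem_map_of_mem _ (Ideal.subset_span ?_)))
  rw [basicOpen_pull] at haO
  have hr : Y.left.basicOpen r ≤ U := by
    rw [← hq.preimage_le_preimage_iff]
    exact fun y hy => haO ⟨Y.left.basicOpen_le r hy, hy⟩
  have h1 := Scheme.basicOpen_res Y.left r (homOfLE hUW).op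
  rw [inf_eq_right.mpr hr] at h1
  have := hU.basicOpen (Y.left.presheaf.map (homOfLE hUW).op r)
  rwa [h1] at this

/-- The diagonal of `g` preceded by the surjection `q` is the closed diagonal of `q ≫ g` followed by
the integral map `q × q`, so it is universally closed. -/
theorem isSeparated_of_isSeparated_comp {X Y S : Scheme.{u}} (q : X ⟶ Y) (g : Y ⟶ S)
    [IsIntegralHom q] [Surjective q] [IsSeparated (q ≫ g)] : IsSeparated g := by
  refine ⟨?_⟩
  have h1 : q ≫ Limits.pullback.diagonal g = Limits.pullback.diagonal (q ≫ g) ≫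
      Limits.pullback.map (q ≫ g) (q ≫ g) g g q q (𝟙 _) (Category.comp_id _)
        (Category.comp_id _) := by
    apply Limits.pullback.hom_ext
    · rw [Category.assoc, Category.assoc, Limits.pullback.diagonal_fst, Limits.pullback.map,
        Limits.pullback.lift_fst, Limits.pullback.diagonal_fst_assoc, Category.comp_id]
    · rw [Category.assoc, Category.assoc, Limits.pullback.diagonal_snd, Limits.pullback.map,
        Limits.pullback.lift_snd, Limits.pullback.diagonal_snd_assoc, Category.comp_id]
  have h2 : IsIntegralHom (Limits.pullback.map (q ≫ g) (q ≫ g) g g q q (𝟙 _) (Category.comp_id _)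
      (Category.comp_id _)) :=
    MorphismProperty.pullbackMap (P := @IsIntegralHom) ‹_› ‹_› rfl rfl
  have h3 : UniversallyClosed (q ≫ Limits.pullback.diagonal g) := by
    rw [h1]; infer_instance
  have h4 : UniversallyClosed (Limits.pullback.diagonal g) := .of_comp_surjective q _
  exact .of_isPreimmersion _ (Limits.pullback.diagonal g).isClosedMap.isClosed_range

/-- Finite type is the Artin-Tate lemma: `Γ(X)` is of finite type over `k` and finite over `Γ(Y)`.
-/
theorem IsQuotient.isSepFiniteType [IsFinite G.hom] (hq : IsQuotient G q)
    (hX : IsSepFiniteType X) : IsSepFiniteType Y := by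
  have hint := hq.isIntegralHom
  have hsurj := hq.surjective
  have := hX.isSeparated
  have := hX.locallyOfFiniteType
  have := hX.quasiCompact
  refine ⟨?_, ?_, ?_⟩
  · have : IsSeparated (q.left ≫ Y.hom) := by rwa [Over.w q]
    exact isSeparated_of_isSeparated_comp q.left Y.hom
  · refine HasRingHomProperty.of_iSup_eq_top (P := @LocallyOfFiniteType)
      (fun i : Y.left.affineOpens => i) (iSup_affineOpens_eq_top _) fun U => ?_
    have hO : IsAffineOpen (q.left ⁻¹ᵁ U) := U.2.preimage q.left
    let := (pull q (le_refl (q.left ⁻¹ᵁ U))).toAlgebra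
    have : IsScalarTower k Γ(Y.left, U) Γ(X.left, q.left ⁻¹ᵁ U) :=
      .of_algebraMap_eq fun x => (pull_algebraMap _ _ _).symm
    have h1 : Algebra.FiniteType k Γ(X.left, q.left ⁻¹ᵁ U) := hX.finiteType hO
    have h2 : Algebra.FiniteType Γ(Y.left, U) Γ(X.left, q.left ⁻¹ᵁ U) := .of_restrictScalars_finiteType k _ _
    have h3 : Algebra.IsIntegral Γ(Y.left, U) Γ(X.left, q.left ⁻¹ᵁ U) :=
      ⟨hq.isIntegral_pull hO rfl⟩
    have h4 : Module.Finite Γ(Y.left, U) Γ(X.left, q.left ⁻¹ᵁ U) := Algebra.IsIntegral.finite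
    have h5 : Algebra.FiniteType k Γ(Y.left, U) :=
      ⟨fg_of_fg_of_fg k _ _ h1.out h4.fg_top (hq.pull_injective rfl)⟩
    rw [← RingHom.finiteType_algebraMap, algebraMap_sections, CommRingCat.hom_comp] at h5
    exact h5.of_comp_finiteType
  · have : CompactSpace X.left := QuasiCompact.compactSpace_of_compactSpace X.hom
    have : CompactSpace Y.left := hsurj.surj.compactSpace q.left.continuous
    exact inferInstance

end FiniteQuotient

/-! ### Descent of affine morphisms along faithfully flat coverings -/

section AffineDescent

open Limits MorphismProperty

theorem isSeparated_of_universallyClosed_diagonal {X Y : Scheme.{u}} (f : X ⟶ Y)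
    [UniversallyClosed (pullback.diagonal f)] : IsSeparated f :=
  ⟨.of_isPreimmersion _ (pullback.diagonal f).isClosedMap.isClosed_range⟩

/-- Faithfully flat morphisms. -/
def faithfullyFlat : MorphismProperty Scheme.{u} := @Surjective ⊓ @Flat

/-- Faithfully flat quasi-compact morphisms. -/
def fpqc : MorphismProperty Scheme.{u} := @Surjective ⊓ @Flat ⊓ @QuasiCompact

/-- Faithfully flat morphisms locally of finite presentation. -/
def fppf : MorphismProperty Scheme.{u} := @Surjective ⊓ @Flat ⊓ @LocallyOfFinitePresentation

/-- The universally closed morphisms. -/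
def universallyClosed : MorphismProperty Scheme.{u} := @UniversallyClosed

/-- The affine morphisms. -/
def affineHom : MorphismProperty Scheme.{u} := @IsAffineHom

instance : universallyClosed.{u}.DescendsAlong fpqc.{u} :=
  descendsAlong_universallyClosed_surjective_inf_flat_inf_quasicompact

instance : (isomorphisms Scheme.{u}).DescendsAlong fpqc.{u} :=
  descendsAlong_isomorphisms_surjective_inf_flat_inf_quasicompact

instance : faithfullyFlat.{u}.IsStableUnderBaseChange where
  of_isPullback h := fun ⟨h₁, h₂⟩ =>
    ⟨MorphismProperty.of_isPullback (P := @Surjective) h h₁,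
      MorphismProperty.of_isPullback (P := @Flat) h h₂⟩

instance : faithfullyFlat.{u}.IsStableUnderComposition where
  comp_mem f g := fun ⟨_, _⟩ ⟨_, _⟩ =>
    ⟨inferInstanceAs (Surjective (f ≫ g)), inferInstanceAs (Flat (f ≫ g))⟩

instance : fpqc.{u}.IsStableUnderBaseChange where
  of_isPullback h := fun ⟨⟨h₁, h₂⟩, h₃⟩ =>
    ⟨⟨MorphismProperty.of_isPullback (P := @Surjective) h h₁,
      MorphismProperty.of_isPullback (P := @Flat) h h₂⟩,
      MorphismProperty.of_isPullback (P := @QuasiCompact) h h₃⟩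

instance : universallyClosed.{u}.IsStableUnderBaseChange where
  of_isPullback h := MorphismProperty.of_isPullback (P := @UniversallyClosed) h

/-- The flat morphisms. -/
def flatHom : MorphismProperty Scheme.{u} := @Flat

instance : flatHom.{u}.ContainsIdentities where
  id_mem X := inferInstanceAs (Flat (𝟙 X))

instance : HasRingHomProperty flatHom.{u} RingHom.Flat :=
  inferInstanceAs (HasRingHomProperty @Flat RingHom.Flat)

instance : affineHom.{u}.IsStableUnderBaseChange where
  of_isPullback h := MorphismProperty.of_isPullback (P := @IsAffineHom) h

instance : IsZariskiLocalAtTarget affineHom.{u} :=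
  @HasAffineProperty.instIsZariskiLocalAtTarget _ _ instHasAffinePropertyIsAffineHomIsAffine

/-- Quasi-compactness and separatedness descend to `X`. Flat base change then computes the global
functions of `Y` from those of `X`, which makes `Y → Spec Γ(Y)` a base change of `X → Spec Γ(X)`.
The former is an isomorphism, and isomorphisms descend. -/
theorem isAffine_of_isPullback_of_faithfullyFlat {X Y S T : Scheme.{u}} {f : T ⟶ S} {g : Y ⟶ X}
    {iX : X ⟶ S} {iY : Y ⟶ T} (H : IsPullback g iY iX f) [IsAffine S] [IsAffine T] [IsAffine Y]
    [Surjective f] [Flat f] : IsAffine X := by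
  have hf : fpqc f :=
    ⟨⟨inferInstance, inferInstance⟩, inferInstance⟩
  have : Surjective g := MorphismProperty.of_isPullback H.flip inferInstance
  have : CompactSpace X := g.surjective.compactSpace g.continuous
  have : IsSeparated iX := by
    have h : universallyClosed.diagonal iX :=
      of_isPullback_of_descendsAlong (P := universallyClosed.diagonal) H.flip hf (by
        rw [diagonal_iff]; exact inferInstanceAs (UniversallyClosed _))
    rw [diagonal_iff] at h
    have : UniversallyClosed (pullback.diagonal iX) := h
    exact isSeparated_of_universallyClosed_diagonal iX
  have : QuasiSeparatedSpace X := quasiSeparatedSpace_of_quasiSeparated iX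
  have hp := (isIso_pushoutSection_iff H (US := ⊤) (UT := ⊤) (UX := ⊤) (UY := ⊤) le_top le_top
    (by simp)).mp (isIso_pushoutSection_of_isQuasiSeparated_of_flat_right H _ _ _
      (isAffineOpen_top _) (isAffineOpen_top _) isCompact_univ
      (isQuasiSeparated_univ))
  have happ {X Y : Scheme.{u}} (f : X ⟶ Y) : f.appLE ⊤ ⊤ le_top = f.appTop :=
    f.appLE_eq_app
  simp only [happ] at hp
  have hS : IsPullback (Spec.map g.appTop) (Spec.map iY.appTop) (Spec.map iX.appTop)
      (Spec.map f.appTop) :=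
    isPullback_SpecMap_of_isPushout _ _ _ _ hp
  have hL : IsPullback g Y.toSpecΓ X.toSpecΓ (Spec.map g.appTop) := by
    refine .of_bot ?_ (Scheme.toSpecΓ_naturality g) hS
    have h1 := H.paste_vert (IsPullback.of_vert_isIso ⟨Scheme.toSpecΓ_naturality f⟩)
    rwa [Scheme.toSpecΓ_naturality iX, Scheme.toSpecΓ_naturality iY] at h1
  have hg : fpqc
      (Spec.map g.appTop) := by
    refine MorphismProperty.of_isPullback hS.flip ?_
    rwa [← cancel_left_of_respectsIso fpqc T.toSpecΓ, ← Scheme.toSpecΓ_naturality f,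
      cancel_right_of_respectsIso fpqc]
  have : IsIso X.toSpecΓ := of_isPullback_of_descendsAlong
    (P := isomorphisms Scheme) hL.flip hg (inferInstanceAs (IsIso _))
  exact ⟨this⟩

instance : affineHom.{u}.DescendsAlong fpqc.{u} := by
  refine IsZariskiLocalAtTarget.descendsAlong_inf_quasiCompact (P := affineHom)
    (P' := faithfullyFlat) ?_ ?_
  · rintro _ _ f ⟨h₁, h₂⟩
    exact ⟨h₂, IsLocalIso.le_of_isZariskiLocalAtSource flatHom _ _ f h₁⟩
  intro R S Y φ g ⟨_, _⟩ hfst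
  have : IsAffineHom (pullback.fst (Spec.map φ) g) := hfst
  have : IsAffine (pullback (Spec.map φ) g) := isAffine_of_isAffineHom (pullback.fst (Spec.map φ) g)
  have := isAffine_of_isPullback_of_faithfullyFlat (IsPullback.of_hasPullback (Spec.map φ) g).flip
  exact inferInstanceAs (IsAffineHom g)

instance : affineHom.{u}.DescendsAlong fppf.{u} :=
  have : affineHom.{u}.DescendsAlong (@Surjective ⊓ @Flat ⊓ @QuasiCompact) :=
    inferInstanceAs (affineHom.{u}.DescendsAlong fpqc.{u})
  inferInstanceAs (affineHom.{u}.DescendsAlong (@Surjective ⊓ @Flat ⊓ @LocallyOfFinitePresentation))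

theorem isAffineHom_of_isPullback_fppf {X Y S T : Scheme.{u}} {f : T ⟶ S} {g : Y ⟶ X}
    {iX : X ⟶ S} {iY : Y ⟶ T} (H : IsPullback g iY iX f) [Surjective f] [Flat f]
    [LocallyOfFinitePresentation f] [IsAffineHom iY] : IsAffineHom iX :=
  of_isPullback_of_descendsAlong (P := affineHom) (Q := fppf) H.flip
    ⟨⟨inferInstance, inferInstance⟩, inferInstance⟩ (inferInstanceAs (IsAffineHom iY))

end AffineDescent

/-! ### Characters of the multiplicative group -/

section Characters

open MonObj TensorProduct

/-- Evaluation of a function on `Spec A` at a point of `Spec A`. -/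
def evalSpec {Z : Scheme.{u}} {A : CommRingCat.{u}} (x : Z ⟶ Spec A) : A →+* Γ(Z, ⊤) :=
  ((Scheme.ΓSpecIso A).inv ≫ x.appTop).hom

theorem evalSpec_comp {Z : Scheme.{u}} {A B : CommRingCat.{u}} (x : Z ⟶ Spec A) (f : B ⟶ A)
    (b : B) : evalSpec (x ≫ Spec.map f) b = evalSpec x (f b) := by
  have h : (Scheme.ΓSpecIso B).inv ≫ (x ≫ Spec.map f).appTop =
      f ≫ (Scheme.ΓSpecIso A).inv ≫ x.appTop := by
    rw [Scheme.Hom.comp_appTop, Scheme.ΓSpecIso_inv_naturality_assoc]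
  exact congr(($h).hom b)

theorem evalSpec_id {A : CommRingCat.{u}} (a : A) :
    evalSpec (𝟙 (Spec A)) a = (Scheme.ΓSpecIso A).inv a := by
  have h : (Scheme.ΓSpecIso A).inv ≫ (𝟙 (Spec A) : Spec A ⟶ Spec A).appTop =
      (Scheme.ΓSpecIso A).inv := by
    rw [Scheme.Hom.id_appTop]; exact Category.comp_id _
  exact congr(($h).hom a)

theorem evalSpec_SpecMap {A B : CommRingCat.{u}} (f : B ⟶ A) (b : B) :
    evalSpec (Spec.map f) b = (Scheme.ΓSpecIso A).inv (f b) := by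
  rw [← evalSpec_id, ← evalSpec_comp, Category.id_comp]

variable {k : Type u} [Field k]

theorem algebraMap_sections_top (Y : SchemeOver k) (a : k) :
    algebraMap k Γ(Y.left, ⊤) a = evalSpec (A := .of k) Y.hom a := by
  have h : Y.hom.appLE ⊤ ⊤ le_top = Y.hom.appTop := Scheme.Hom.appLE_eq_app _
  rw [algebraMap_sections, h]; rfl

/-- `T ^ n` is group-like. -/
theorem evalSpec_comul (n : ℤ) :
    evalSpec ((pullbackSpecIso k (LaurentPolynomial k) (LaurentPolynomial k)).hom ≫
      Spec.map (CommRingCat.ofHom (Bialgebra.comulAlgHom k (LaurentPolynomial k)).toRingHom))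
      (LaurentPolynomial.T n : LaurentPolynomial k) =
    evalSpec (A := .of (LaurentPolynomial k)) (Limits.pullback.fst _ _) (LaurentPolynomial.T n) *
      evalSpec (A := .of (LaurentPolynomial k)) (Limits.pullback.snd _ _)
        (LaurentPolynomial.T n) := by
  rw [evalSpec_comp, ← pullbackSpecIso_hom_fst, ← pullbackSpecIso_hom_snd, evalSpec_comp,
    evalSpec_comp, ← map_mul]
  congr 1
  exact (LaurentPolynomial.comul_T (R := k) (A := k) n).trans
    (by simp [Algebra.TensorProduct.tmul_mul_tmul])

instance : IsAffine (Gm k).left := inferInstanceAs (IsAffine (Spec _))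

instance : IsAffineHom (Gm k).hom :=
  inferInstanceAs (IsAffineHom (Spec.map (CommRingCat.ofHom
    (algebraMap k (LaurentPolynomial k)))))

/-- The function `T ^ n` on `𝔾ₘ`. -/
def gmPow (k : Type u) [Field k] (n : ℤ) : Γ((Gm k).left, ⊤) :=
  (Scheme.ΓSpecIso (CommRingCat.of (LaurentPolynomial k))).inv (LaurentPolynomial.T n)

theorem gmPow_zero : gmPow k 0 = 1 := by
  rw [gmPow, LaurentPolynomial.T_zero, map_one]; rfl

theorem gmPow_add (m n : ℤ) : gmPow k (m + n) = gmPow k m * gmPow k n := by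
  rw [gmPow, LaurentPolynomial.T_add, map_mul]; rfl

/-- The powers of the coordinate form a basis of the functions on `𝔾ₘ`. -/
def gmBasis (k : Type u) [Field k] : Module.Basis ℤ k Γ((Gm k).left, ⊤) := by
  let e : LaurentPolynomial k ≃+* Γ((Gm k).left, ⊤) :=
    (Scheme.ΓSpecIso (CommRingCat.of (LaurentPolynomial k))).symm.commRingCatIsoToRingEquiv
  let e' : LaurentPolynomial k ≃ₐ[k] Γ((Gm k).left, ⊤) :=
    AlgEquiv.ofRingEquiv (f := e) fun a => by
      rw [algebraMap_sections_top]
      exact (evalSpec_SpecMap (CommRingCat.ofHom (algebraMap k (LaurentPolynomial k))) a).symm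
  exact (Module.Basis.ofRepr (AddMonoidAlgebra.coeffLinearEquiv k)).map e'.toLinearEquiv

theorem gmBasis_apply (n : ℤ) : gmBasis k n = gmPow k n := by
  rw [gmBasis, Module.Basis.map_apply]
  rfl

variable {T : SchemeOver k}

/-- The `n`-th power of a point of `𝔾ₘ`, as a function. -/
def chr (t : T ⟶ Gm k) (W : T.left.Opens) (n : ℤ) : Γ(T.left, W) :=
  pull t (le_preimage_top t W) (gmPow k n)

theorem pull_chr {T' : SchemeOver k} (f : T' ⟶ T) (t : T ⟶ Gm k) {W : T.left.Opens}
    {W' : T'.left.Opens} (h : W' ≤ f.left ⁻¹ᵁ W) (n : ℤ) :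
    pull f h (chr t W n) = chr (f ≫ t) W' n := by
  rw [chr, pull_pull]; rfl

theorem chr_zero (t : T ⟶ Gm k) (W : T.left.Opens) : chr t W 0 = 1 := by
  rw [chr, gmPow_zero, map_one]

theorem chr_add (t : T ⟶ Gm k) (W : T.left.Opens) (m n : ℤ) :
    chr t W (m + n) = chr t W m * chr t W n := by
  rw [chr, gmPow_add, map_mul]; rfl

theorem chr_top (t : T ⟶ Gm k) (n : ℤ) :
    chr t ⊤ n = evalSpec (A := .of (LaurentPolynomial k)) t.left (LaurentPolynomial.T n) := by
  have : pull t (le_preimage_top t ⊤) = t.left.appTop.hom :=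
    congrArg CommRingCat.Hom.hom (Scheme.Hom.appLE_eq_app t.left)
  rw [chr, this]; rfl

/-- It suffices to treat the two projections of `𝔾ₘ × 𝔾ₘ`, where it says that `T ^ n` is group-like.
-/
theorem chr_mul (s t : T ⟶ Gm k) (W : T.left.Opens) (n : ℤ) :
    chr (s * t) W n = chr s W n * chr t W n := by
  have key : chr μ[Gm k] ⊤ n = chr (fst (Gm k) (Gm k)) ⊤ n * chr (snd (Gm k) (Gm k)) ⊤ n := by
    rw [chr_top, chr_top, chr_top]
    exact evalSpec_comul n
  rw [Hom.mul_def, ← pull_chr (lift s t) μ[Gm k] (le_preimage_top _ W), key, map_mul, pull_chr,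
    pull_chr, lift_fst, lift_snd]

theorem chr_one (W : T.left.Opens) (n : ℤ) : chr (1 : T ⟶ Gm k) W n = 1 := by
  have h := chr_mul (1 : T ⟶ Gm k) 1 W n
  rw [_root_.mul_one] at h
  have hu : chr (1 : T ⟶ Gm k) W n * chr (1 : T ⟶ Gm k) W (-n) = 1 := by
    rw [← chr_add, add_neg_cancel, chr_zero]
  calc _ = chr (1 : T ⟶ Gm k) W n * (chr (1 : T ⟶ Gm k) W n * chr (1 : T ⟶ Gm k) W (-n)) := by
        rw [hu, _root_.mul_one]
    _ = 1 := by rw [← _root_.mul_assoc, ← h, hu]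

end Characters

/-! ### Coordinates with respect to a basis -/

section Coordinates

variable {C E ι : Type*} [CommRing C] [CommRing E] {s : C →+* E} {e : ι → E}

/-- The coordinates with respect to a basis. -/
def IsBasisOver.coord (h : IsBasisOver s e) (x : E) : ι →₀ C := (Equiv.ofBijective _ h).symm x

theorem IsBasisOver.sum_coord (h : IsBasisOver s e) (x : E) :
    ((h.coord x).sum fun i a => s a * e i) = x :=
  (Equiv.ofBijective _ h).apply_symm_apply x

theorem IsBasisOver.coord_eq (h : IsBasisOver s e) {x : E} {c : ι →₀ C}
    (hc : (c.sum fun i a => s a * e i) = x) : h.coord x = c :=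
  (Equiv.symm_apply_eq (Equiv.ofBijective _ h)).mpr hc.symm

theorem IsBasisOver.coord_add (h : IsBasisOver s e) (x y : E) :
    h.coord (x + y) = h.coord x + h.coord y := by
  classical
  refine h.coord_eq ?_
  rw [Finsupp.sum_add_index (by simp) (by simp [add_mul]), h.sum_coord, h.sum_coord]

theorem IsBasisOver.eq_of_sum_eq (h : IsBasisOver s e) (t : Finset ι) {a b : ι → C}
    (hab : ∑ i ∈ t, s (a i) * e i = ∑ i ∈ t, s (b i) * e i) : ∀ i ∈ t, a i = b i := by
  classical
  have key (a : ι → C) : ((∑ i ∈ t, Finsupp.single i (a i)).sum fun i a => s a * e i) =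
      ∑ i ∈ t, s (a i) * e i := by
    rw [← Finsupp.sum_finsetSum_index (by simp) (by simp [add_mul])]
    simp
  have h1 := h.1 ((key a).trans (hab.trans (key b).symm))
  intro i hi
  have := DFunLike.congr_fun h1 i
  simpa [Finsupp.finsetSum_apply, Finsupp.single_apply, hi] using this

end Coordinates

/-! ### Weight decomposition under the multiplicative group -/

section Weights

open MonObj

variable {k : Type u} [Field k]

theorem isBasisOver_chr (Z : SchemeOver k) {O : Z.left.Opens} (hO : IsAffineOpen O)
    {O' : (Gm k ⊗ Z).left.Opens} (hO' : O' = (snd (Gm k) Z).left ⁻¹ᵁ O) :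
    IsBasisOver (pull (snd (Gm k) Z) hO'.le) (chr (fst (Gm k) Z) O') := by
  have := isBasisOver_pull (Gm k) Z (gmBasis k) hO hO'
  simp only [gmBasis_apply] at this
  exact this

variable {P : SchemeOver k} [ModObj (Gm k) P] {O : P.left.Opens}

/-- The weight components of a function on an affine open subscheme with an action of `𝔾ₘ`. -/
def weightComponents (hO : IsAffineOpen O) (hinv : IsInvariantOpen (Gm k) O) (c : Γ(P.left, O)) :
    ℤ →₀ Γ(P.left, O) :=
  (isBasisOver_chr P hO rfl).coord (pull (actMap (Gm k) P) hinv.ge c)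

/-- The functions of weight `n`. -/
def weightSpace (hinv : IsInvariantOpen (Gm k) O) (n : ℤ) : AddSubgroup Γ(P.left, O) where
  carrier := {c | pull (actMap (Gm k) P) hinv.ge c = pull (snd (Gm k) P) le_rfl c * chr (fst _ _) _ n}
  zero_mem' := by rw [Set.mem_ofPred_eq, map_zero, map_zero, zero_mul]
  add_mem' {a b} ha hb := by
    rw [Set.mem_ofPred_eq, map_add, map_add, add_mul, ha, hb]
  neg_mem' {a} ha := by
    rw [Set.mem_ofPred_eq, map_neg, map_neg, neg_mul, ha]

theorem mem_weightSpace {hinv : IsInvariantOpen (Gm k) O} {n : ℤ} {c : Γ(P.left, O)} :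
    c ∈ weightSpace hinv n ↔
      pull (actMap (Gm k) P) hinv.ge c = pull (snd (Gm k) P) le_rfl c * chr (fst _ _) _ n := Iff.rfl

theorem mul_mem_weightSpace {hinv : IsInvariantOpen (Gm k) O} {m n : ℤ} {a b : Γ(P.left, O)}
    (ha : a ∈ weightSpace hinv m) (hb : b ∈ weightSpace hinv n) :
    a * b ∈ weightSpace hinv (m + n) := by
  rw [mem_weightSpace] at *
  rw [map_mul, map_mul, ha, hb, chr_add]
  ring

theorem one_mem_weightSpace (hinv : IsInvariantOpen (Gm k) O) :
    (1 : Γ(P.left, O)) ∈ weightSpace hinv 0 := by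
  rw [mem_weightSpace, map_one, map_one, chr_zero, _root_.one_mul]

variable (hO : IsAffineOpen O) (hinv : IsInvariantOpen (Gm k) O)

theorem weightComponents_add (a b : Γ(P.left, O)) : weightComponents hO hinv (a + b) =
    weightComponents hO hinv a + weightComponents hO hinv b := by
  rw [weightComponents, map_add, IsBasisOver.coord_add]; rfl

theorem weightComponents_of_mem {n : ℤ} {c : Γ(P.left, O)} (hc : c ∈ weightSpace hinv n) :
    weightComponents hO hinv c = Finsupp.single n c :=
  IsBasisOver.coord_eq _ (by
    rw [Finsupp.sum_single_index (by rw [map_zero, zero_mul])]; exact hc.symm)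

theorem pull_actMap_eq_sum (c : Γ(P.left, O)) :
    pull (actMap (Gm k) P) hinv.ge c = ∑ n ∈ (weightComponents hO hinv c).support,
      pull (snd (Gm k) P) le_rfl (weightComponents hO hinv c n) * chr (fst _ _) _ n :=
  ((isBasisOver_chr P hO rfl).sum_coord _).symm

/-- Evaluate `c(tp) = ∑ c_n(p) t ^ n` at `t = 1`. -/
theorem sum_weightComponents (c : Γ(P.left, O)) :
    (weightComponents hO hinv c).sum (fun _ x => x) = c := by
  let σ : P ⟶ Gm k ⊗ P := lift 1 (𝟙 P)
  have hσ : O ≤ σ.left ⁻¹ᵁ ((snd (Gm k) P).left ⁻¹ᵁ O) := by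
    rw [preimage_left_comp, lift_snd]; exact le_preimage_id O
  have h := congrArg (pull σ hσ) (pull_actMap_eq_sum hO hinv c)
  rw [pull_pull, pull_congr (show σ ≫ actMap (Gm k) P = 𝟙 P by exact one_act _), pull_id,
    map_sum] at h
  refine Eq.trans ?_ h.symm
  refine Finset.sum_congr rfl fun n _ => ?_
  rw [map_mul, pull_pull, pull_congr (show σ ≫ snd (Gm k) P = 𝟙 P from lift_snd _ _), pull_id,
    pull_chr, lift_fst, chr_one, _root_.mul_one]

/-- Expand `c(ghp)` in two ways, as `∑ c_n(hp) g ^ n` and as `∑ c_n(p) g ^ n h ^ n`, and compare the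
coefficients of `g ^ n`. -/
theorem weightComponents_mem (c : Γ(P.left, O)) (n : ℤ) :
    weightComponents hO hinv c n ∈ weightSpace hinv n := by
  by_cases hn : n ∈ (weightComponents hO hinv c).support
  swap
  · rw [Finsupp.notMem_support_iff.mp hn]; exact zero_mem _
  let O₁ := (snd (Gm k) P).left ⁻¹ᵁ O
  let O₂ := (snd (Gm k) (Gm k ⊗ P)).left ⁻¹ᵁ O₁
  have := isAffineHom_snd_left (Gm k) P
  have hO₁ : IsAffineOpen O₁ := hO.preimage (snd (Gm k) P).left
  let M₁ : Gm k ⊗ (Gm k ⊗ P) ⟶ Gm k ⊗ P := lift (fst _ _) (snd _ _ ≫ actMap (Gm k) P)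
  let M₂ : Gm k ⊗ (Gm k ⊗ P) ⟶ Gm k ⊗ P :=
    lift (fst _ _ * (snd _ _ ≫ fst _ _)) (snd _ _ ≫ snd _ _)
  have hM₁ : O₂ ≤ M₁.left ⁻¹ᵁ O₁ := by
    rw [preimage_left_comp, lift_snd, ← preimage_left_comp, hinv]
  have hM₂ : O₂ ≤ M₂.left ⁻¹ᵁ O₁ := by
    rw [preimage_left_comp, lift_snd, ← preimage_left_comp]
  have hM : M₁ ≫ actMap (Gm k) P = M₂ ≫ actMap (Gm k) P := by
    rw [actMap_eq, comp_act, comp_act]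
    simp only [M₁, M₂, lift_fst, lift_snd, mul_act]
    rw [← comp_act, ← actMap_eq]
  have h₁ := congrArg (pull M₁ hM₁) (pull_actMap_eq_sum hO hinv c)
  have h₂ := congrArg (pull M₂ hM₂) (pull_actMap_eq_sum hO hinv c)
  rw [pull_pull, map_sum] at h₁ h₂
  rw [pull_congr hM, h₂] at h₁
  refine (isBasisOver_chr (Gm k ⊗ P) hO₁ (O' := O₂) rfl).eq_of_sum_eq
    (weightComponents hO hinv c).support
    (a := fun n => pull (actMap (Gm k) P) hinv.ge (weightComponents hO hinv c n))
    (b := fun n => pull (snd (Gm k) P) le_rfl (weightComponents hO hinv c n) * chr (fst _ _) _ n)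
    ?_ n hn
  refine Eq.trans ?_ (h₁.symm.trans ?_) <;> refine Finset.sum_congr rfl fun n _ => ?_
  · rw [map_mul, pull_pull, pull_pull, pull_chr, lift_fst]
    congr 1
    exact pull_congr (lift_snd _ _).symm _ _
  · rw [map_mul, map_mul, pull_pull, pull_pull, pull_chr, pull_chr, lift_fst, chr_mul]
    rw [pull_congr (lift_snd _ _ : M₂ ≫ snd _ _ = _)]
    ring

/-- For invariant `c` one has `c(t(gp)) = c(g(tp)) = c(tp)`; compare the coefficients of `t ^ n` in
the outer terms. The maps `A`, `B` and `K` send `(t, g, p)` to `(t, gp)`, `(t, p)` and `(g, tp)`. -/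
theorem weightComponents_mem_invariants {G : SchemeOver k} [GrpObj G] [ModObj G P]
    [IsAffineHom G.hom]
    (hcomm : ∀ {T : SchemeOver k} (g : T ⟶ G) (t : T ⟶ Gm k) (p : T ⟶ P),
      act g (act t p) = act t (act g p)) (hG : IsInvariantOpen G O) {c : Γ(P.left, O)}
    (hc : c ∈ invariants hG) (n : ℤ) : weightComponents hO hinv c n ∈ invariants hG := by
  by_cases hn : n ∈ (weightComponents hO hinv c).support
  swap
  · rw [Finsupp.notMem_support_iff.mp hn]; exact zero_mem _
  let O₁ := (snd G P).left ⁻¹ᵁ O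
  let O₂ := (snd (Gm k) (G ⊗ P)).left ⁻¹ᵁ O₁
  have := isAffineHom_snd_left G P
  have hO₁ : IsAffineOpen O₁ := hO.preimage (snd G P).left
  let A : Gm k ⊗ (G ⊗ P) ⟶ Gm k ⊗ P := lift (fst _ _) (snd _ _ ≫ actMap G P)
  let B : Gm k ⊗ (G ⊗ P) ⟶ Gm k ⊗ P := lift (fst _ _) (snd _ _ ≫ snd _ _)
  let K : Gm k ⊗ (G ⊗ P) ⟶ G ⊗ P :=
    lift (snd _ _ ≫ fst _ _) (act (fst _ _) (snd _ _ ≫ snd _ _))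
  have hA : O₂ ≤ A.left ⁻¹ᵁ ((snd (Gm k) P).left ⁻¹ᵁ O) := by
    rw [preimage_left_comp, lift_snd, ← preimage_left_comp, hG]
  have hB : O₂ ≤ B.left ⁻¹ᵁ ((snd (Gm k) P).left ⁻¹ᵁ O) := by
    rw [preimage_left_comp, lift_snd, ← preimage_left_comp]
  have hBK : B ≫ actMap (Gm k) P = K ≫ snd G P := (lift_snd _ _).symm
  have hAK : A ≫ actMap (Gm k) P = K ≫ actMap G P := by
    change act (fst _ _) (snd _ _ ≫ actMap G P) = act _ (act _ _)
    rw [hcomm, ← comp_act, ← actMap_eq]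
  have hK : O₂ ≤ K.left ⁻¹ᵁ O₁ := by
    rw [preimage_left_comp, ← hBK, ← preimage_left_comp, hinv]; exact hB
  have h₁ := congrArg (pull A hA) (pull_actMap_eq_sum hO hinv c)
  have h₂ := congrArg (pull B hB) (pull_actMap_eq_sum hO hinv c)
  have h₃ := congrArg (pull K hK) hc
  rw [pull_pull, map_sum] at h₁ h₂
  rw [pull_pull, pull_pull, pull_congr hAK.symm, pull_congr hBK.symm, h₁, h₂] at h₃
  refine (isBasisOver_chr (G ⊗ P) hO₁ (O' := O₂) rfl).eq_of_sum_eq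
    (weightComponents hO hinv c).support
    (a := fun n => pull (actMap G P) hG.ge (weightComponents hO hinv c n))
    (b := fun n => pull (snd G P) le_rfl (weightComponents hO hinv c n)) ?_ n hn
  refine Eq.trans ?_ (h₃.trans ?_) <;> refine Finset.sum_congr rfl fun n _ => ?_
  · rw [map_mul, pull_pull, pull_pull, pull_chr, lift_fst]
    congr 1
    exact pull_congr (lift_snd _ _).symm _ _
  · rw [map_mul, pull_pull, pull_pull, pull_chr, lift_fst]
    congr 1
    exact pull_congr (lift_snd _ _) _ _

end Weights

/-! ### The grading on the functions of a quotient -/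

section WeightGrading

/-- A graded algebra structure from a decomposition of elements into components. -/
abbrev gradedAlgebraOfComponents {R₀ R : Type*} [CommRing R₀] [CommRing R] [Algebra R₀ R]
    (𝒜 : ℤ → Submodule R₀ R) [SetLike.GradedMonoid 𝒜] (θ : R → ℤ →₀ R)
    (hadd : ∀ a b, θ (a + b) = θ a + θ b) (hmem : ∀ r n, θ r n ∈ 𝒜 n)
    (hsum : ∀ r, (θ r).sum (fun _ x => x) = r) (hone : ∀ n, ∀ r ∈ 𝒜 n, θ r = Finsupp.single n r) :
    GradedAlgebra 𝒜 :=
  have hint : DirectSum.IsInternal 𝒜 := by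
    classical
    constructor
    · let Θ : R →+ ℤ →₀ R := AddMonoidHom.mk' θ hadd
      have key : ∀ x n, Θ (DirectSum.coeAddMonoidHom 𝒜 x) n = x n := by
        intro x n
        induction x using DirectSum.induction_on with
        | zero => simp
        | of i y =>
          rw [DirectSum.coeAddMonoidHom_of]
          change θ y n = _
          rw [hone i y y.2, Finsupp.single_apply, DirectSum.coe_of_apply]
          split_ifs <;> rfl
        | add x y hx hy =>
          rw [map_add, map_add, Finsupp.add_apply, hx, hy]; rfl
      refine (injective_iff_map_eq_zero _).mpr fun x hx => ?_
      ext n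
      rw [← key, hx, map_zero]; rfl
    · intro r
      refine ⟨∑ n ∈ (θ r).support, DirectSum.of (fun n => 𝒜 n) n ⟨θ r n, hmem r n⟩, ?_⟩
      rw [map_sum]
      simp only [DirectSum.coeAddMonoidHom_of]
      exact hsum r
  { hint.chooseDecomposition, ‹SetLike.GradedMonoid 𝒜› with }

variable {k : Type u} [Field k] {G : SchemeOver k} [GrpObj G] [IsFinite G.hom]
  {P PG : SchemeOver k} [ModObj G P] [ModObj (Gm k) P] {q : P ⟶ PG}

theorem pow_mem_weightSpace {O : P.left.Opens} {hinv : IsInvariantOpen (Gm k) O} {d : ℤ}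
    {a : Γ(P.left, O)} (ha : a ∈ weightSpace hinv d) (i : ℕ) :
    a ^ i ∈ weightSpace hinv (i * d) := by
  induction i with
  | zero => simpa using one_mem_weightSpace hinv
  | succ i ih =>
    rw [pow_succ, Nat.cast_succ, add_mul, one_mul]
    exact mul_mem_weightSpace ih ha

theorem weightComponents_mul_of_mem {O : P.left.Opens} (hO : IsAffineOpen O)
    (hinv : IsInvariantOpen (Gm k) O) {d : ℤ} {a : Γ(P.left, O)} (ha : a ∈ weightSpace hinv d)
    (r : Γ(P.left, O)) (n : ℤ) :
    weightComponents hO hinv (r * a) n = weightComponents hO hinv r (n - d) * a := by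
  let Θ : Γ(P.left, O) →+ ℤ →₀ Γ(P.left, O) :=
    AddMonoidHom.mk' (weightComponents hO hinv) (weightComponents_add hO hinv)
  conv_lhs => rw [← sum_weightComponents hO hinv r, Finsupp.sum, Finset.sum_mul]
  change Θ _ n = _
  rw [map_sum, Finsupp.finsetSum_apply]
  have (m : ℤ) : Θ (weightComponents hO hinv r m * a) n =
      if m = n - d then weightComponents hO hinv r m * a else 0 := by
    change weightComponents hO hinv _ n = _
    rw [weightComponents_of_mem hO hinv (mul_mem_weightSpace (weightComponents_mem hO hinv r m) ha),
      Finsupp.single_apply]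
    simp only [eq_sub_iff_add_eq]
  simp only [this]
  rw [Finset.sum_ite_eq']
  split_ifs with h
  · rfl
  · rw [Finsupp.notMem_support_iff.mp h, zero_mul]

/-- Let `a` have weight `d > 0` upstairs, with a monic equation of degree `N` over the
`G`-invariants. Its component of weight `N d` expresses `a ^ N` by terms `f_i' a ^ i`, `i < N`,
where `f_i'` is the component of weight `(N - i) d > 0` of a coefficient. These components are
invariant, so they come from the quotient. Integrality transfers the unit ideal down. -/
theorem span_weightSpace_eq_top (hcomm : ∀ {T : SchemeOver k} (g : T ⟶ G) (t : T ⟶ Gm k)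
    (p : T ⟶ P), act g (act t p) = act t (act g p)) {O : P.left.Opens} (hO : IsAffineOpen O)
    (hG : IsInvariantOpen G O) (hinv : IsInvariantOpen (Gm k) O) (hq : IsQuotient G q)
    {W : PG.left.Opens} (hW : O = q.left ⁻¹ᵁ W)
    (hpos : Ideal.span {c : Γ(P.left, O) | ∃ n > 0, c ∈ weightSpace hinv n} = ⊤) :
    Ideal.span {r : Γ(PG.left, W) | ∃ n > 0, pull q hW.le r ∈ weightSpace hinv n} = ⊤ := by
  rw [← Ideal.map_eq_top_iff (pull q hW.le) (hq.pull_injective hW) (hq.isIntegral_pull hO hW)]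
  by_contra hne
  obtain ⟨m, hm, hle⟩ := Ideal.exists_le_maximal _ hne
  have hmp := hm.isPrime
  refine hm.ne_top (top_le_iff.mp (hpos.ge.trans (Ideal.span_le.mpr ?_)))
  rintro a ⟨d, hd, ha⟩
  obtain ⟨f, hf, hf0, hfinv, -⟩ := exists_monic_of_isInvariantOpen hO hG a ⊤
    (by rw [Ideal.map_top]; trivial)
  let Θ : Γ(P.left, O) →+ ℤ →₀ Γ(P.left, O) :=
    AddMonoidHom.mk' (weightComponents hO hinv) (weightComponents_add hO hinv)
  have h := DFunLike.congr_fun (congrArg Θ hf0) (f.natDegree * d)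
  rw [Polynomial.eval_eq_sum_range, Finset.sum_range_succ, map_add, map_sum, map_zero,
    hf.coeff_natDegree, one_mul] at h
  have hN : Θ (a ^ f.natDegree) (f.natDegree * d) = a ^ f.natDegree := by
    change weightComponents hO hinv _ _ = _
    rw [weightComponents_of_mem hO hinv (pow_mem_weightSpace ha _), Finsupp.single_eq_same]
  rw [Finsupp.add_apply, hN, Finsupp.finsetSum_apply, Finsupp.zero_apply] at h
  refine hmp.mem_of_pow_mem f.natDegree ?_
  rw [← neg_eq_of_add_eq_zero_right h]
  refine neg_mem (sum_mem fun i hi => ?_)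
  change weightComponents hO hinv _ _ ∈ m
  rw [weightComponents_mul_of_mem hO hinv (pow_mem_weightSpace ha _)]
  refine Ideal.mul_mem_right _ _ (hle ?_)
  obtain ⟨r, hr⟩ := (hq.mem_range_pull hG hW _).mpr
    (weightComponents_mem_invariants hO hinv hcomm hG (hfinv i) (f.natDegree * d - i * d))
  rw [← hr]
  refine Ideal.mem_map_of_mem _ (Ideal.subset_span ⟨f.natDegree * d - i * d, ?_, ?_⟩)
  · rw [← sub_mul]
    have := Finset.mem_range.mp hi
    exact mul_pos (by omega) hd
  · rw [hr]; exact weightComponents_mem hO hinv _ _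

/-- Weight components of `G`-invariant functions are `G`-invariant, so the grading passes to `Γ(PG,
W)`; by `h0` its degree zero part is `Γ(Y, U)`, and `affCls_quotient_map` applies. -/
theorem affCls_quotient_of_weights {Y : SchemeOver k}
    (hcomm : ∀ {T : SchemeOver k} (g : T ⟶ G) (t : T ⟶ Gm k)
    (p : T ⟶ P), act g (act t p) = act t (act g p)) {O : P.left.Opens} (hO : IsAffineOpen O)
    (hG : IsInvariantOpen G O) (hinv : IsInvariantOpen (Gm k) O) (hq : IsQuotient G q)
    {W : PG.left.Opens} (hW : O = q.left ⁻¹ᵁ W)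
    (hpos : Ideal.span {c : Γ(P.left, O) | ∃ n > 0, c ∈ weightSpace hinv n} = ⊤)
    {U : Y.left.Opens} (φ : Γ(Y.left, U) →+* Γ(PG.left, W))
    (hφk : ∀ a : k, φ (algebraMap k _ a) = algebraMap k _ a) (hφ : Function.Injective φ)
    (h0 : ∀ r, r ∈ Set.range φ ↔ pull q hW.le r ∈ weightSpace hinv 0)
    [Algebra.FiniteType k Γ(Y.left, U)] [Algebra.FiniteType k Γ(PG.left, W)]
    (J : Ideal Γ(Y.left, U)) :
    affCls k (Γ(PG.left, W) ⧸ J.map φ) = (lefschetz k - 1) * affCls k (Γ(Y.left, U) ⧸ J) := by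
  let := φ.toAlgebra
  have : IsScalarTower k Γ(Y.left, U) Γ(PG.left, W) := .of_algebraMap_eq fun x => (hφk x).symm
  let 𝒜 : ℤ → Submodule Γ(Y.left, U) Γ(PG.left, W) := fun n =>
    { (weightSpace hinv n).comap (pull q hW.le).toAddMonoidHom with
      smul_mem' := fun a r hr => by
        have ha : pull q hW.le (φ a) ∈ weightSpace hinv 0 := (h0 _).mp ⟨a, rfl⟩
        have := mul_mem_weightSpace ha hr
        rw [zero_add] at this
        change pull q hW.le (φ a * r) ∈ weightSpace hinv n
        rw [map_mul]
        exact this }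
  have h𝒜 : ∀ n r, r ∈ 𝒜 n ↔ pull q hW.le r ∈ weightSpace hinv n := fun _ _ => Iff.rfl
  have : SetLike.GradedMonoid 𝒜 :=
    { one_mem := by rw [h𝒜, map_one]; exact one_mem_weightSpace hinv
      mul_mem := fun _ _ _ _ ha hb => by
        rw [h𝒜] at *
        rw [map_mul]; exact mul_mem_weightSpace ha hb }
  have hinj := hq.pull_injective hW
  have hrange : ∀ r n, ∃ r', pull q hW.le r' = weightComponents hO hinv (pull q hW.le r) n := by
    intro r n
    have := weightComponents_mem_invariants hO hinv hcomm hG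
      ((hq.mem_range_pull hG hW _).mp ⟨r, rfl⟩) n
    exact (hq.mem_range_pull hG hW _).mpr this
  have hinv0 : Function.invFun (pull q hW.le) 0 = 0 :=
    hinj ((Function.invFun_eq ⟨0, map_zero _⟩).trans (map_zero _).symm)
  -- The components are moved down along the injective `pull q` by a set-theoretic inverse.
  let θ : Γ(PG.left, W) → ℤ →₀ Γ(PG.left, W) := fun r =>
    (weightComponents hO hinv (pull q hW.le r)).mapRange (Function.invFun (pull q hW.le)) hinv0
  have hθ : ∀ r n, pull q hW.le (θ r n) = weightComponents hO hinv (pull q hW.le r) n := by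
    intro r n
    rw [Finsupp.mapRange_apply]
    exact Function.invFun_eq (hrange r n)
  let := gradedAlgebraOfComponents 𝒜 θ
    (fun a b => Finsupp.ext fun n => hinj (by
      rw [Finsupp.add_apply, map_add, hθ, hθ, hθ, map_add, weightComponents_add,
        Finsupp.add_apply]))
    (fun r n => (h𝒜 _ _).mpr (by rw [hθ]; exact weightComponents_mem hO hinv _ n))
    (fun r => hinj (by
      refine Eq.trans ?_ (sum_weightComponents hO hinv (pull q hW.le r))
      rw [Finsupp.sum, map_sum]
      refine (Finset.sum_congr rfl fun n _ => hθ r n).trans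
        (Finset.sum_subset Finsupp.support_mapRange fun n _ hn => ?_)
      rw [← hθ, Finsupp.notMem_support_iff.mp hn, map_zero]))
    (fun n r hr => Finsupp.ext fun m => hinj (by
      rw [hθ, weightComponents_of_mem hO hinv ((h𝒜 n r).mp hr), Finsupp.single_apply,
        Finsupp.single_apply]
      split_ifs
      · rfl
      · rw [map_zero]))
  exact affCls_quotient_map (𝒜 := 𝒜) (fun x hx => (h0 x).mpr hx) hφ
    (span_weightSpace_eq_top hcomm hO hG hinv hq hW hpos) J

end WeightGrading

/-! ### Quasi-projective schemes are separated of finite type -/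

section SepFiniteType

variable {k : Type u} [Field k]

attribute [local instance] MvPolynomial.gradedAlgebra in
theorem isSepFiniteType_projectiveSpace (n : ℕ) : IsSepFiniteType (projectiveSpace k n) := by
  let 𝒜 := MvPolynomial.homogeneousSubmodule (Fin (n + 1)) k
  have h : Function.Bijective (algebraMap k (𝒜 0)) := by
    refine ⟨fun a b hab => MvPolynomial.C_injective _ _ (congrArg Subtype.val hab), fun x => ?_⟩
    obtain ⟨x, hx⟩ := x
    have := (MvPolynomial.mem_homogeneousSubmodule _ _).mp hx
    refine ⟨x.coeff 0, Subtype.ext ?_⟩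
    exact (MvPolynomial.totalDegree_eq_zero_iff_eq_C.mp (by
      exact Nat.le_zero.mp this.totalDegree_le)).symm
  have : IsIso (CommRingCat.ofHom (algebraMap k (𝒜 0))) :=
    (ConcreteCategory.isIso_iff_bijective _).mpr h
  have : Algebra.FiniteType (𝒜 0) (MvPolynomial (Fin (n + 1)) k) := by
    rw [← RingHom.finiteType_algebraMap]
    refine RingHom.FiniteType.of_comp_finiteType (f := algebraMap k (𝒜 0)) ?_
    exact RingHom.finiteType_algebraMap.mpr
      (inferInstance : Algebra.FiniteType k (MvPolynomial (Fin (n + 1)) k))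
  refine ⟨?_, ?_, ?_⟩ <;> dsimp [projectiveSpace] <;> infer_instance

theorem IsSepFiniteType.of_isImmersion {X Y : SchemeOver k} (hY : IsSepFiniteType Y) (i : X ⟶ Y)
    [IsImmersion i.left] : IsSepFiniteType X := by
  have := hY.isSeparated
  have := hY.locallyOfFiniteType
  have := hY.quasiCompact
  have := hY.isNoetherian
  have : TopologicalSpace.NoetherianSpace X.left := i.left.isEmbedding.isInducing.noetherianSpace
  have : QuasiCompact i.left := inferInstance
  refine ⟨?_, ?_, ?_⟩ <;> rw [← Over.w i] <;> infer_instance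

theorem IsQuasiProjective.isSepFiniteType {X : SchemeOver k} (hX : IsQuasiProjective X) :
    IsSepFiniteType X := by
  obtain ⟨n, i, hi⟩ := hX
  exact (isSepFiniteType_projectiveSpace n).of_isImmersion i

theorem IsSepFiniteType.of_isAffineHom {X Y : SchemeOver k} (hY : IsSepFiniteType Y) (f : X ⟶ Y)
    [IsAffineHom f.left] [LocallyOfFiniteType f.left] : IsSepFiniteType X := by
  have := hY.isSeparated
  have := hY.locallyOfFiniteType
  have := hY.quasiCompact
  refine ⟨?_, ?_, ?_⟩ <;> rw [← Over.w f] <;> infer_instance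

end SepFiniteType

/-! ### Faithfully flat descent for elements of rings -/

section RingDescent

variable {B C E : CommRingCat.{u}} {β : B ⟶ C} {l r : C ⟶ E}

/-- Exactness of `B → C ⇉ C ⊗[B] C`, transported to an arbitrary pushout. -/
theorem mem_range_of_isPushout (H : IsPushout β β l r) (hβ : β.hom.FaithfullyFlat) {c : C}
    (hc : l.hom c = r.hom c) : c ∈ Set.range β.hom := by
  algebraize [β.hom]
  have h1 := Algebra.IsEffective.of_faithfullyFlat B C
  refine (h1 c).mp ?_
  rw [Algebra.TensorProduct.includeLeftSubRight_apply, sub_eq_zero]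
  have H' := CommRingCat.isPushout_tensorProduct B C C
  have e1 := congr(($(H.inl_isoIsPushout_hom _ _ H')).hom c)
  have e2 := congr(($(H.inr_isoIsPushout_hom _ _ H')).hom c)
  refine e1.symm.trans (Eq.trans ?_ e2)
  exact congrArg (H.isoIsPushout _ _ H').hom.hom hc

theorem exists_sum_eq_of_isPushout (H : IsPushout β β l r) (x : E) :
    ∃ S : Finset (C × C), x = ∑ i ∈ S, l.hom i.1 * r.hom i.2 := by
  algebraize [β.hom]
  have H' := CommRingCat.isPushout_tensorProduct B C C
  let e := H'.isoIsPushout _ _ H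
  have e1 := fun c => congr(($(H'.inl_isoIsPushout_hom _ _ H)).hom c)
  have e2 := fun c => congr(($(H'.inr_isoIsPushout_hom _ _ H)).hom c)
  obtain ⟨y, rfl⟩ : ∃ y, e.hom.hom y = x := ⟨e.inv.hom x, by simp⟩
  obtain ⟨S, rfl⟩ := TensorProduct.exists_finset y
  refine ⟨S, ?_⟩
  rw [map_sum]
  refine Finset.sum_congr rfl fun i _ => ?_
  rw [← e1, ← e2]
  refine Eq.trans ?_ (map_mul e.hom.hom _ _)
  refine congrArg e.hom.hom ?_
  change _ = (i.1 ⊗ₜ[B] 1) * (1 ⊗ₜ[B] i.2)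
  rw [Algebra.TensorProduct.tmul_mul_tmul, mul_one, one_mul]

end RingDescent

/-! ### Functions on a torsor under the multiplicative group -/

section Torsor

variable {k : Type u} [Field k] {P X : SchemeOver k} [ModObj (Gm k) P] {π : P ⟶ X}

theorem IsGmTorsor.isPullback_left (h : IsGmTorsor π) :
    IsPullback (actMap (Gm k) P).left (snd (Gm k) P).left π.left π.left :=
  h.isPullback.map (Over.forget _)

/-- Pulled back to `P`, the torsor becomes the projection `𝔾ₘ × P → P`, which is affine; affineness
descends. -/
theorem IsGmTorsor.isAffineHom (h : IsGmTorsor π) : IsAffineHom π.left := by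
  have := h.flat
  have := h.surjective
  have := h.locallyOfFinitePresentation
  have := isAffineHom_snd_left (Gm k) P
  exact isAffineHom_of_isPullback_fppf h.isPullback_left

theorem IsGmTorsor.isSepFiniteType (h : IsGmTorsor π) (hX : IsSepFiniteType X) :
    IsSepFiniteType P := by
  have := h.isAffineHom
  have := h.locallyOfFinitePresentation
  exact hX.of_isAffineHom π

theorem IsGmTorsor.isInvariantOpen (h : IsGmTorsor π) (N : X.left.Opens) :
    IsInvariantOpen (Gm k) (π.left ⁻¹ᵁ N) := by
  rw [IsInvariantOpen, preimage_left_comp, preimage_left_comp, h.isPullback.w]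

theorem faithfullyFlat_appLE {S T : Scheme.{u}} (f : S ⟶ T) [Flat f] [Surjective f] {N : T.Opens}
    {O : S.Opens} (hN : IsAffineOpen N) (hO : IsAffineOpen O) (h : O = f ⁻¹ᵁ N) :
    (f.appLE N O h.le).hom.FaithfullyFlat := by
  rw [RingHom.FaithfullyFlat.iff_flat_and_comap_surjective]
  refine ⟨f.flat_appLE hN hO h.le, fun p => ?_⟩
  obtain ⟨y, hy⟩ := f.surjective (hN.fromSpec p)
  have hyO : y ∈ O := by
    rw [h]
    change f y ∈ N
    rw [hy]
    exact hN.range_fromSpec.le ⟨p, rfl⟩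
  obtain ⟨p', rfl⟩ := hO.range_fromSpec.ge hyO
  refine ⟨p', hN.fromSpec.isEmbedding.injective ?_⟩
  rw [← hy]
  exact congr($(IsAffineOpen.SpecMap_appLE_fromSpec f hN hO h.le) p')

variable {N : X.left.Opens} {O : P.left.Opens}

theorem IsGmTorsor.isPushout (h : IsGmTorsor π) (hN : IsAffineOpen N) (hO : O = π.left ⁻¹ᵁ N)
    (hinv : IsInvariantOpen (Gm k) O) :
    IsPushout (π.left.appLE N O hO.le) (π.left.appLE N O hO.le)
      ((actMap (Gm k) P).left.appLE O ((snd (Gm k) P).left ⁻¹ᵁ O) hinv.ge)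
      ((snd (Gm k) P).left.appLE O ((snd (Gm k) P).left ⁻¹ᵁ O) le_rfl) := by
  have := h.isAffineHom
  have hOa : IsAffineOpen O := hO ▸ hN.preimage π.left
  exact (isIso_pushoutSection_iff h.isPullback_left hO.le hO.le
    (by rw [hinv, inf_idem])).mp
    (isIso_pushoutSection_of_isAffineOpen h.isPullback_left _ _ _ hN hOa hOa)

theorem IsGmTorsor.faithfullyFlat_pull (h : IsGmTorsor π) (hN : IsAffineOpen N)
    (hO : O = π.left ⁻¹ᵁ N) : (pull π hO.le).FaithfullyFlat := by
  have := h.flat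
  have := h.surjective
  have := h.isAffineHom
  exact faithfullyFlat_appLE π.left hN (hO ▸ hN.preimage π.left) hO

/-- Weight zero means equal pullbacks along the action and the projection, which is the descent
condition for `P → X` because `𝔾ₘ × P = P ×_X P`. -/
theorem IsGmTorsor.mem_range_pull_iff (h : IsGmTorsor π) (hN : IsAffineOpen N)
    (hO : O = π.left ⁻¹ᵁ N) (hinv : IsInvariantOpen (Gm k) O) (c : Γ(P.left, O)) :
    c ∈ Set.range (pull π hO.le) ↔ c ∈ weightSpace hinv 0 := by
  rw [mem_weightSpace, chr_zero, mul_one]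
  refine ⟨?_, fun hc => ?_⟩
  · rintro ⟨b, rfl⟩
    rw [pull_pull, pull_pull, pull_congr h.isPullback.w]
  · exact mem_range_of_isPushout (h.isPushout hN hO hinv) (h.faithfullyFlat_pull hN hO) hc

/-- Since `𝔾ₘ × P = P ×_X P`, the coordinate can be written `t = ∑ a_i(tp) b_i(p)`. Comparing
coefficients of `t` gives `1 = ∑ (a_i)₁ b_i`, with `(a_i)₁` of weight one. -/
theorem IsGmTorsor.span_weightSpace_eq_top (h : IsGmTorsor π) (hN : IsAffineOpen N)
    (hO : O = π.left ⁻¹ᵁ N) (hinv : IsInvariantOpen (Gm k) O) :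
    Ideal.span {c : Γ(P.left, O) | ∃ n > 0, c ∈ weightSpace hinv n} = ⊤ := by
  have := h.isAffineHom
  have hOa : IsAffineOpen O := hO ▸ hN.preimage π.left
  obtain ⟨S, hab⟩ := exists_sum_eq_of_isPushout (h.isPushout hN hO hinv)
    (chr (fst (Gm k) P) _ 1)
  rw [Ideal.eq_top_iff_one]
  have key : (1 : Γ(P.left, O)) = ∑ i ∈ S, weightComponents hOa hinv i.1 1 * i.2 := by
    have hb := isBasisOver_chr P hOa rfl
    have hmul (a b : Γ(P.left, O)) : hb.coord (pull (actMap (Gm k) P) hinv.ge a *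
        pull (snd (Gm k) P) le_rfl b) =
        (weightComponents hOa hinv a).mapRange (· * b) (zero_mul b) := by
      refine hb.coord_eq ?_
      rw [Finsupp.sum_mapRange_index fun _ => by rw [map_zero, zero_mul], pull_actMap_eq_sum hOa hinv, Finset.sum_mul]
      refine Finset.sum_congr rfl fun n _ => ?_
      dsimp only
      rw [map_mul]; ring
    have h1 : hb.coord (chr (fst (Gm k) P) _ 1) = Finsupp.single 1 1 :=
      hb.coord_eq (by rw [Finsupp.sum_single_index (by rw [map_zero, zero_mul]), map_one, one_mul])
    let Θ := AddMonoidHom.mk' hb.coord hb.coord_add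
    have := DFunLike.congr_fun (congrArg Θ hab) 1
    rw [map_sum, Finsupp.finsetSum_apply] at this
    refine (Finsupp.single_eq_same.symm.trans (DFunLike.congr_fun h1.symm 1)).trans
      (this.trans (Finset.sum_congr rfl fun i _ => ?_))
    exact DFunLike.congr_fun (hmul i.1 i.2) 1
  rw [key]
  refine sum_mem fun i _ => Ideal.mul_mem_right _ _ (Ideal.subset_span ⟨1, one_pos, ?_⟩)
  exact weightComponents_mem hOa hinv _ _

end Torsor

/-! ### Comparison of two quotients by means of weights -/

section Gluing

theorem cls_openSub_of_eq_top {k : Type u} [Field k] {Y : SchemeOver k} (hY : IsSepFiniteType Y)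
    {U : Y.left.Opens} (h : U = ⊤) :
    K0Var.cls (openSub Y U) (hY.openSub U) = K0Var.cls Y hY := by
  subst h
  exact cls_openSub_top hY

theorem exists_lift_of_range_le {R S T : Type*} [CommRing R] [CommRing S] [CommRing T]
    (g : R →+* S) (hg : Function.Injective g) (h : T →+* S) (hle : ∀ t, h t ∈ Set.range g) :
    ∃ φ : T →+* R, ∀ t, g (φ t) = h t := by
  let e := RingEquiv.ofBijective g.rangeRestrict
    ⟨fun a b hab => hg (congrArg Subtype.val hab), g.rangeRestrict_surjective⟩
  refine ⟨e.symm.toRingHom.comp (h.codRestrict g.range hle), fun t => ?_⟩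
  exact congrArg Subtype.val (e.apply_symm_apply ⟨h t, hle t⟩)

variable {k : Type u} [Field k] {G : SchemeOver k} [GrpObj G] [IsFinite G.hom]

/-- Comparison of the classes of quotients, when functions of weight zero on open subsets of `P`
correspond to functions on open subsets of `X`. -/
theorem cls_openSub_of_weights {P PG X XG : SchemeOver k} [ModObj G P] [ModObj (Gm k) P]
    [ModObj G X] {qP : P ⟶ PG} {qX : X ⟶ XG} (hqP : IsQuotient G qP) (hqX : IsQuotient G qX)
    (hPG : IsSepFiniteType PG) (hXG : IsSepFiniteType XG)
    (hcomm : ∀ {T : SchemeOver k} (g : T ⟶ G) (t : T ⟶ Gm k) (p : T ⟶ P),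
      act g (act t p) = act t (act g p))
    {ι : Type*} {N : ι → X.left.Opens} {O : ι → P.left.Opens} {U : ι → XG.left.Opens}
    {W : ι → PG.left.Opens} (hN : ∀ i, N i = qX.left ⁻¹ᵁ U i) (hO : ∀ i, O i = qP.left ⁻¹ᵁ W i)
    (hNa : ∀ i, IsAffineOpen (N i)) (hOa : ∀ i, IsAffineOpen (O i))
    (hNG : ∀ i, IsInvariantOpen G (N i)) (hOG : ∀ i, IsInvariantOpen G (O i))
    (hOm : ∀ i, IsInvariantOpen (Gm k) (O i))
    (hpos : ∀ i, Ideal.span {c : Γ(P.left, O i) | ∃ n > 0, c ∈ weightSpace (hOm i) n} = ⊤)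
    (β : ∀ i, Γ(X.left, N i) →+* Γ(P.left, O i)) (hβ : ∀ i, Function.Injective (β i))
    (hβk : ∀ i (a : k), β i (algebraMap k _ a) = algebraMap k _ a)
    (hβm : ∀ i c, c ∈ Set.range (β i) ↔ c ∈ weightSpace (hOm i) 0)
    (hβG : ∀ i b, β i b ∈ invariants (hOG i) ↔ b ∈ invariants (hNG i))
    (hβp : ∀ i, ∀ p ∈ O i, ∃ x ∈ N i, (∀ b, x ∈ X.left.basicOpen b ↔ p ∈ P.left.basicOpen (β i b)) ∧
      ∀ j, p ∈ O j ↔ x ∈ N j) (s : Finset ι) :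
    K0Var.cls (openSub PG (s.sup W)) (hPG.openSub _) =
      (lefschetz k - 1) * K0Var.cls (openSub XG (s.sup U)) (hXG.openSub _) := by
  have hUa i : IsAffineOpen (U i) := hqX.isAffineOpen (hN i ▸ hNa i)
  have hWa i : IsAffineOpen (W i) := hqP.isAffineOpen (hO i ▸ hOa i)
  have : ∀ i, Algebra.FiniteType k Γ(XG.left, U i) := fun i => hXG.finiteType (hUa i)
  have : ∀ i, Algebra.FiniteType k Γ(PG.left, W i) := fun i => hPG.finiteType (hWa i)
  -- The image under `β i` of a function from `XG` is `G`-invariant by `hβG`, so it descends to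
  -- `PG`.
  have hlift : ∀ i, ∃ φ : Γ(XG.left, U i) →+* Γ(PG.left, W i), ∀ a,
      pull qP (hO i).le (φ a) = (β i).comp (pull qX (hN i).le) a := fun i =>
    exists_lift_of_range_le _ (hqP.pull_injective (hO i)) _ fun a => by
      rw [hqP.mem_range_pull (hOG i) (hO i)]
      exact (hβG i _).mpr ((hqX.mem_range_pull (hNG i) (hN i) _).mp ⟨a, rfl⟩)
  choose φ hφ using hlift
  have hinjP i := hqP.pull_injective (hO i)
  have hinjX i := hqX.pull_injective (hN i)
  refine cls_openSub_finsetSup hXG hPG U W hUa hWa φ (fun i J => ?_) (fun i j w hw => ?_) s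
  · refine affCls_quotient_of_weights hcomm (hOa i) (hOG i) (hOm i) hqP (hO i) (hpos i) (φ i)
      (fun a => hinjP i ?_) (fun a b hab => hinjX i (hβ i ?_)) (fun r => ?_) J
    · rw [hφ, RingHom.comp_apply, pull_algebraMap, hβk, pull_algebraMap]
    · have := congrArg (pull qP (hO i).le) hab
      rwa [hφ, hφ] at this
    · rw [← hβm]
      constructor
      · rintro ⟨a, rfl⟩
        exact ⟨_, (hφ i a).symm⟩
      · rintro ⟨b, hb⟩
        have h1 : β i b ∈ invariants (hOG i) := by
          rw [hb]; exact (hqP.mem_range_pull (hOG i) (hO i) _).mp ⟨r, rfl⟩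
        obtain ⟨a, ha⟩ := (hqX.mem_range_pull (hNG i) (hN i) _).mpr ((hβG i b).mp h1)
        refine ⟨a, hinjP i ?_⟩
        rw [hφ, RingHom.comp_apply, ha, hb]
  · obtain ⟨p, rfl⟩ := hqP.surjective.surj w
    have hpO j : qP.left p ∈ W j ↔ p ∈ O j := by rw [hO]; rfl
    have hpi := (hpO i).mp hw
    -- The overlaps of the charts of `PG` are read off on `XG` through the point `x` attached to
    -- `p`.
    obtain ⟨x, hxi, hxb, hxj⟩ := hβp i p hpi
    have hxN j : x ∈ N j ↔ qX.left x ∈ U j := by rw [hN]; rfl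
    have hb (a : Γ(XG.left, U i)) : qP.left p ∈ PG.left.basicOpen (φ i a) ↔
        qX.left x ∈ XG.left.basicOpen a := by
      have h1 : p ∈ P.left.basicOpen (pull qP (hO i).le (φ i a)) ↔
          qP.left p ∈ PG.left.basicOpen (φ i a) := by
        rw [basicOpen_pull]; exact and_iff_right hpi
      have h2 : x ∈ X.left.basicOpen (pull qX (hN i).le a) ↔
          qX.left x ∈ XG.left.basicOpen a := by
        rw [basicOpen_pull]; exact and_iff_right hxi
      rw [← h1, ← h2, hxb, hφ]; rfl
    rw [hpO, hxj, hxN]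
    constructor
    · intro hj
      obtain ⟨a, ha, hxa⟩ := (hUa i).exists_basicOpen_le ⟨qX.left x, hj⟩ ((hxN i).mp hxi)
      exact ⟨a, ha, (hb a).mpr hxa⟩
    · rintro ⟨a, ha, hpa⟩
      exact ha ((hb a).mp hpa)

end Gluing

/-! ### Part (a): quotients of equivariant torsors -/

section EquivariantTorsor

variable {k : Type u} [Field k] {G : SchemeOver k}

/-- In the bases coming from `Γ(G)`, the pullback along `G × f` acts coefficientwise by the pullback
along `f`. -/
theorem pull_whiskerLeft_injective [IsAffineHom G.hom] {P X : SchemeOver k} (f : P ⟶ X)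
    {N : X.left.Opens} {O : P.left.Opens} (hN : IsAffineOpen N) (hO : IsAffineOpen O)
    (h : O ≤ f.left ⁻¹ᵁ N) (hinj : Function.Injective (pull f h))
    (h' : (snd G P).left ⁻¹ᵁ O ≤ (G ◁ f).left ⁻¹ᵁ ((snd G X).left ⁻¹ᵁ N)) :
    Function.Injective (pull (G ◁ f) h') := by
  have : IsAffine G.left := isAffine_of_isAffineHom G.hom
  let b := Module.Basis.ofVectorSpace k Γ(G.left, ⊤)
  have hX := isBasisOver_pull G X b hN rfl
  have hP := isBasisOver_pull G P b hO rfl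
  have key (c) : pull (G ◁ f) h' ((fun c : _ →₀ Γ(X.left, N) => c.sum fun i a =>
      pull (snd G X) le_rfl a * pull (fst G X) (le_preimage_top _ _) (b i)) c) =
      (fun c : _ →₀ Γ(P.left, O) => c.sum fun i a =>
      pull (snd G P) le_rfl a * pull (fst G P) (le_preimage_top _ _) (b i))
        (c.mapRange (pull f h) (map_zero _)) := by
    dsimp only
    rw [Finsupp.sum_mapRange_index fun _ => by rw [map_zero, zero_mul], Finsupp.sum, map_sum]
    refine Finset.sum_congr rfl fun i _ => ?_
    dsimp only
    rw [map_mul, pull_pull, pull_pull, pull_pull, pull_congr (whiskerLeft_snd G f),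
      pull_congr (whiskerLeft_fst G f)]
  intro x y hxy
  obtain ⟨c, rfl⟩ := hX.2 x
  obtain ⟨d, rfl⟩ := hX.2 y
  rw [key, key] at hxy
  rw [(Finsupp.mapRange_injective _ _ hinj (hP.1 hxy) : c = d)]

variable [GrpObj G]

/-- Pullback along `G × f` is injective and intertwines the two conditions for invariance. -/
theorem IsEquivariant.mem_invariants_iff [IsAffineHom G.hom] {P X : SchemeOver k} [ModObj G P]
    [ModObj G X] {f : P ⟶ X} (hf : IsEquivariant G f) {N : X.left.Opens} {O : P.left.Opens}
    (hN : IsAffineOpen N) (hO : IsAffineOpen O) (h : O ≤ f.left ⁻¹ᵁ N)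
    (hinj : Function.Injective (pull f h)) (hNG : IsInvariantOpen G N) (hOG : IsInvariantOpen G O)
    (b : Γ(X.left, N)) : pull f h b ∈ invariants hOG ↔ b ∈ invariants hNG := by
  have h' : (snd G P).left ⁻¹ᵁ O ≤ (G ◁ f).left ⁻¹ᵁ ((snd G X).left ⁻¹ᵁ N) := by
    rw [preimage_left_comp, whiskerLeft_snd]
    exact (snd G P).left.preimage_mono h
  rw [mem_invariants, mem_invariants,
    ← (pull_whiskerLeft_injective f hN hO h hinj h').eq_iff, pull_pull, pull_pull, pull_pull,
    pull_pull, pull_congr hf, pull_congr (whiskerLeft_snd G f).symm]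

/-- The charts are the affine opens of `X/G`. Their preimages in `P` are `G`-invariant and come from
opens of `P/G`, and finitely many of them cover. -/
theorem cls_quotient_torsor [IsFinite G.hom] {X P : SchemeOver k} [ModObj G X] [ModObj G P]
    [ModObj (Gm k) P] {π : P ⟶ X} (hπ : IsEquivariantGmTorsor G π) {XG PG : SchemeOver k}
    {qX : X ⟶ XG} {qP : P ⟶ PG} (hqX : IsQuotient G qX) (hqP : IsQuotient G qP)
    (hXG : IsSepFiniteType XG) (hPG : IsSepFiniteType PG) :
    K0Var.cls PG hPG = (lefschetz k - 1) * K0Var.cls XG hXG := by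
  have haffX := hqX.isAffineHom
  have haffπ := hπ.toIsGmTorsor.isAffineHom
  have hinvO (U : XG.left.Opens) : IsInvariantOpen G (π.left ⁻¹ᵁ (qX.left ⁻¹ᵁ U)) := by
    rw [IsInvariantOpen, preimage_left_comp, preimage_left_comp, preimage_left_comp,
      preimage_left_comp]
    have h1 : actMap G P ≫ π ≫ qX = snd G P ≫ π ≫ qX := by
      rw [← Category.assoc, hπ.equivariant, Category.assoc, hqX.invariant, whiskerLeft_snd_assoc]
    rw [Category.assoc, Category.assoc, h1]
  choose W hW using fun U : XG.left.affineOpens => hqP.exists_opens (hinvO U)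
  have hNa (U : XG.left.affineOpens) : IsAffineOpen (qX.left ⁻¹ᵁ U.1) := U.2.preimage qX.left
  have hOa (U : XG.left.affineOpens) : IsAffineOpen (π.left ⁻¹ᵁ (qX.left ⁻¹ᵁ U.1)) :=
    (hNa U).preimage π.left
  have hm (U : XG.left.affineOpens) := hπ.toIsGmTorsor.isInvariantOpen (qX.left ⁻¹ᵁ U.1)
  have hinj (U : XG.left.affineOpens) :=
    (hπ.toIsGmTorsor.faithfullyFlat_pull (hNa U) rfl).injective
  have key := cls_openSub_of_weights hqP hqX hPG hXG hπ.act_comm (ι := XG.left.affineOpens)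
    (U := fun U => U.1) (W := W) (fun U => rfl) (fun U => (hW U).symm) hNa hOa
    (fun U => hqX.isInvariantOpen _) (fun U => hinvO _) hm
    (fun U => hπ.toIsGmTorsor.span_weightSpace_eq_top (hNa U) rfl (hm U))
    (fun U => pull π le_rfl) hinj (fun U a => pull_algebraMap _ _ _)
    (fun U c => hπ.toIsGmTorsor.mem_range_pull_iff (hNa U) rfl (hm U) c)
    (fun U b => hπ.equivariant.mem_invariants_iff (hNa U) (hOa U) le_rfl (hinj U) _ _ b)
    (fun U p hp => ⟨π.left p, hp, fun b => by
      rw [basicOpen_pull]; exact (and_iff_right hp).symm, fun _ => Iff.rfl⟩)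
  have hc : CompactSpace XG.left := hXG.isNoetherian.toCompactSpace
  obtain ⟨s, hs⟩ := isCompact_univ.elim_finite_subcover
    (fun U : XG.left.affineOpens => (U.1 : Set XG.left)) (fun U => U.1.2) fun x _ => by
      obtain ⟨U, hU, hx, -⟩ := exists_isAffineOpen_mem_and_subset (x := x) (U := ⊤) trivial
      exact Set.mem_iUnion.mpr ⟨⟨U, hU⟩, hx⟩
  have hcov x : ∃ U ∈ s, x ∈ U.1 := by simpa using hs (Set.mem_univ x)
  rw [← cls_openSub_of_eq_top hPG (U := s.sup W), ← cls_openSub_of_eq_top hXG (U := s.sup _), key s]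
  · rw [← top_le_iff]
    intro x _
    obtain ⟨U, hU, hx⟩ := hcov x
    exact Finset.le_sup (f := fun U : XG.left.affineOpens => U.1) hU hx
  · rw [← top_le_iff, ← hqP.preimage_le_preimage_iff]
    intro p _
    obtain ⟨U, hU, hx⟩ := hcov (qX.left (π.left p))
    exact Finset.le_sup (f := W) hU ((hW U).ge hx)

end EquivariantTorsor

/-! ### Points of affine schemes as evaluations -/

section SpecPoints

variable {Z : Scheme.{u}} {R : CommRingCat.{u}}

/-- The point of `Spec R` defined by evaluation of functions. -/
def specLift (e : R →+* Γ(Z, ⊤)) : Z ⟶ Spec R := Z.toSpecΓ ≫ Spec.map (CommRingCat.ofHom e)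

theorem specLift_evalSpec (x : Z ⟶ Spec R) : specLift (evalSpec x) = x := by
  rw [specLift, evalSpec, CommRingCat.ofHom_hom, Spec.map_comp, ← Category.assoc,
    ← Scheme.toSpecΓ_naturality x, Category.assoc, toSpecΓ_SpecMap_ΓSpecIso_inv, Category.comp_id]

theorem evalSpec_specLift (e : R →+* Γ(Z, ⊤)) (r : R) : evalSpec (specLift e) r = e r := by
  rw [specLift, evalSpec_comp, evalSpec]
  have := Scheme.toSpecΓ_appTop Z
  rw [this, Iso.inv_hom_id]
  rfl

theorem evalSpec_injective {x y : Z ⟶ Spec R} (h : ∀ r, evalSpec x r = evalSpec y r) : x = y := by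
  rw [← specLift_evalSpec x, ← specLift_evalSpec y, RingHom.ext h]

end SpecPoints

section Sym

variable {A : Type u} [CommRing A] {M : Type u} [AddCommGroup M] [Module A M]

theorem sym_ringHom_ext {B : Type*} [CommRing B] {e e' : Sym A M →+* B}
    (h₀ : ∀ a, e (algebraMap A _ a) = e' (algebraMap A _ a))
    (h₁ : ∀ l, e (SymmetricAlgebra.ι A _ l) = e' (SymmetricAlgebra.ι A _ l)) (s : Sym A M) :
    e s = e' s := by
  induction s using SymmetricAlgebra.induction with
  | algebraMap a => exact h₀ a
  | ι l => exact h₁ l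
  | mul a b ha hb => rw [map_mul, map_mul, ha, hb]
  | add a b ha hb => rw [map_add, map_add, ha, hb]

end Sym

/-! ### Scalar multiplication and the zero section of a vector bundle -/

section Scaling

open MonObj

variable {k : Type u} [Field k] {A : Type u} [CommRing A] [Algebra k A] {M : Type u}
  [AddCommGroup M] [Module A M] {T T' : SchemeOver k}

theorem pull_top (f : T' ⟶ T) (h : ⊤ ≤ f.left ⁻¹ᵁ ⊤) (a : Γ(T.left, ⊤)) :
    pull f h a = f.left.appTop a := pull_eq_app f ⊤ a

theorem pull_evalAt (f : T' ⟶ T) (v : T ⟶ totalSpace k A M) (s : Sym A M) :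
    pull f (le_preimage_top f ⊤) (evalAt v s) = evalAt (f ≫ v) s := by
  rw [pull_top]; rfl

theorem evalAt_algebraMap (v : T ⟶ totalSpace k A M) (a : k) :
    evalAt v (algebraMap A _ (algebraMap k A a)) = algebraMap k _ a := by
  rw [algebraMap_sections_top, ← Over.w v]
  refine Eq.trans ?_ (congrArg (fun x => evalSpec (A := .of k) x a) (Category.assoc v.left
    (Spec.map (CommRingCat.ofHom (algebraMap A (Sym A M))))
    (Spec.map (CommRingCat.ofHom (algebraMap k A)))))
  refine Eq.symm ((evalSpec_comp _ (CommRingCat.ofHom (algebraMap k A)) a).trans ?_)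
  exact evalSpec_comp v.left (CommRingCat.ofHom (algebraMap A (Sym A M))) (algebraMap k A a)

theorem hom_ext_evalAt {v w : T ⟶ totalSpace k A M}
    (h₀ : ∀ a, evalAt v (algebraMap A _ a) = evalAt w (algebraMap A _ a))
    (h₁ : ∀ l, evalAt v (SymmetricAlgebra.ι A _ l) = evalAt w (SymmetricAlgebra.ι A _ l)) :
    v = w :=
  Over.OverMorphism.ext (evalSpec_injective (R := .of (Sym A M)) (sym_ringHom_ext h₀ h₁))

/-- The point of the total space defined by evaluation of functions. -/
def ofEval (e : Sym A M →+* Γ(T.left, ⊤))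
    (he : ∀ a, e (algebraMap A _ (algebraMap k A a)) = algebraMap k _ a) :
    T ⟶ totalSpace k A M :=
  Over.homMk (specLift (R := .of (Sym A M)) e) (evalSpec_injective (R := .of k) fun a => by
    rw [← algebraMap_sections_top, ← he, ← evalSpec_specLift (R := .of (Sym A M)) e]
    exact (congrArg (fun x => evalSpec (A := .of k) x a) (Category.assoc _ _ _).symm).trans
      ((evalSpec_comp _ _ _).trans (evalSpec_comp _ _ _)))

theorem evalAt_ofEval (e : Sym A M →+* Γ(T.left, ⊤)) (he) (s : Sym A M) :
    evalAt (ofEval (k := k) e he) s = e s :=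
  evalSpec_specLift (R := .of (Sym A M)) e s

/-- Multiplication of linear functions by a scalar. -/
def scaleHom {B : Type*} [CommRing B] (e : Sym A M →+* B) (c : B) : Sym A M →+* B :=
  letI := (e.comp (algebraMap A (Sym A M))).toAlgebra
  (SymmetricAlgebra.lift (R := A) (A := B)
    { toFun := fun l => e (SymmetricAlgebra.ι A _ l) * c
      map_add' := fun l l' => by rw [map_add, map_add, add_mul]
      map_smul' := fun a l => by
        rw [map_smul, Algebra.smul_def, map_mul, _root_.mul_assoc]; rfl } : Sym A M →ₐ[A] B).toRingHom

theorem scaleHom_algebraMap {B : Type*} [CommRing B] (e : Sym A M →+* B) (c : B) (a : A) :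
    scaleHom e c (algebraMap A _ a) = e (algebraMap A _ a) :=
  letI := (e.comp (algebraMap A (Sym A M))).toAlgebra
  AlgHom.commutes _ a

theorem scaleHom_ι {B : Type*} [CommRing B] (e : Sym A M →+* B) (c : B) (l : Module.Dual A M) :
    scaleHom e c (SymmetricAlgebra.ι A _ l) = e (SymmetricAlgebra.ι A _ l) * c :=
  letI := (e.comp (algebraMap A (Sym A M))).toAlgebra
  SymmetricAlgebra.lift_ι_apply _ l

theorem scaleHom_of_mem {B : Type*} [CommRing B] (e : Sym A M →+* B) (c : B) {n : ℕ} {s : Sym A M}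
    (hs : s ∈ symGrading A M n) : scaleHom e c s = e s * c ^ n := by
  induction hs using Submodule.pow_induction_on_left' with
  | algebraMap a => rw [scaleHom_algebraMap, pow_zero, _root_.mul_one]
  | add x y i hx hy ihx ihy => rw [map_add, map_add, ihx, ihy, add_mul]
  | mem_mul m hm i x hx ih =>
    obtain ⟨m, rfl⟩ := hm
    rw [map_mul, map_mul, ih, scaleHom_ι, pow_succ]
    ring

/-- Multiplication of a point of a vector bundle by a scalar. -/
def scale (t : T ⟶ Gm k) (v : T ⟶ totalSpace k A M) : T ⟶ totalSpace k A M :=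
  ofEval (scaleHom (evalAt v) (chr t ⊤ 1)) fun a => by
    rw [scaleHom_algebraMap, evalAt_algebraMap]

theorem evalAt_scale_algebraMap (t : T ⟶ Gm k) (v : T ⟶ totalSpace k A M) (a : A) :
    evalAt (scale t v) (algebraMap A _ a) = evalAt v (algebraMap A _ a) := by
  rw [scale, evalAt_ofEval, scaleHom_algebraMap]

theorem evalAt_scale_ι (t : T ⟶ Gm k) (v : T ⟶ totalSpace k A M) (l : Module.Dual A M) :
    evalAt (scale t v) (SymmetricAlgebra.ι A _ l) =
      evalAt v (SymmetricAlgebra.ι A _ l) * chr t ⊤ 1 := by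
  rw [scale, evalAt_ofEval, scaleHom_ι]

theorem chr_pow (t : T ⟶ Gm k) (W : T.left.Opens) (m : ℤ) (n : ℕ) :
    chr t W m ^ n = chr t W (n * m) := by
  induction n with
  | zero => rw [pow_zero, Nat.cast_zero, zero_mul, chr_zero]
  | succ n ih => rw [pow_succ, ih, ← chr_add]; congr 1; push_cast; ring

theorem evalAt_scale_of_mem (t : T ⟶ Gm k) (v : T ⟶ totalSpace k A M) {n : ℕ} {s : Sym A M}
    (hs : s ∈ symGrading A M n) : evalAt (scale t v) s = evalAt v s * chr t ⊤ n := by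
  rw [scale, evalAt_ofEval, scaleHom_of_mem _ _ hs, chr_pow, _root_.mul_one]

theorem comp_scale (f : T' ⟶ T) (t : T ⟶ Gm k) (v : T ⟶ totalSpace k A M) :
    f ≫ scale t v = scale (f ≫ t) (f ≫ v) := by
  refine hom_ext_evalAt (fun a => ?_) fun l => ?_
  · rw [← pull_evalAt, evalAt_scale_algebraMap, evalAt_scale_algebraMap, pull_evalAt]
  · rw [← pull_evalAt, evalAt_scale_ι, evalAt_scale_ι, map_mul, pull_evalAt, pull_chr]

theorem one_scale (v : T ⟶ totalSpace k A M) : scale 1 v = v := by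
  refine hom_ext_evalAt (fun a => ?_) fun l => ?_
  · rw [evalAt_scale_algebraMap]
  · rw [evalAt_scale_ι, chr_one, _root_.mul_one]

theorem mul_scale (t t' : T ⟶ Gm k) (v : T ⟶ totalSpace k A M) :
    scale (t * t') v = scale t (scale t' v) := by
  refine hom_ext_evalAt (fun a => ?_) fun l => ?_
  · simp only [evalAt_scale_algebraMap]
  · rw [evalAt_scale_ι, evalAt_scale_ι, evalAt_scale_ι, chr_mul]; ring

/-- The action of `𝔾ₘ` on a vector bundle by scalar multiplication. -/
instance : ModObj (Gm k) (totalSpace k A M) where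
  smul := scale (fst (Gm k) _) (snd (Gm k) _)
  one_smul := by
    change (η[Gm k] ▷ _) ≫ scale (fst (Gm k) _) (snd (Gm k) _) = (λ_ _).hom
    rw [comp_scale, whiskerRight_fst, whiskerRight_snd, leftUnitor_hom]
    exact one_scale _
  mul_smul := by
    change (μ[Gm k] ▷ _) ≫ scale (fst (Gm k) _) (snd (Gm k) _) =
      (α_ (Gm k) (Gm k) _).hom ≫ (Gm k ◁ scale (fst (Gm k) _) (snd (Gm k) _)) ≫
        scale (fst (Gm k) _) (snd (Gm k) _)
    simp only [comp_scale, whiskerRight_fst, whiskerRight_snd, whiskerLeft_fst, whiskerLeft_snd,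
      associator_hom_snd_snd, ← mul_scale]
    rw [Hom.mul_def, ← Category.assoc]
    congr 2
    ext1 <;> simp

theorem act_eq_scale (t : T ⟶ Gm k) (v : T ⟶ totalSpace k A M) : act t v = scale t v := by
  change lift t v ≫ scale _ _ = _
  rw [comp_scale, lift_fst, lift_snd]

variable {G : SchemeOver k} [GrpObj G] [ModObj G (specOver k A)] [ModObj G (totalSpace k A M)]

theorem bundleProj_comp_eq {v w : T ⟶ totalSpace k A M}
    (h : ∀ a, evalAt v (algebraMap A _ a) = evalAt w (algebraMap A _ a)) :
    v ≫ bundleProj k A M = w ≫ bundleProj k A M :=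
  Over.OverMorphism.ext (evalSpec_injective (R := .of A) fun a =>
    (evalSpec_comp _ _ _).trans ((h a).trans (evalSpec_comp _ _ _).symm))

theorem evalAt_algebraMap_congr {v w : T ⟶ totalSpace k A M}
    (h : v ≫ bundleProj k A M = w ≫ bundleProj k A M) (a : A) :
    evalAt v (algebraMap A _ a) = evalAt w (algebraMap A _ a) := by
  have := congrArg (fun x => evalSpec (A := .of A) x.left a) h
  exact (evalSpec_comp _ _ _).symm.trans (this.trans (evalSpec_comp _ _ _))

theorem act_comp_bundleProj (h : IsEquivariant G (bundleProj k A M)) (g : T ⟶ G)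
    (v : T ⟶ totalSpace k A M) : act g v ≫ bundleProj k A M = act g (v ≫ bundleProj k A M) := by
  rw [act, Category.assoc, h, lift_whiskerLeft_assoc]

/-- The identity defining linearity lives on `G × V`; here it is evaluated at `(g, v)`, with
coefficients independent of the point. -/
theorem IsEquivariantBundle.evalAt_act (h : IsEquivariantBundle (A := A) (M := M) G)
    (l : Module.Dual A M) :
    ∃ (n : ℕ) (c : Fin n → Γ((G ⊗ specOver k A).left, ⊤)) (m : Fin n → Module.Dual A M),
      ∀ {T : SchemeOver k} (g : T ⟶ G) (v : T ⟶ totalSpace k A M),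
        evalAt (act g v) (SymmetricAlgebra.ι A _ l) =
          ∑ i, pull (lift g (v ≫ bundleProj k A M)) (le_preimage_top _ ⊤) (c i) *
            evalAt v (SymmetricAlgebra.ι A _ (m i)) := by
  obtain ⟨n, c, m, hcm⟩ := h.linear l
  refine ⟨n, c, m, fun g v => ?_⟩
  rw [act, ← pull_evalAt, hcm, map_sum]
  refine Finset.sum_congr rfl fun i _ => ?_
  rw [map_mul, pull_evalAt, lift_snd, ← pull_top _ (le_preimage_top _ ⊤), pull_pull,
    pull_congr (lift_whiskerLeft _ _ _)]

/-- By linearity `g` takes linear functions to combinations of linear functions with coefficients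
from `G × W`, and scalars fix `W`. -/
theorem IsEquivariantBundle.act_comm (h : IsEquivariantBundle (A := A) (M := M) G)
    (g : T ⟶ G) (t : T ⟶ Gm k) (v : T ⟶ totalSpace k A M) :
    act g (act t v) = act t (act g v) := by
  rw [act_eq_scale, act_eq_scale]
  have hp : scale t v ≫ bundleProj k A M = v ≫ bundleProj k A M :=
    bundleProj_comp_eq fun a => evalAt_scale_algebraMap t v a
  refine hom_ext_evalAt (fun a => ?_) fun l => ?_
  · rw [evalAt_scale_algebraMap]
    refine evalAt_algebraMap_congr ?_ a
    rw [act_comp_bundleProj h.equivariant, act_comp_bundleProj h.equivariant, hp]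
  · obtain ⟨n, c, m, hcm⟩ := h.evalAt_act l
    rw [hcm, evalAt_scale_ι, hcm, hp, Finset.sum_mul]
    refine Finset.sum_congr rfl fun i _ => ?_
    rw [evalAt_scale_ι, _root_.mul_assoc]

/-- The zero section of a vector bundle. -/
def zeroSection : specOver k A ⟶ totalSpace k A M :=
  ofEval ((Scheme.ΓSpecIso (.of A)).inv.hom.comp
    (SymmetricAlgebra.algebraMapInv (R := A) (M := Module.Dual A M)).toRingHom) fun a => by
      rw [algebraMap_sections_top]
      refine Eq.trans ?_ (evalSpec_SpecMap (CommRingCat.ofHom (algebraMap k A)) a).symm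
      exact congrArg (Scheme.ΓSpecIso (.of A)).inv.hom (SymmetricAlgebra.algebraMap_leftInverse _ _)

theorem evalAt_zeroSection (s : Sym A M) : evalAt (zeroSection (k := k)) s =
    (Scheme.ΓSpecIso (.of A)).inv (SymmetricAlgebra.algebraMapInv s) :=
  evalAt_ofEval _ _ s

theorem zeroSection_bundleProj : zeroSection ≫ bundleProj k A M = 𝟙 _ := by
  refine Over.OverMorphism.ext (evalSpec_injective (R := .of A) fun a => ?_)
  refine (evalSpec_comp _ _ _).trans ((evalAt_zeroSection _).trans ?_)
  exact (congrArg (Scheme.ΓSpecIso (.of A)).inv.hom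
    (SymmetricAlgebra.algebraMap_leftInverse _ _)).trans (evalSpec_id a).symm

/-- Linear functions vanish on the zero section, and by linearity so do their pullbacks under the
action. -/
theorem IsEquivariantBundle.isEquivariant_zeroSection
    (h : IsEquivariantBundle (A := A) (M := M) G) :
    IsEquivariant G (zeroSection (k := k) (A := A) (M := M)) := by
  have h0 (l : Module.Dual A M) : evalAt (zeroSection (k := k)) (SymmetricAlgebra.ι A _ l) = 0 := by
    rw [evalAt_zeroSection, SymmetricAlgebra.algebraMapInv_ι, map_zero]
  have hw : (G ◁ zeroSection (k := k) (A := A) (M := M)) ≫ actMap G _ =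
      act (fst G _) (snd G _ ≫ zeroSection) := by
    rw [act]
    congr 1
  rw [IsEquivariant, hw]
  refine hom_ext_evalAt (fun a => evalAt_algebraMap_congr ?_ a) fun l => ?_
  · rw [act_comp_bundleProj h.equivariant, Category.assoc, Category.assoc, zeroSection_bundleProj,
      Category.comp_id, Category.comp_id, actMap_eq]
  · obtain ⟨n, c, m, hcm⟩ := h.evalAt_act l
    rw [hcm, ← pull_evalAt, h0, map_zero, eq_comm]
    refine Finset.sum_eq_zero fun i _ => ?_
    rw [← pull_evalAt, h0, map_zero, mul_zero]

end Scaling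

/-! ### Functions pulled back along a morphism to Proj -/

section ProjSections

open HomogeneousLocalization

variable {σ : Type*} {R : Type u} [CommRing R] [SetLike σ R] [AddSubgroupClass σ R] (𝒜 : ℕ → σ)
  [GradedRing 𝒜] {r : R} {n : ℕ} {Z : Scheme.{u}} (f : R →+* Γ(Z, ⊤))
  (hf : (HomogeneousIdeal.irrelevant 𝒜).toIdeal.map f = ⊤)

theorem evalSpec_ι_toSpecΓ (W : Z.Opens) (g : Γ(Z, ⊤)) :
    evalSpec (A := Γ(Z, ⊤)) (W.ι ≫ Z.toSpecΓ) g = W.ι.appTop g := by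
  have h : (Scheme.ΓSpecIso Γ(Z, ⊤)).inv ≫ (W.ι ≫ Z.toSpecΓ).appTop = W.ι.appTop := by
    rw [Scheme.Hom.comp_appTop, Scheme.toSpecΓ_appTop, Iso.inv_hom_id_assoc]
  exact congr(($h).hom g)

/-- The map of localizations induced by `f`. -/
def awayEval (r : R) : Away 𝒜 r →+* Localization.Away (f r) :=
  RingHom.comp (IsLocalization.map (M := .powers r) (T := .powers (f r)) (Localization.Away (f r)) f
    (by rw [← Submonoid.map_le_iff_le_comap, Submonoid.map_powers]))
    (algebraMap (Away 𝒜 r) (Localization.Away r))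

/-- On the chart of `r`, the morphism to `Proj` is given by the ring map `awayEval`; `κ` is the
locus `D(f r)` seen as a point of the spectrum of the localization. -/
theorem exists_resLE_comp_eq (hr : r ∈ 𝒜 n) (hn : 0 < n) :
    ∃ κ : (Z.basicOpen (f r)).toScheme ⟶ Spec (.of (Localization.Away (f r))),
      κ ≫ Spec.map (CommRingCat.ofHom (algebraMap Γ(Z, ⊤) _)) = (Z.basicOpen (f r)).ι ≫ Z.toSpecΓ ∧
      (Proj.fromOfGlobalSections 𝒜 f hf).resLE _ _
        (Proj.fromOfGlobalSections_preimage_basicOpen 𝒜 f hf hn hr).ge ≫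
        Proj.basicOpenToSpec 𝒜 r = κ ≫ Spec.map (CommRingCat.ofHom (awayEval 𝒜 f r)) := by
  refine ⟨(Z.isoOfEq (Z.toSpecΓ_preimage_basicOpen (f r))).inv ≫ Z.toSpecΓ ∣_ _ ≫
    (basicOpenIsoSpecAway _).hom, ?_, ?_⟩
  · simp only [Category.assoc, basicOpenIsoSpecAway_hom_SpecMap]
    rw [Scheme.isoOfEq_inv]
    exact (congrArg (Z.homOfLE _ ≫ ·) (morphismRestrict_ι Z.toSpecΓ
      (PrimeSpectrum.basicOpen (f r)))).trans (Scheme.homOfLE_ι_assoc ..)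
  · rw [Proj.fromOfGlobalSections_resLE 𝒜 f hf hn hr, Proj.toBasicOpenOfGlobalSections,
      ← Proj.basicOpenIsoSpec_hom 𝒜 r hr hn]
    simp only [Category.assoc, Iso.inv_hom_id]
    simp [awayEval]

theorem topIso_inv_resLE_appTop {X Y : Scheme.{u}} (f : X ⟶ Y) {U : Y.Opens} {V : X.Opens}
    (e : V ≤ f ⁻¹ᵁ U) : U.topIso.inv ≫ (f.resLE U V e).appTop = f.appLE U V e ≫ V.topIso.inv :=
  (Iso.inv_comp_eq _).mpr (Scheme.Hom.resLE_app_top f e)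

theorem map_topIso_inv (W : Z.Opens) :
    Z.presheaf.map (homOfLE le_top).op ≫ W.topIso.inv = W.ι.appTop := by
  rw [Scheme.Opens.topIso_inv]
  exact (Z.presheaf.map_comp _ _).symm

theorem mul_pow_eq_of_map {B C D : Type*} [CommRing B] [CommRing C] [CommRing D] {t : B →+* C}
    (ht : Function.Injective t) (κ : D →+* C) {b x a : B} {y x' a' : D} {m : ℕ} (hb : t b = κ y)
    (hx : t x = κ x') (ha : t a = κ a') (h : y * x' ^ m = a') : b * x ^ m = a := by
  apply ht
  rw [map_mul, map_pow, hb, hx, ha, ← h, map_mul, map_pow]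

theorem awayEval_mul_pow (z : Away 𝒜 r) {a : R} {m : ℕ}
    (hz : z.val * algebraMap R _ r ^ m = algebraMap R _ a) :
    awayEval 𝒜 f r z * algebraMap Γ(Z, ⊤) (Localization.Away (f r)) (f r) ^ m =
    algebraMap Γ(Z, ⊤) (Localization.Away (f r)) (f a) := by
  have := congrArg (IsLocalization.map (M := .powers r) (T := .powers (f r))
    (Localization.Away (f r)) f (by rw [← Submonoid.map_le_iff_le_comap, Submonoid.map_powers])) hz
  rw [map_mul, map_pow, IsLocalization.map_eq, IsLocalization.map_eq] at this
  exact this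

/-- The relation `z r ^ m = a` is moved through `κ`; clearing denominators avoids naming inverses on
`Z`. -/
theorem appLE_fromOfGlobalSections_basicOpen (hr : r ∈ 𝒜 n) (hn : 0 < n) (z : Away 𝒜 r) (a : R)
    (m : ℕ) (hz : z.val * algebraMap R _ r ^ m = algebraMap R _ a) :
    (Proj.fromOfGlobalSections 𝒜 f hf).appLE _ _
      (Proj.fromOfGlobalSections_preimage_basicOpen 𝒜 f hf hn hr).ge (Proj.awayToSection 𝒜 r z) *
      (Z.presheaf.map (homOfLE le_top).op (f r)) ^ m =
      Z.presheaf.map (homOfLE (le_top : Z.basicOpen (f r) ≤ ⊤)).op (f a) := by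
  have hx := Proj.fromOfGlobalSections_preimage_basicOpen 𝒜 f hf hn hr
  obtain ⟨κ, hκ, hκ'⟩ := exists_resLE_comp_eq 𝒜 f hf hr hn
  have h2 (g : R) : (Z.basicOpen (f r)).topIso.inv (Z.presheaf.map (homOfLE le_top).op (f g)) =
      evalSpec κ (algebraMap Γ(Z, ⊤) (Localization.Away (f r)) (f g)) := by
    refine Eq.trans ?_ (evalSpec_comp κ (CommRingCat.ofHom (algebraMap Γ(Z, ⊤) _)) (f g))
    rw [hκ]
    exact (congr(($(map_topIso_inv (Z.basicOpen (f r)))).hom (f g))).trans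
      (evalSpec_ι_toSpecΓ _ _).symm
  refine mul_pow_eq_of_map (t := (Z.basicOpen (f r)).topIso.inv.hom)
    (ConcreteCategory.bijective_of_isIso (Z.basicOpen (f r)).topIso.inv).1 (evalSpec κ) ?_
    (h2 r) (h2 a) (awayEval_mul_pow 𝒜 f z hz)
  refine Eq.trans ?_ (evalSpec_comp κ (CommRingCat.ofHom (awayEval 𝒜 f r)) z)
  rw [← hκ']
  have h : (Scheme.ΓSpecIso (.of (Away 𝒜 r))).inv ≫ ((Proj.fromOfGlobalSections
      𝒜 f hf).resLE _ _ hx.ge ≫ Proj.basicOpenToSpec 𝒜 r).appTop =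
      Proj.awayToSection 𝒜 r ≫ (Proj.fromOfGlobalSections 𝒜 f hf).appLE _ _ hx.ge ≫
        (Z.basicOpen (f r)).topIso.inv := by
    have h4 : (Proj.basicOpenToSpec 𝒜 r).appTop = _ := Proj.basicOpenToSpec_app_top 𝒜 r
    rw [Scheme.Hom.comp_appTop, h4, Category.assoc, Category.assoc, topIso_inv_resLE_appTop,
      Iso.inv_hom_id_assoc]
  exact congr(($h).hom z).symm

/-- The pullback of `a / r ^ m` along the morphism to `Proj` given by a ring homomorphism. -/
theorem appLE_fromOfGlobalSections (hr : r ∈ 𝒜 n) (hn : 0 < n) {W : Z.Opens}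
    (hW : W ≤ Proj.fromOfGlobalSections 𝒜 f hf ⁻¹ᵁ Proj.basicOpen 𝒜 r) (z : Away 𝒜 r) (a : R)
    (m : ℕ) (hz : z.val * algebraMap R _ r ^ m = algebraMap R _ a) :
    (Proj.fromOfGlobalSections 𝒜 f hf).appLE _ W hW (Proj.awayToSection 𝒜 r z) *
      (Z.presheaf.map (homOfLE le_top).op (f r)) ^ m =
      Z.presheaf.map (homOfLE (le_top : W ≤ ⊤)).op (f a) := by
  have hx := Proj.fromOfGlobalSections_preimage_basicOpen 𝒜 f hf hn hr
  have := congrArg (Z.presheaf.map (homOfLE (hW.trans hx.le)).op)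
    (appLE_fromOfGlobalSections_basicOpen 𝒜 f hf hr hn z a m hz)
  have h1 (g : Γ(Z, ⊤)) : Z.presheaf.map (homOfLE (hW.trans hx.le)).op
      (Z.presheaf.map (homOfLE le_top).op g) = Z.presheaf.map (homOfLE (le_top : W ≤ ⊤)).op g :=
    congr(($(Z.presheaf.map_comp _ _)).hom g).symm
  have h2 := congr(($(Scheme.Hom.appLE_map (Proj.fromOfGlobalSections 𝒜 f hf) hx.ge
    (homOfLE (hW.trans hx.le)).op)).hom (Proj.awayToSection 𝒜 r z))
  rw [map_mul, map_pow, h1, h1] at this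
  refine Eq.trans ?_ this
  exact congrArg (· * _) h2.symm

end ProjSections

/-! ### Functions on open subsets of a vector bundle -/

section BundleFunctions

variable {k : Type u} [Field k] {A : Type u} [CommRing A] [Algebra k A] {M : Type u}
  [AddCommGroup M] [Module A M] {T T' : SchemeOver k}

/-- Evaluation of functions on a vector bundle at a point defined on an open subset. -/
def evalOn (v : T ⟶ totalSpace k A M) (W : T.left.Opens) : Sym A M →+* Γ(T.left, W) :=
  (T.left.presheaf.map (homOfLE (le_top : W ≤ ⊤)).op).hom.comp (evalAt v)

theorem evalOn_apply (v : T ⟶ totalSpace k A M) (W : T.left.Opens) (s : Sym A M) :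
    evalOn v W s = T.left.presheaf.map (homOfLE (le_top : W ≤ ⊤)).op (evalAt v s) := rfl

theorem map_evalOn (v : T ⟶ totalSpace k A M) {W W' : T.left.Opens} (h : W' ≤ W) (s : Sym A M) :
    T.left.presheaf.map (homOfLE h).op (evalOn v W s) = evalOn v W' s :=
  congr(($(T.left.presheaf.map_comp (homOfLE (le_top : W ≤ ⊤)).op (homOfLE h).op)).hom
    (evalAt v s)).symm

theorem evalOn_top (v : T ⟶ totalSpace k A M) (s : Sym A M) : evalOn v ⊤ s = evalAt v s :=
  congr(($(T.left.presheaf.map_id _)).hom (evalAt v s))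

theorem pull_evalAt_eq_evalOn (f : T' ⟶ T) (v : T ⟶ totalSpace k A M) (W : T'.left.Opens)
    (s : Sym A M) : pull f (le_preimage_top f W) (evalAt v s) = evalOn (f ≫ v) W s := by
  rw [evalOn_apply, ← pull_evalAt, pull_map]

theorem pull_evalOn (f : T' ⟶ T) (v : T ⟶ totalSpace k A M) {W : T.left.Opens} {W' : T'.left.Opens}
    (h : W' ≤ f.left ⁻¹ᵁ W) (s : Sym A M) : pull f h (evalOn v W s) = evalOn (f ≫ v) W' s := by
  have h1 : evalOn v W s = pull (𝟙 T) (le_preimage_top _ W) (evalAt v s) := by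
    rw [pull_evalAt_eq_evalOn, Category.id_comp]
  rw [h1, pull_pull, pull_congr (Category.comp_id f), pull_evalAt_eq_evalOn]

theorem evalOn_isUnit (v : T ⟶ totalSpace k A M) {W : T.left.Opens} {s : Sym A M}
    (h : W ≤ T.left.basicOpen (evalAt v s)) : IsUnit (evalOn v W s) := by
  have := (T.left.toRingedSpace.isUnit_res_basicOpen (evalAt v s)).map
    (T.left.presheaf.map (homOfLE h).op).hom
  rw [← map_evalOn v h]
  exact this

variable (k) in
/-- The nonvanishing locus of a function on a vector bundle. -/
def bundleOpen (f : Sym A M) : (totalSpace k A M).left.Opens :=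
  (totalSpace k A M).left.basicOpen (evalAt (𝟙 (totalSpace k A M)) f)

theorem preimage_bundleOpen (v : T ⟶ totalSpace k A M) (f : Sym A M) :
    v.left ⁻¹ᵁ bundleOpen k f = T.left.basicOpen (evalAt v f) := by
  have := basicOpen_pull v (le_preimage_top v ⊤) (evalAt (𝟙 (totalSpace k A M)) f)
  rw [pull_evalAt, Category.comp_id] at this
  rw [this]
  exact (top_inf_eq _).symm

instance : IsAffine (totalSpace k A M).left := inferInstanceAs (IsAffine (Spec _))

theorem isAffineOpen_bundleOpen (f : Sym A M) : IsAffineOpen (bundleOpen k f) :=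
  (isAffineOpen_top (totalSpace k A M).left).basicOpen _

theorem evalAt_id_bijective :
    Function.Bijective (evalAt (𝟙 (totalSpace k A M))) := by
  have : (evalAt (𝟙 (totalSpace k A M)) : Sym A M → _) =
      (Scheme.ΓSpecIso (.of (Sym A M))).inv :=
    funext fun s => evalSpec_id (A := .of (Sym A M)) s
  rw [this]
  exact ConcreteCategory.bijective_of_isIso _

theorem exists_mul_pow_eq_res {X : Scheme.{u}} [IsAffine X] (g : Γ(X, ⊤))
    (c : Γ(X, X.basicOpen g)) : ∃ (m : ℕ) (a : Γ(X, ⊤)),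
      c * X.presheaf.map (homOfLE le_top).op g ^ m = X.presheaf.map (homOfLE le_top).op a := by
  have := (isAffineOpen_top X).isLocalization_basicOpen g
  exact IsLocalization.Away.surj g c

theorem exists_pow_mul_eq_zero_of_res {X : Scheme.{u}} [IsAffine X] (g a : Γ(X, ⊤))
    (h : X.presheaf.map (homOfLE (le_top : X.basicOpen g ≤ ⊤)).op a = 0) :
    ∃ m : ℕ, g ^ m * a = 0 := by
  have := (isAffineOpen_top X).isLocalization_basicOpen g
  obtain ⟨m, hm⟩ := IsLocalization.Away.exists_of_eq (S := Γ(X, X.basicOpen g)) g (a := a)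
    (b := 0) (h.trans (map_zero _).symm)
  exact ⟨m, hm.trans (mul_zero _)⟩

theorem exists_mul_pow_eq_evalOn (f : Sym A M) (c : Γ((totalSpace k A M).left, bundleOpen k f)) :
    ∃ (m : ℕ) (s : Sym A M), c * evalOn (𝟙 _) (bundleOpen k f) f ^ m =
      evalOn (𝟙 _) (bundleOpen k f) s := by
  obtain ⟨m, a, h⟩ := exists_mul_pow_eq_res (evalAt (𝟙 (totalSpace k A M)) f) c
  obtain ⟨s, rfl⟩ := evalAt_id_bijective.2 a
  exact ⟨m, s, h⟩

theorem exists_pow_mul_eq_zero (f : Sym A M) {s : Sym A M}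
    (h : evalOn (𝟙 _) (bundleOpen k f) s = 0) : ∃ m : ℕ, f ^ m * s = 0 := by
  obtain ⟨m, hm⟩ := exists_pow_mul_eq_zero_of_res (evalAt (𝟙 (totalSpace k A M)) f) _ h
  refine ⟨m, (evalAt_id_bijective (k := k)).1 ?_⟩
  rw [map_mul, map_pow, map_zero, hm]

end BundleFunctions

/-! ### Weights of functions on a vector bundle -/

section BundleWeights

variable {k : Type u} [Field k] {A : Type u} [CommRing A] [Algebra k A] {M : Type u}
  [AddCommGroup M] [Module A M]

theorem isUnit_chr {T : SchemeOver k} (t : T ⟶ Gm k) (W : T.left.Opens) (n : ℤ) :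
    IsUnit (chr t W n) :=
  .of_mul_eq_one (chr t W (-n)) (by rw [← chr_add, add_neg_cancel, chr_zero])

theorem map_chr {T : SchemeOver k} (t : T ⟶ Gm k) {W W' : T.left.Opens} (h : W' ≤ W) (n : ℤ) :
    T.left.presheaf.map (homOfLE h).op (chr t W n) = chr t W' n :=
  pull_map (le_preimage_top t W) h _

theorem actMap_Gm_eq_scale : actMap (Gm k) (totalSpace k A M) = scale (fst _ _) (snd _ _) := rfl

/-- Scaling by `t` multiplies `f` by the unit `t ^ d`. -/
theorem isInvariantOpen_bundleOpen {f : Sym A M} {d : ℕ} (hf : f ∈ symGrading A M d) :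
    IsInvariantOpen (Gm k) (bundleOpen k f) := by
  rw [IsInvariantOpen, preimage_bundleOpen, preimage_bundleOpen, actMap_Gm_eq_scale,
    evalAt_scale_of_mem _ _ hf, Scheme.basicOpen_mul,
    Scheme.basicOpen_of_isUnit _ (isUnit_chr _ _ _), inf_top_eq]

variable {O : (totalSpace k A M).left.Opens} (hO : IsAffineOpen O)
  (hinv : IsInvariantOpen (Gm k) O)

theorem evalOn_mem_weightSpace {s : Sym A M} {n : ℕ} (hs : s ∈ symGrading A M n) :
    evalOn (𝟙 _) O s ∈ weightSpace hinv n := by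
  rw [mem_weightSpace, pull_evalOn, pull_evalOn, Category.comp_id, Category.comp_id,
    actMap_Gm_eq_scale, evalOn_apply, evalAt_scale_of_mem _ _ hs, map_mul]
  congr 1
  exact map_chr _ _ _

open DirectSum in
theorem weightComponents_evalOn (s : Sym A M) (n : ℕ) :
    weightComponents hO hinv (evalOn (𝟙 _) O s) n =
      evalOn (𝟙 _) O (decompose (symGrading A M) s n : Sym A M) := by
  let Θ : Γ((totalSpace k A M).left, O) →+ ℤ →₀ Γ((totalSpace k A M).left, O) :=
    AddMonoidHom.mk' (weightComponents hO hinv) (weightComponents_add hO hinv)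
  change Θ _ _ = _
  induction s using DirectSum.Decomposition.inductionOn (symGrading A M) with
  | zero => simp
  | homogeneous m =>
    rename_i i
    change weightComponents hO hinv _ _ = _
    rw [weightComponents_of_mem hO hinv (evalOn_mem_weightSpace hinv m.2), Finsupp.single_apply,
      DirectSum.decompose_coe, DirectSum.coe_of_apply]
    by_cases h : i = n
    · simp [h]
    · simp [h]
  | add a b ha hb =>
    rw [map_add, map_add, Finsupp.add_apply, ha, hb, decompose_add, DirectSum.add_apply, Submodule.coe_add,
      map_add]

theorem mem_weightSpace_of_mul_mem {P : SchemeOver k} [ModObj (Gm k) P] {O : P.left.Opens}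
    {hinv : IsInvariantOpen (Gm k) O} {c u : Γ(P.left, O)} {n e : ℤ} (hu : IsUnit u)
    (hue : u ∈ weightSpace hinv e) (h : c * u ∈ weightSpace hinv (n + e)) :
    c ∈ weightSpace hinv n := by
  rw [mem_weightSpace] at *
  have h1 := hu.map (pull (actMap (Gm k) P) hinv.ge)
  rw [← h1.mul_left_inj, ← map_mul, h, hue, map_mul, chr_add]
  ring

/-- On its nonvanishing locus, `f` itself is a unit of weight `d > 0`. -/
theorem span_weightSpace_bundleOpen {f : Sym A M} {d : ℕ} (hd : 0 < d)
    (hf : f ∈ symGrading A M d) :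
    Ideal.span {c : Γ((totalSpace k A M).left, bundleOpen k f) |
      ∃ n > 0, c ∈ weightSpace (isInvariantOpen_bundleOpen hf) n} = ⊤ :=
  Ideal.eq_top_of_isUnit_mem _ (Ideal.subset_span ⟨d, by exact_mod_cast hd,
    evalOn_mem_weightSpace _ hf⟩) (evalOn_isUnit (𝟙 _) le_rfl)

end BundleWeights

/-! ### Points and functions on the projectivization -/

section ProjPoints

open HomogeneousLocalization

variable {k : Type u} [Field k] {A : Type u} [CommRing A] [Algebra k A] {M : Type u}
  [AddCommGroup M] [Module A M] {T T' : SchemeOver k} {f : Sym A M} {d : ℕ}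

theorem hom_ext_of_pull_eq {Y : SchemeOver k} [IsAffine T.left] {U : Y.left.Opens}
    (hU : IsAffineOpen U) {x y : T ⟶ Y} (hx : ⊤ ≤ x.left ⁻¹ᵁ U) (hy : ⊤ ≤ y.left ⁻¹ᵁ U)
    (h : ∀ b, pull x hx b = pull y hy b) : x = y := by
  have h1 : x.left.appLE U ⊤ hx = y.left.appLE U ⊤ hy := CommRingCat.hom_ext (RingHom.ext h)
  apply Over.OverMorphism.ext
  have : IsIso (isAffineOpen_top T.left).fromSpec := by
    rw [IsAffineOpen.fromSpec_top]; infer_instance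
  rw [← cancel_epi (isAffineOpen_top T.left).fromSpec,
    ← IsAffineOpen.SpecMap_appLE_fromSpec x.left hU (isAffineOpen_top _) hx, h1,
    IsAffineOpen.SpecMap_appLE_fromSpec]

theorem nowhereZero_of_isUnit (hd : 0 < d) (hf : f ∈ symGrading A M d)
    {v : T ⟶ totalSpace k A M} (h : IsUnit (evalAt v f)) : NowhereZero v :=
  Ideal.eq_top_of_isUnit_mem _ (Ideal.mem_map_of_mem _
    (HomogeneousIdeal.mem_irrelevant_of_mem _ hd hf)) h

theorem preimage_toProj_basicOpen (hd : 0 < d) (hf : f ∈ symGrading A M d)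
    (v : T ⟶ totalSpace k A M) (hv : NowhereZero v) :
    (toProj v hv).left ⁻¹ᵁ Proj.basicOpen (symGrading A M) f = T.left.basicOpen (evalAt v f) :=
  Proj.fromOfGlobalSections_preimage_basicOpen _ _ _ hd hf

theorem pull_toProj_mul_pow (hd : 0 < d) (hf : f ∈ symGrading A M d)
    (v : T ⟶ totalSpace k A M) (hv : NowhereZero v) {W : T.left.Opens}
    (hW : W ≤ (toProj v hv).left ⁻¹ᵁ Proj.basicOpen (symGrading A M) f)
    {z : Away (symGrading A M) f} {a : Sym A M} {m : ℕ}
    (hz : z.val * algebraMap _ _ f ^ m = algebraMap _ _ a) :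
    pull (toProj v hv) hW (Proj.awayToSection _ f z) * evalOn v W f ^ m = evalOn v W a :=
  appLE_fromOfGlobalSections _ _ _ hf hd hW z a m hz

theorem exists_awayToSection_eq (hd : 0 < d) (hf : f ∈ symGrading A M d)
    (b : Γ((projBundle k A M).left, Proj.basicOpen (symGrading A M) f)) :
    ∃ (z : Away (symGrading A M) f) (m : ℕ) (a : Sym A M), a ∈ symGrading A M (m * d) ∧
      Proj.awayToSection _ f z = b ∧ z.val * algebraMap _ _ f ^ m = algebraMap _ _ a := by
  obtain ⟨z, rfl⟩ := (ConcreteCategory.bijective_of_isIso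
    (Proj.basicOpenIsoAway (symGrading A M) f hf hd).hom).2 b
  obtain ⟨m, a, ha, rfl⟩ := Away.mk_surjective (symGrading A M) hf z
  refine ⟨_, m, a, ha, rfl, ?_⟩
  rw [Away.val_mk, ← map_pow]
  exact IsLocalization.mk'_spec (Localization.Away f) a (⟨f ^ m, m, rfl⟩ : Submonoid.powers f) ▸ by
    rw [Localization.mk_eq_mk']

theorem exists_away_eq {m : ℕ} (hf : f ∈ symGrading A M d) {a : Sym A M}
    (ha : a ∈ symGrading A M (m * d)) : ∃ z : Away (symGrading A M) f,
      z.val * algebraMap _ _ f ^ m = algebraMap _ _ a := by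
  refine ⟨Away.mk (symGrading A M) hf m a ha, ?_⟩
  rw [Away.val_mk, ← map_pow]
  exact IsLocalization.mk'_spec (Localization.Away f) a (⟨f ^ m, m, rfl⟩ : Submonoid.powers f) ▸ by
    rw [Localization.mk_eq_mk']

end ProjPoints

/-! ### The chart from the nonvanishing locus of a form to the projectivization -/

section Chart

variable (k : Type u) [Field k] {A : Type u} [CommRing A] [Algebra k A] {M : Type u}
  [AddCommGroup M] [Module A M]

/-- The nonvanishing locus of a function on a vector bundle, as a scheme. -/
abbrev bundleChart (f : Sym A M) : SchemeOver k := openSub (totalSpace k A M) (bundleOpen k f)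

/-- The inclusion of the nonvanishing locus of a function. -/
def chartι (f : Sym A M) : bundleChart k f ⟶ totalSpace k A M := Over.homMk (bundleOpen k f).ι

instance (f : Sym A M) : IsAffine (bundleChart k f).left := isAffineOpen_bundleOpen f

variable {k} {f : Sym A M} {d : ℕ} (hd : 0 < d) (hf : f ∈ symGrading A M d)

theorem preimage_chartι : (chartι k f).left ⁻¹ᵁ bundleOpen k f = ⊤ :=
  (bundleOpen k f).ι_preimage_self

theorem opensι_appLE_bijective {X : Scheme.{u}} (U : X.Opens) (h : ⊤ ≤ U.ι ⁻¹ᵁ U) :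
    Function.Bijective (U.ι.appLE U ⊤ h) := by
  have h1 : U.ι.appLE U ⊤ h = U.topIso.inv := by
    rw [Scheme.Opens.ι_appLE, Scheme.Opens.topIso_inv]
    rfl
  rw [h1]
  exact ConcreteCategory.bijective_of_isIso _

theorem pull_chartι_bijective :
    Function.Bijective (pull (chartι k f) preimage_chartι.ge) :=
  opensι_appLE_bijective _ _

theorem isUnit_evalAt_chartι : IsUnit (evalAt (chartι k f) f) := by
  rw [← evalOn_top]
  exact evalOn_isUnit _ (by rw [← preimage_bundleOpen, preimage_chartι])

/-- The canonical morphism from the nonvanishing locus of `f` to the projectivization. -/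
def chartProj : bundleChart k f ⟶ projBundle k A M :=
  toProj (chartι k f) (nowhereZero_of_isUnit hd hf isUnit_evalAt_chartι)

theorem preimage_chartProj :
    (chartProj (k := k) hd hf).left ⁻¹ᵁ Proj.basicOpen (symGrading A M) f = ⊤ := by
  rw [chartProj, preimage_toProj_basicOpen hd hf, ← preimage_bundleOpen, preimage_chartι]

/-- Pullback of functions from an open subset of the projectivization to the vector bundle. -/
def chartMap : Γ((projBundle k A M).left, Proj.basicOpen (symGrading A M) f) →+*
    Γ((totalSpace k A M).left, bundleOpen k f) :=
  (RingEquiv.ofBijective _ pull_chartι_bijective).symm.toRingHom.comp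
    (pull (chartProj hd hf) (preimage_chartProj hd hf).ge)

theorem pull_chartMap (b) : pull (chartι k f) preimage_chartι.ge (chartMap hd hf b) =
    pull (chartProj hd hf) (preimage_chartProj hd hf).ge b :=
  (RingEquiv.ofBijective _ pull_chartι_bijective).apply_symm_apply _

theorem chartMap_awayToSection {z : HomogeneousLocalization.Away (symGrading A M) f}
    {a : Sym A M} {m : ℕ} (hz : z.val * algebraMap _ _ f ^ m = algebraMap _ _ a) :
    chartMap (k := k) hd hf (Proj.awayToSection _ f z) * evalOn (𝟙 _) (bundleOpen k f) f ^ m =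
      evalOn (𝟙 _) (bundleOpen k f) a := by
  apply pull_chartι_bijective.1
  rw [map_mul, map_pow, pull_chartMap, pull_evalOn, pull_evalOn, Category.comp_id]
  exact pull_toProj_mul_pow hd hf _ _ _ hz

theorem chartMap_algebraMap (a : k) :
    chartMap (k := k) hd hf (algebraMap k _ a) = algebraMap k _ a := by
  apply pull_chartι_bijective.1
  rw [pull_chartMap, pull_algebraMap, pull_algebraMap]

/-- If `a / f ^ m` vanishes on `D(f)`, then `a` is killed by a power of `f` in `Sym A M`, so the
fraction is already zero. -/
theorem chartMap_injective : Function.Injective (chartMap (k := k) hd hf) := by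
  rw [injective_iff_map_eq_zero]
  intro b hb
  obtain ⟨z, m, a, -, rfl, hz⟩ := exists_awayToSection_eq hd hf b
  have h1 := chartMap_awayToSection (k := k) hd hf hz
  rw [hb, zero_mul] at h1
  obtain ⟨n, hn⟩ := exists_pow_mul_eq_zero f h1.symm
  have h2 : (algebraMap (Sym A M) (Localization.Away f)) a = 0 := by
    rw [← (IsLocalization.Away.algebraMap_pow_isUnit (S := Localization.Away f) f n).mul_right_inj,
      ← map_pow, ← map_mul, hn, map_zero, mul_zero]
  have h3 : z.val = 0 := by
    rwa [← hz, (IsLocalization.Away.algebraMap_pow_isUnit f m).mul_left_eq_zero] at h2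
  have h4 : z = 0 :=
    HomogeneousLocalization.val_injective _ (by rw [h3, HomogeneousLocalization.val_zero])
  rw [h4]
  exact map_zero _

/-- Functions on `D₊(f)` are fractions `a / f ^ m` with `a` of degree `m * d`, that is, those of
weight zero on `D(f)`. -/
theorem mem_range_chartMap_iff (c : Γ((totalSpace k A M).left, bundleOpen k f)) :
    c ∈ Set.range (chartMap hd hf) ↔ c ∈ weightSpace (isInvariantOpen_bundleOpen hf) 0 := by
  have hu : IsUnit (evalOn (𝟙 (totalSpace k A M)) (bundleOpen k f) f) := evalOn_isUnit _ le_rfl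
  have hfm (m : ℕ) : evalOn (𝟙 (totalSpace k A M)) (bundleOpen k f) f ^ m ∈
      weightSpace (isInvariantOpen_bundleOpen hf) ((m * d : ℕ) : ℤ) := by
    rw [← map_pow]
    exact evalOn_mem_weightSpace _ (SetLike.pow_mem_graded m hf)
  constructor
  · rintro ⟨b, rfl⟩
    obtain ⟨z, m, a, ha, rfl, hz⟩ := exists_awayToSection_eq hd hf b
    refine mem_weightSpace_of_mul_mem (hu.pow m) (hfm m) ?_
    rw [chartMap_awayToSection hd hf hz, zero_add]
    exact evalOn_mem_weightSpace _ ha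
  · intro hc
    obtain ⟨m, s, hs⟩ := exists_mul_pow_eq_evalOn f c
    have hO := isAffineOpen_bundleOpen (k := k) f
    have hinv := isInvariantOpen_bundleOpen (k := k) hf
    have h1 : evalOn (𝟙 _) (bundleOpen k f) s ∈ weightSpace hinv ((m * d : ℕ) : ℤ) := by
      rw [← hs, ← zero_add ((m * d : ℕ) : ℤ)]
      exact mul_mem_weightSpace hc (hfm m)
    -- The numerator `s` need not be homogeneous in `Sym A M`, but its component of degree `m * d`
    -- has the same image on `D(f)`.
    have h2 := weightComponents_evalOn hO hinv s (m * d)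
    rw [weightComponents_of_mem hO hinv h1, Finsupp.single_eq_same] at h2
    obtain ⟨z, hz⟩ := exists_away_eq hf (DirectSum.decompose (symGrading A M) s (m * d)).2
    refine ⟨Proj.awayToSection _ f z, (hu.pow m).mul_left_inj.mp ?_⟩
    rw [chartMap_awayToSection hd hf hz, hs, h2]

variable {T : SchemeOver k}

/-- A function on the projectivization and its pullback to the bundle agree at points of the
bundle. -/
theorem pull_toProj (v : T ⟶ totalSpace k A M) (hv : NowhereZero v) {W : T.left.Opens}
    (hW : W ≤ (toProj v hv).left ⁻¹ᵁ Proj.basicOpen (symGrading A M) f)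
    (hW' : W ≤ v.left ⁻¹ᵁ bundleOpen k f) (b) :
    pull (toProj v hv) hW b = pull v hW' (chartMap hd hf b) := by
  obtain ⟨z, m, a, -, rfl, hz⟩ := exists_awayToSection_eq hd hf b
  have h1 := congrArg (pull v hW') (chartMap_awayToSection hd hf hz)
  rw [map_mul, map_pow, pull_evalOn, pull_evalOn, Category.comp_id] at h1
  have hu : IsUnit (evalOn v W f) := evalOn_isUnit v (by rwa [← preimage_bundleOpen])
  rw [← (hu.pow m).mul_left_inj, h1]
  exact pull_toProj_mul_pow hd hf _ _ _ hz

/-- Both morphisms land in the affine chart `D₊(f)`, where they are compared on functions. -/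
theorem comp_toProj (hd : 0 < d) (hf : f ∈ symGrading A M d) {T' : SchemeOver k}
    [IsAffine T'.left] (x : T' ⟶ T) (v : T ⟶ totalSpace k A M) (hv : NowhereZero v)
    (hv' : NowhereZero (x ≫ v)) (h : IsUnit (evalAt v f)) :
    x ≫ toProj v hv = toProj (x ≫ v) hv' := by
  have hv1 : ⊤ ≤ v.left ⁻¹ᵁ bundleOpen k f := by
    rw [preimage_bundleOpen, Scheme.basicOpen_of_isUnit _ h]
  have hxv1 : ⊤ ≤ (x ≫ v).left ⁻¹ᵁ bundleOpen k f := le_preimage_comp x v hv1 le_top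
  have hv2 := (preimage_toProj_basicOpen hd hf v hv).trans (preimage_bundleOpen v f).symm
  have hxv2 := (preimage_toProj_basicOpen hd hf _ hv').trans (preimage_bundleOpen (x ≫ v) f).symm
  refine hom_ext_of_pull_eq (Proj.isAffineOpen_basicOpen _ f hf hd)
    (le_preimage_comp x _ (hv1.trans hv2.ge) le_top) (hxv1.trans hxv2.ge) fun b => ?_
  rw [← pull_pull x _ (hv1.trans hv2.ge) (le_preimage_top x ⊤), pull_toProj hd hf v hv _ hv1,
    pull_toProj hd hf _ hv' _ hxv1, pull_pull]

theorem bundleOpen_eq (g : Sym A M) : bundleOpen k g = PrimeSpectrum.basicOpen g :=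
  (congrArg (Spec (.of (Sym A M))).basicOpen (evalSpec_id (A := .of (Sym A M)) g)).trans
    (basicOpen_eq_of_affine (R := .of (Sym A M)) g)

/-- A homogeneous prime is in particular a prime of `Sym A M`, hence a point of `V`; its image
contains the same homogeneous elements. -/
theorem exists_chartProj_eq (x : (projBundle k A M).left)
    (hx : x ∈ Proj.basicOpen (symGrading A M) f) :
    ∃ t, (chartProj (k := k) hd hf).left t = x := by
  let p : (totalSpace k A M).left :=
    (⟨(x : ProjectiveSpectrum (symGrading A M)).asHomogeneousIdeal.toIdeal,
      (x : ProjectiveSpectrum (symGrading A M)).isPrime⟩ : PrimeSpectrum (Sym A M))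
  have hp (g : Sym A M) : p ∈ bundleOpen k g ↔ x ∈ Proj.basicOpen (symGrading A M) g := by
    rw [bundleOpen_eq]
    rfl
  have hpf : p ∈ bundleOpen k f := (hp f).mpr hx
  refine ⟨(⟨p, hpf⟩ : bundleOpen k f), ?_⟩
  have key {g : Sym A M} {e : ℕ} (he : 0 < e) (hg : g ∈ symGrading A M e) :
      (chartProj (k := k) hd hf).left (⟨p, hpf⟩ : bundleOpen k f) ∈
        Proj.basicOpen (symGrading A M) g ↔ x ∈ Proj.basicOpen (symGrading A M) g := by
    rw [← hp]
    have := (preimage_toProj_basicOpen he hg (chartι k f) (nowhereZero_of_isUnit hd hf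
      isUnit_evalAt_chartι)).trans (preimage_bundleOpen (chartι k f) g).symm
    exact SetLike.ext_iff.mp this (⟨p, hpf⟩ : bundleOpen k f)
  generalize (chartProj (k := k) hd hf).left (⟨p, hpf⟩ : bundleOpen k f) = y at key
  have hy := (key hd hf).mpr hx
  refine ProjectiveSpectrum.ext (HomogeneousIdeal.ext' fun i g hg => ?_)
  -- `key` needs positive degree; multiplying by `f` covers the case where `g` has degree zero.
  have h1 := key (add_pos_of_nonneg_of_pos i.zero_le hd) (SetLike.mul_mem_graded hg hf)
  rw [Proj.basicOpen_mul] at h1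
  have h2 := (and_iff_left hy).symm.trans (h1.trans (and_iff_left hx))
  exact not_iff_not.mp h2

end Chart

/-! ### Compatibility of the charts with the group action -/

section ChartAction

variable {k : Type u} [Field k] {A : Type u} [CommRing A] [Algebra k A] {M : Type u}
  [AddCommGroup M] [Module A M] {G : SchemeOver k} {f g : Sym A M} {d e : ℕ} (hd : 0 < d)
  (hf : f ∈ symGrading A M d)

/-- `G ◁ x` is the base change of `x` along the projection `G × X → X`. -/
theorem exists_whiskerLeft_eq {T X : SchemeOver k} (x : T ⟶ X) (y : (G ⊗ X).left) (t : T.left)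
    (h : x.left t = (snd G X).left y) : ∃ z, (G ◁ x).left z = y := by
  have h1 : IsPullback (G ◁ x).left (snd G T).left (snd G X).left x.left := by
    refine IsPullback.of_right (h₁₂ := (fst G X).left) (h₂₂ := X.hom) (v₁₃ := G.hom) ?_ ?_
      (isPullback_left G X)
    · have h2 : (G ◁ x).left ≫ (fst G X).left = (fst G T).left :=
        congrArg (·.left) (whiskerLeft_fst G x)
      rw [h2, Over.w x]
      exact isPullback_left G T
    · exact congrArg (·.left) (whiskerLeft_snd G x)
  obtain ⟨z, hz, -⟩ := Scheme.Pullback.exists_preimage_pullback (f := (snd G X).left)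
    (g := x.left) y t h.symm
  refine ⟨h1.isoPullback.inv z, ?_⟩
  rw [← hz, ← h1.isoPullback_inv_fst]
  rfl

theorem isUnit_evalAt_snd_chartι : IsUnit (evalAt (snd G (bundleChart k f) ≫ chartι k f) f) := by
  rw [← pull_evalAt]
  exact isUnit_evalAt_chartι.map _

theorem isAffine_tensor_bundleChart [IsAffineHom G.hom] : IsAffine (G ⊗ bundleChart k f).left :=
  have := isAffineHom_snd_left G (bundleChart k f)
  isAffine_of_isAffineHom (snd G (bundleChart k f)).left

theorem snd_chartProj [IsAffineHom G.hom] :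
    snd G _ ≫ chartProj (k := k) hd hf = toProj (snd G _ ≫ chartι k f)
    (nowhereZero_of_isUnit hd hf isUnit_evalAt_snd_chartι) :=
  have := isAffine_tensor_bundleChart (G := G) (f := f)
  comp_toProj hd hf _ _ _ _ isUnit_evalAt_chartι

variable [GrpObj G]

theorem whiskerLeft_comp_actMap {X T : SchemeOver k} [ModObj G X] (x : T ⟶ X) :
    (G ◁ x) ≫ actMap G X = act (fst G T) (snd G T ≫ x) := by
  rw [act]
  congr 1

variable [ModObj G (totalSpace k A M)]

variable (G) in
/-- A function on an equivariant vector bundle is invariant. -/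
def IsInvariantFunction (f : Sym A M) : Prop :=
  evalAt (actMap G (totalSpace k A M)) f = evalAt (snd G (totalSpace k A M)) f

theorem IsInvariantFunction.isInvariantOpen (h : IsInvariantFunction G f) :
    IsInvariantOpen G (bundleOpen k f) := by
  rw [IsInvariantOpen, preimage_bundleOpen, preimage_bundleOpen, h]

theorem IsInvariantFunction.evalAt_whiskerLeft (h : IsInvariantFunction G f) {T : SchemeOver k}
    (v : T ⟶ totalSpace k A M) :
    evalAt ((G ◁ v) ≫ actMap G _) f = evalAt (snd G T ≫ v) f := by
  rw [← pull_evalAt, h, pull_evalAt, whiskerLeft_snd]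

theorem IsInvariantFunction.isUnit_evalAt (h : IsInvariantFunction G f) :
    IsUnit (evalAt ((G ◁ chartι k f) ≫ actMap G _) f) := by
  rw [h.evalAt_whiskerLeft, ← pull_evalAt]
  exact isUnit_evalAt_chartι.map _

variable [ModObj G (projBundle k A M)] [IsAffineHom G.hom]

/-- The induced action is prescribed only on points `[v]`; it is applied to the tautological one on
`G × D(f)`, whose translate is nowhere zero because `f` is invariant. -/
theorem IsInvariantFunction.whiskerLeft_chartProj (h : IsInvariantFunction G f)
    (hind : IsInducedAction (A := A) (M := M) G) :
    (G ◁ chartProj hd hf) ≫ actMap G _ = toProj ((G ◁ chartι k f) ≫ actMap G _)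
      (nowhereZero_of_isUnit hd hf h.isUnit_evalAt) := by
  have h1 : NowhereZero (act (fst G _) (snd G _ ≫ chartι k f)) := by
    rw [← whiskerLeft_comp_actMap]
    exact nowhereZero_of_isUnit hd hf h.isUnit_evalAt
  rw [whiskerLeft_comp_actMap, snd_chartProj hd hf, hind _ _ _ _ h1]
  congr 1

/-- Each point of `G × ℙ(V)` lifts to `G × D(g)` for an invariant form `g`. There both preimages of
`D₊(f)` are nonvanishing loci of pullbacks of `f`, which agree. -/
theorem IsInvariantFunction.isInvariantOpen_basicOpen
    (hind : IsInducedAction (A := A) (M := M) G) (hfG : IsInvariantFunction G f)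
    (hcov : ∀ x : (projBundle k A M).left, ∃ (e : ℕ) (g : Sym A M), 0 < e ∧ g ∈ symGrading A M e ∧
      IsInvariantFunction G g ∧ x ∈ Proj.basicOpen (symGrading A M) g)
    (hd : 0 < d) (hf : f ∈ symGrading A M d) :
    IsInvariantOpen G (X := projBundle k A M) (Proj.basicOpen (symGrading A M) f) := by
  rw [IsInvariantOpen]
  ext y
  obtain ⟨e, g, he, hg, hgG, hy⟩ := hcov ((snd G (projBundle k A M)).left y)
  obtain ⟨t, ht⟩ := exists_chartProj_eq (k := k) he hg _ hy
  obtain ⟨z, rfl⟩ := exists_whiskerLeft_eq (G := G) _ y t ht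
  have h1 := preimage_toProj_basicOpen hd hf ((G ◁ chartι k g) ≫ actMap G _)
    (nowhereZero_of_isUnit he hg hgG.isUnit_evalAt)
  have h2 := preimage_toProj_basicOpen hd hf (snd G _ ≫ chartι k g)
    (nowhereZero_of_isUnit he hg isUnit_evalAt_snd_chartι)
  rw [← hgG.whiskerLeft_chartProj he hg hind, hfG.evalAt_whiskerLeft] at h1
  rw [← snd_chartProj he hg, ← whiskerLeft_snd, ← h1] at h2
  exact SetLike.ext_iff.mp h2.symm z

/-- Functions on `G × D(f)` and on `G × D₊(f)` both pull back injectively to `G` times the chart,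
where the two invariance conditions become the same. -/
theorem IsInvariantFunction.chartMap_mem_invariants_iff
    (hind : IsInducedAction (A := A) (M := M) G) (hfG : IsInvariantFunction G f)
    (hO : IsInvariantOpen G (bundleOpen k f))
    (hN : IsInvariantOpen G (X := projBundle k A M) (Proj.basicOpen (symGrading A M) f)) (b) :
    chartMap hd hf b ∈ invariants hO ↔ b ∈ invariants hN := by
  have hι : (snd G (bundleChart k f)).left ⁻¹ᵁ ⊤ ≤
      (G ◁ chartι k f).left ⁻¹ᵁ ((snd G _).left ⁻¹ᵁ bundleOpen k f) := by
    rw [preimage_left_comp, whiskerLeft_snd, ← preimage_left_comp, preimage_chartι]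
  have hρ : (snd G (bundleChart k f)).left ⁻¹ᵁ ⊤ ≤ (G ◁ chartProj hd hf).left ⁻¹ᵁ
      ((snd G (projBundle k A M)).left ⁻¹ᵁ Proj.basicOpen (symGrading A M) f) := by
    rw [preimage_left_comp, whiskerLeft_snd, ← preimage_left_comp, preimage_chartProj]
  have hιi := pull_whiskerLeft_injective (G := G) (chartι k f) (isAffineOpen_bundleOpen f)
    (isAffineOpen_top _) _ pull_chartι_bijective.1 hι
  have hρi := pull_whiskerLeft_injective (G := G) (chartProj (k := k) hd hf)
    (Proj.isAffineOpen_basicOpen _ f hf hd) (isAffineOpen_top _) (preimage_chartProj hd hf).ge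
    (fun a b hab => by
      rw [← pull_chartMap, ← pull_chartMap] at hab
      exact chartMap_injective hd hf (pull_chartι_bijective.1 hab)) hρ
  have hact : pull (G ◁ chartι k f) hι (pull (actMap G _) hO.ge (chartMap hd hf b)) =
      pull (G ◁ chartProj hd hf) hρ (pull (actMap G _) hN.ge b) := by
    rw [pull_pull, pull_pull, pull_congr (hfG.whiskerLeft_chartProj hd hf hind)]
    exact (pull_toProj hd hf _ _ _ _ b).symm
  have hsnd : pull (G ◁ chartι k f) hι (pull (snd G _) le_rfl (chartMap hd hf b)) =
      pull (G ◁ chartProj hd hf) hρ (pull (snd G _) le_rfl b) := by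
    rw [pull_pull, pull_pull, pull_congr (whiskerLeft_snd G _), pull_congr (whiskerLeft_snd G _),
      ← pull_pull (snd G _) (chartι k f) preimage_chartι.ge le_rfl, pull_chartMap, pull_pull]
  rw [mem_invariants, mem_invariants, ← hιi.eq_iff, ← hρi.eq_iff, hact, hsnd]

end ChartAction

/-! ### Points of the charts -/

section ChartPoints

variable {k : Type u} [Field k] {A : Type u} [CommRing A] [Algebra k A] {M : Type u}
  [AddCommGroup M] [Module A M] {f : Sym A M} {d : ℕ} (hd : 0 < d) (hf : f ∈ symGrading A M d)

theorem exists_mem_basicOpen_iff (p : (totalSpace k A M).left) (hp : p ∈ bundleOpen k f) :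
    ∃ x ∈ Proj.basicOpen (symGrading A M) f,
      (∀ b, x ∈ (projBundle k A M).left.basicOpen b ↔
        p ∈ (totalSpace k A M).left.basicOpen (chartMap hd hf b)) ∧
      ∀ (e : ℕ) (g : Sym A M), 0 < e → g ∈ symGrading A M e →
        (p ∈ bundleOpen k g ↔ x ∈ Proj.basicOpen (symGrading A M) g) := by
  let t : (bundleChart k f).left := (⟨p, hp⟩ : bundleOpen k f)
  refine ⟨(chartProj (k := k) hd hf).left t,
    SetLike.ext_iff.mp (preimage_chartProj (k := k) hd hf) t |>.mpr trivial, fun b => ?_,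
    fun e g he hg => ?_⟩
  · have h1 := basicOpen_pull (chartProj (k := k) hd hf) (preimage_chartProj hd hf).ge b
    rw [← pull_chartMap, basicOpen_pull] at h1
    have h2 := SetLike.ext_iff.mp h1 t
    exact ((and_iff_right trivial).symm.trans (h2.symm.trans (and_iff_right trivial)))
  · have := (preimage_toProj_basicOpen he hg (chartι k f) (nowhereZero_of_isUnit hd hf
      isUnit_evalAt_chartι)).trans (preimage_bundleOpen (chartι k f) g).symm
    exact (SetLike.ext_iff.mp this t).symm

end ChartPoints

/-! ### The irrelevant ideal and finiteness of the symmetric algebra -/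

section SymFinite

variable (k : Type u) [Field k] {A : Type u} [CommRing A] [Algebra k A] {M : Type u}
  [AddCommGroup M] [Module A M]

theorem exists_algebraMap_eq_of_mem {s : Sym A M} (hs : s ∈ symGrading A M 0) :
    ∃ a, algebraMap A (Sym A M) a = s := by
  rwa [symGrading, pow_zero, Submodule.mem_one] at hs

theorem algebraMapInv_of_mem {s : Sym A M} {n : ℕ} (hn : 0 < n) (hs : s ∈ symGrading A M n) :
    SymmetricAlgebra.algebraMapInv s = 0 := by
  induction hs using Submodule.pow_induction_on_left' with
  | algebraMap a => exact absurd hn (lt_irrefl _)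
  | add x y i hx hy ihx ihy => rw [map_add, ihx hn, ihy hn, add_zero]
  | mem_mul m hm i x hx ih =>
    obtain ⟨m, rfl⟩ := hm
    rw [map_mul, SymmetricAlgebra.algebraMapInv_ι, zero_mul]

/-- The augmentation kills positive degrees and is injective on degree zero. -/
theorem mem_irrelevant_iff_algebraMapInv (s : Sym A M) :
    s ∈ HomogeneousIdeal.irrelevant (symGrading A M) ↔ SymmetricAlgebra.algebraMapInv s = 0 := by
  have h0 : SymmetricAlgebra.algebraMapInv s =
      SymmetricAlgebra.algebraMapInv (DirectSum.decompose (symGrading A M) s 0 : Sym A M) := by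
    induction s using DirectSum.Decomposition.inductionOn (symGrading A M) with
    | zero => simp
    | homogeneous m =>
      rename_i i
      rcases i.eq_zero_or_pos with rfl | hi
      · rw [DirectSum.decompose_coe, DirectSum.of_eq_same]
      · rw [DirectSum.decompose_coe, DirectSum.of_eq_of_ne _ _ _ hi.ne, algebraMapInv_of_mem hi m.2]
        simp
    | add a b ha hb =>
      rw [map_add, ha, hb, DirectSum.decompose_add, DirectSum.add_apply, Submodule.coe_add, map_add]
  obtain ⟨a, ha⟩ : ∃ a, algebraMap A (Sym A M) a = DirectSum.decompose (symGrading A M) s 0 :=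
     exists_algebraMap_eq_of_mem (DirectSum.decompose (symGrading A M) s 0).2
  rw [HomogeneousIdeal.mem_irrelevant_iff, GradedRing.proj_apply, h0, ← ha,
    SymmetricAlgebra.algebraMap_leftInverse]
  constructor
  · intro h
    rw [← SymmetricAlgebra.algebraMap_leftInverse (R := A) (Module.Dual A M) a, h, map_zero]
  · rintro rfl
    exact map_zero _

instance [Module.Finite A M] [Module.Projective A M] : Algebra.FiniteType A (Sym A M) := by
  obtain ⟨s, hs⟩ := Module.Finite.fg_top (R := A) (M := Module.Dual A M)
  classical
  refine ⟨⟨s.image (SymmetricAlgebra.ι A _), ?_⟩⟩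
  rw [← top_le_iff]
  intro x _
  induction x using SymmetricAlgebra.induction with
  | algebraMap a => exact Subalgebra.algebraMap_mem _ a
  | ι l =>
    have hl : l ∈ Submodule.span A (s : Set (Module.Dual A M)) := hs ▸ trivial
    induction hl using Submodule.span_induction with
    | mem x hx => exact Algebra.subset_adjoin (by exact_mod_cast Finset.mem_image_of_mem _ hx)
    | zero => rw [map_zero]; exact zero_mem _
    | add x y _ _ hx hy => rw [map_add]; exact add_mem (hx trivial) (hy trivial)
    | smul a x _ hx => rw [map_smul]; exact Subalgebra.smul_mem _ (hx trivial) a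
  | mul a b ha hb => exact mul_mem (ha trivial) (hb trivial)
  | add a b ha hb => exact add_mem (ha trivial) (hb trivial)

theorem isSepFiniteType_totalSpace [Module.Finite k A] [Module.Finite A M]
    [Module.Projective A M] : IsSepFiniteType (totalSpace k A M) := by
  have h1 : LocallyOfFiniteType (Spec.map (CommRingCat.ofHom (algebraMap A (Sym A M)))) := by
    rw [HasRingHomProperty.Spec_iff (P := @LocallyOfFiniteType)]
    exact RingHom.finiteType_algebraMap.mpr inferInstance
  have h2 : LocallyOfFiniteType (bundleProj k A M).left := h1
  have h3 : IsAffineHom (bundleProj k A M).left := inferInstanceAs (IsAffineHom (Spec.map _))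
  exact (isSepFiniteType_specOver k A).of_isAffineHom (bundleProj k A M)

theorem isSepFiniteType_projBundle [Module.Finite k A] [Module.Finite A M]
    [Module.Projective A M] : IsSepFiniteType (projBundle k A M) := by
  have hs : Function.Surjective (algebraMap A (symGrading A M 0)) := by
    rintro ⟨x, hx⟩
    obtain ⟨a, ha⟩ := exists_algebraMap_eq_of_mem hx
    exact ⟨a, Subtype.ext ha⟩
  have : Algebra.FiniteType (symGrading A M 0) (Sym A M) := by
    rw [← RingHom.finiteType_algebraMap]
    refine RingHom.FiniteType.of_comp_finiteType (f := algebraMap A (symGrading A M 0)) ?_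
    exact RingHom.finiteType_algebraMap.mpr (inferInstance : Algebra.FiniteType A (Sym A M))
  have h1 : LocallyOfFiniteType
      (Spec.map (CommRingCat.ofHom (algebraMap A (symGrading A M 0)))) := by
    rw [HasRingHomProperty.Spec_iff (P := @LocallyOfFiniteType)]
    exact RingHom.FiniteType.of_surjective _ hs
  have h2 : LocallyOfFiniteType (Spec.map (CommRingCat.ofHom (algebraMap k A))) :=
    (isSepFiniteType_specOver k A).locallyOfFiniteType
  refine ⟨?_, ?_, ?_⟩ <;> dsimp <;> infer_instance

end SymFinite

/-! ### Invariant forms on an equivariant vector bundle -/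

section InvariantFunctions

variable {k : Type u} [Field k] {A : Type u} [CommRing A] [Algebra k A] {M : Type u}
  [AddCommGroup M] [Module A M] {G : SchemeOver k} [GrpObj G]
  [ModObj G (totalSpace k A M)]

theorem isInvariantOpen_top {X : SchemeOver k} [ModObj G X] :
    IsInvariantOpen G (⊤ : X.left.Opens) := rfl

theorem evalAt_id_mem_invariants_iff (s : Sym A M) :
    evalAt (𝟙 (totalSpace k A M)) s ∈ invariants (isInvariantOpen_top (G := G)) ↔
      IsInvariantFunction G s := by
  have h1 := pull_evalAt (actMap G (totalSpace k A M)) (𝟙 (totalSpace k A M)) s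
  have h2 := pull_evalAt (snd G (totalSpace k A M)) (𝟙 (totalSpace k A M)) s
  rw [Category.comp_id] at h1 h2
  rw [mem_invariants, IsInvariantFunction, ← h1, ← h2]
  rfl

variable (k G A M) in
/-- The homogeneous invariant functions of positive degree on an equivariant vector bundle. -/
def invariantForms : Set (Sym A M) :=
  {g | ∃ e, 0 < e ∧ g ∈ symGrading A M e ∧ IsInvariantFunction G g}

variable [ModObj G (specOver k A)]

theorem IsEquivariantBundle.evalAt_actMap_mem (h : IsEquivariantBundle (A := A) (M := M) G)
    {s : Sym A M} (hs : s ∈ HomogeneousIdeal.irrelevant (symGrading A M)) :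
    evalAt (actMap G (totalSpace k A M)) s ∈
      (HomogeneousIdeal.irrelevant (symGrading A M)).toIdeal.map
        (evalAt (snd G (totalSpace k A M))) := by
  let J := (HomogeneousIdeal.irrelevant (symGrading A M)).toIdeal.map
        (evalAt (snd G (totalSpace k A M)))
  -- Induction on `s` meets elements outside the irrelevant ideal, so the constant term is
  -- subtracted first.
  have key (s : Sym A M) (a : A) (ha : SymmetricAlgebra.algebraMapInv s = a) :
      evalAt (actMap G (totalSpace k A M)) (s - algebraMap A _ a) ∈ J := by
    induction s using SymmetricAlgebra.induction generalizing a with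
    | algebraMap b =>
      rw [← ha, SymmetricAlgebra.algebraMap_leftInverse, sub_self, map_zero]
      exact zero_mem _
    | ι l =>
      rw [← ha, SymmetricAlgebra.algebraMapInv_ι, map_zero, sub_zero]
      obtain ⟨n, c, m, hcm⟩ := h.linear l
      rw [hcm]
      refine sum_mem fun i _ => Ideal.mul_mem_left _ _ (Ideal.mem_map_of_mem _ ?_)
      exact (mem_irrelevant_iff_algebraMapInv _).mpr (SymmetricAlgebra.algebraMapInv_ι _)
    | mul x y hx hy =>
      have h1 : x * y - algebraMap A _ a =
          x * (y - algebraMap A _ (SymmetricAlgebra.algebraMapInv y)) +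
          (x - algebraMap A _ (SymmetricAlgebra.algebraMapInv x)) *
            algebraMap A _ (SymmetricAlgebra.algebraMapInv y) := by
        rw [← ha, map_mul, map_mul]
        ring
      rw [h1, map_add, map_mul, map_mul]
      exact add_mem (Ideal.mul_mem_left _ _ (hy _ rfl)) (Ideal.mul_mem_right _ _ (hx _ rfl))
    | add x y hx hy =>
      rw [← ha, map_add, map_add, add_sub_add_comm, map_add]
      exact add_mem (hx _ rfl) (hy _ rfl)
  have := key s 0 ((mem_irrelevant_iff_algebraMapInv s).mp hs)
  rwa [map_zero, sub_zero] at this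

/-- The actions of `G` and `𝔾ₘ` commute, so the homogeneous components of an invariant function are
invariant. -/
theorem IsEquivariantBundle.mem_span_invariantForms [IsFinite G.hom]
    (h : IsEquivariantBundle (A := A) (M := M) G)
    {s : Sym A M} (hs : s ∈ HomogeneousIdeal.irrelevant (symGrading A M))
    (hsG : IsInvariantFunction G s) : s ∈ Ideal.span (invariantForms k A M G) := by
  classical
  rw [← DirectSum.sum_support_decompose (symGrading A M) s]
  refine sum_mem fun i _ => ?_
  rcases i.eq_zero_or_pos with rfl | hi
  · have := (HomogeneousIdeal.mem_irrelevant_iff _ _).mp hs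
    rw [GradedRing.proj_apply] at this
    rw [this]
    exact zero_mem _
  · refine Ideal.subset_span ⟨i, hi, (DirectSum.decompose _ s i).2, ?_⟩
    have h1 := weightComponents_mem_invariants (isAffineOpen_top _) (isInvariantOpen_top (G := Gm k))
      h.act_comm isInvariantOpen_top ((evalAt_id_mem_invariants_iff s).mpr hsG) i
    rw [← evalAt_id_mem_invariants_iff (k := k)]
    rw [← evalOn_top, weightComponents_evalOn, evalOn_top] at h1
    exact h1

theorem mem_map_map {R S T : Type*} [CommRing R] [CommRing S] [CommRing T] {e : R →+* S}
    {p : S →+* T} {e' : R →+* T} (h : ∀ r, p (e r) = e' r) {I : Ideal R} {x : T}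
    (hx : x ∈ I.map e') : x ∈ (I.map e).map p := by
  rwa [Ideal.map_map, RingHom.ext (f := p.comp e) h]

/-- The invariant forms have only the zero section as common zeros. The action preserves the
irrelevant ideal, so the lower coefficients of the characteristic polynomial of `s` are invariant
and lie in that ideal, and the equation puts a power of `s` in the ideal generated by invariant
forms. -/
theorem IsEquivariantBundle.exists_pow_mem [IsFinite G.hom]
    (h : IsEquivariantBundle (A := A) (M := M) G)
    {s : Sym A M} (hs : s ∈ HomogeneousIdeal.irrelevant (symGrading A M)) :
    ∃ n : ℕ, s ^ n ∈ Ideal.span (invariantForms k A M G) := by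
  let e := evalAt (𝟙 (totalSpace k A M))
  obtain ⟨p, hp, hp0, hpG, hpJ⟩ := exists_monic_of_isInvariantOpen (G := G)
    (isAffineOpen_top (totalSpace k A M).left) isInvariantOpen_top (e s)
    ((HomogeneousIdeal.irrelevant (symGrading A M)).toIdeal.map e) (by
      have h1 := pull_evalAt (actMap G (totalSpace k A M)) (𝟙 (totalSpace k A M)) s
      rw [Category.comp_id] at h1
      refine Set.mem_of_eq_of_mem h1 (mem_map_map (fun r => ?_) (h.evalAt_actMap_mem hs))
      refine (pull_evalAt (snd G (totalSpace k A M)) (𝟙 (totalSpace k A M)) r).trans ?_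
      rw [Category.comp_id]
      rfl)
  refine ⟨p.natDegree, ?_⟩
  have hcoeff (i : ℕ) (hi : i < p.natDegree) : ∃ r ∈ Ideal.span (invariantForms k A M G),
      e r = p.coeff i := by
    obtain ⟨r, hr, hri⟩ := (Ideal.mem_map_iff_of_surjective e evalAt_id_bijective.2).mp (hpJ i hi)
    refine ⟨r, h.mem_span_invariantForms hr ?_, hri⟩
    rw [← evalAt_id_mem_invariants_iff (k := k), hri]
    exact hpG i
  choose! r hr hri using hcoeff
  have h1 : e (s ^ p.natDegree + ∑ i ∈ Finset.range p.natDegree, r i * s ^ i) = 0 := by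
    rw [← hp0, Polynomial.eval_eq_sum_range, Finset.sum_range_succ, hp.coeff_natDegree, one_mul,
      map_add, map_pow, map_sum, add_comm]
    congr 1
    refine Finset.sum_congr rfl fun i hi => ?_
    rw [map_mul, map_pow, hri i (Finset.mem_range.mp hi)]
  have h2 := evalAt_id_bijective.1 (h1.trans (map_zero e).symm)
  rw [eq_neg_of_add_eq_zero_left h2]
  exact neg_mem (sum_mem fun i hi => Ideal.mul_mem_right _ _ (hr i (Finset.mem_range.mp hi)))

theorem IsEquivariantBundle.exists_finset [IsFinite G.hom] [Module.Finite k A] [Module.Finite A M]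
    [Module.Projective A M] (h : IsEquivariantBundle (A := A) (M := M) G) :
    ∃ t : Finset (Sym A M), (t : Set (Sym A M)) ⊆ invariantForms k A M G ∧
      ∀ s ∈ HomogeneousIdeal.irrelevant (symGrading A M),
        ∃ n : ℕ, s ^ n ∈ Ideal.span (t : Set (Sym A M)) := by
  have : IsNoetherianRing A := IsNoetherianRing.of_finite k A
  have : IsNoetherianRing (Sym A M) := Algebra.FiniteType.isNoetherianRing A (Sym A M)
  obtain ⟨t, ht, hts⟩ := (Submodule.fg_span_iff_fg_span_finset_subset (R := Sym A M)
    (invariantForms k A M G)).mp (IsNoetherian.noetherian _)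
  refine ⟨t, ht, fun s hs => ?_⟩
  obtain ⟨n, hn⟩ := h.exists_pow_mem hs
  exact ⟨n, hts.le hn⟩

end InvariantFunctions

/-! ### Part (b): quotients of equivariant vector bundles -/

section BundleQuotient

theorem eq_one_iff_zero_sub_one_mul_add_one {R : Type*} [CommRing R] (x : R) :
    x = 1 ↔ (0 - 1) * x + 1 = 0 :=
  ⟨fun h => by rw [h]; ring, fun h => by linear_combination -h⟩

variable {k : Type u} [Field k]

theorem affCls_self : affCls k k = 1 :=
  cls_one _ (Over.isoMk (Iso.refl _) (by
    have h : (specOver k k).hom = 𝟙 (Spec (.of k)) := Spec.map_id _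
    refine (Category.id_comp _).trans h.symm))

theorem affCls_quotient_ker {R K : Type u} [CommRing R] [Algebra k R] [Algebra.FiniteType k R]
    [CommRing K] [Algebra k K] (hK : Function.Bijective (algebraMap k K)) (φ : R →ₐ[k] K) :
    affCls k (R ⧸ RingHom.ker φ) = 1 := by
  have hφ : Function.Surjective φ := fun x => by
    obtain ⟨a, rfl⟩ := hK.2 x
    exact ⟨algebraMap k R a, φ.commutes a⟩
  rw [← affCls_self]
  exact affCls_congr ((Ideal.quotientKerAlgEquivOfSurjective hφ).trans
    (AlgEquiv.ofBijective (Algebra.ofId k K) hK).symm)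

theorem algebraMap_unit_bijective :
    Function.Bijective (algebraMap k Γ((𝟙_ (SchemeOver k)).left, ⊤)) := by
  have h : (algebraMap k Γ((𝟙_ (SchemeOver k)).left, ⊤) : k → _) =
      (Scheme.ΓSpecIso (.of k)).inv := funext fun a => by
    rw [algebraMap_sections_top]
    exact evalSpec_id (A := .of k) a
  rw [h]
  exact ConcreteCategory.bijective_of_isIso _

variable {A : Type u} [CommRing A] [Algebra k A] {M : Type u} [AddCommGroup M] [Module A M]
  {G : SchemeOver k} [GrpObj G] [ModObj G (specOver k A)] [ModObj G (totalSpace k A M)]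

/-- The functions on the quotient of an equivariant vector bundle which vanish on the image of the
zero section. -/
theorem IsEquivariantBundle.exists_algHom (hW : IsQuotient G (toUnit (specOver k A)))
    (hV : IsEquivariantBundle (A := A) (M := M) G) {VG : SchemeOver k} {qV : totalSpace k A M ⟶ VG}
    (hqV : IsQuotient G qV) :
    ∃ φ : Γ(VG.left, ⊤) →ₐ[k] Γ((𝟙_ (SchemeOver k)).left, ⊤), ∀ r (s : Sym A M),
      pull qV (le_preimage_top qV ⊤) r = evalAt (𝟙 _) s →
        (φ r = 0 ↔ s ∈ HomogeneousIdeal.irrelevant (symGrading A M)) := by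
  have hinj : Function.Injective (pull (toUnit (specOver k A)) (le_preimage_top _ ⊤)) :=
    hW.pull_injective (U := ⊤) (O := ⊤) rfl
  obtain ⟨φ, hφ⟩ := exists_lift_of_range_le _ hinj
    (pull (zeroSection ≫ qV) (le_preimage_top _ ⊤)) fun r => by
      -- The zero section is equivariant, so a function from `V/G` restricts to an invariant
      -- function on `W`, hence to one from `W/G = Spec k`.
      refine (hW.mem_range_pull isInvariantOpen_top (U := ⊤) rfl _).mpr ?_
      rw [mem_invariants, pull_pull, pull_pull]
      refine pull_congr ?_ _ _
      rw [← Category.assoc, hV.isEquivariant_zeroSection, Category.assoc, hqV.invariant,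
        whiskerLeft_snd_assoc]
  refine ⟨{ φ with commutes' := fun a => hinj ?_ }, fun r s hrs => ?_⟩
  · exact (hφ _).trans ((pull_algebraMap _ _ a).trans (pull_algebraMap _ _ a).symm)
  · have h1 : pull (toUnit (specOver k A)) (le_preimage_top _ ⊤) (φ r) =
        evalAt (zeroSection (k := k)) s := by
      rw [hφ, ← pull_pull _ _ (le_preimage_top qV ⊤) (le_preimage_top _ ⊤), hrs, pull_evalAt,
        Category.comp_id]
    change φ r = 0 ↔ _
    rw [mem_irrelevant_iff_algebraMapInv, ← map_eq_zero_iff _ hinj, h1, evalAt_zeroSection,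
      map_eq_zero_iff _ (ConcreteCategory.bijective_of_isIso (Scheme.ΓSpecIso (.of A)).inv).1]

variable [ModObj G (projBundle k A M)] [IsFinite G.hom] [Module.Finite k A] [Module.Finite A M]
  [Module.Projective A M]

/-- The loci `D₊(f)` of finitely many invariant forms cover `ℙ(V)`, and the loci `D(f)` cover `V`
outside the zero section. Comparison of weights gives the factor `𝕃 - 1`. What is left of `V/G` is
the zero locus of the kernel of a surjection onto functions on `Spec k`, of class `1`. -/
theorem cls_quotient_bundle (hW : IsQuotient G (toUnit (specOver k A)))
    (hV : IsEquivariantBundle (A := A) (M := M) G) (hind : IsInducedAction (A := A) (M := M) G)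
    {VG PVG : SchemeOver k} {qV : totalSpace k A M ⟶ VG} {qPV : projBundle k A M ⟶ PVG}
    (hqV : IsQuotient G qV) (hqPV : IsQuotient G qPV) (hVG : IsSepFiniteType VG)
    (hPVG : IsSepFiniteType PVG) :
    K0Var.cls VG hVG = (lefschetz k - 1) * K0Var.cls PVG hPVG + 1 := by
  obtain ⟨t, ht, htS⟩ := hV.exists_finset
  choose e he hg hgG using fun i : t => ht i.2
  -- A power of `s` lies in the ideal generated by `t`, so a prime containing `t` would contain `s`.
  have hprime (I : Ideal (Sym A M)) (hI : I.IsPrime) (s : Sym A M)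
      (hs : s ∈ HomogeneousIdeal.irrelevant (symGrading A M)) (hsI : s ∉ I) :
      ∃ i : t, i.1 ∉ I := by
    by_contra! H
    obtain ⟨n, hn⟩ := htS s hs
    exact hsI (Ideal.IsPrime.mem_of_pow_mem hI n
      (Ideal.span_le.mpr (fun g hg => H ⟨g, hg⟩) hn))
  have hcov (x : (projBundle k A M).left) :
      ∃ i : t, x ∈ Proj.basicOpen (symGrading A M) i.1 := by
    have hx := (x : ProjectiveSpectrum (symGrading A M)).not_irrelevant_le
    obtain ⟨s, hs, hsx⟩ := SetLike.not_le_iff_exists.mp hx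
    exact hprime _ (x : ProjectiveSpectrum (symGrading A M)).isPrime s hs hsx
  have hNG (i : t) := (hgG i).isInvariantOpen_basicOpen hind (fun x => by
    obtain ⟨j, hj⟩ := hcov x
    exact ⟨e j, j.1, he j, hg j, hgG j, hj⟩) (he i) (hg i)
  choose U hU using fun i : t => hqPV.exists_opens (hNG i)
  have hr (s : Sym A M) (hs : IsInvariantFunction G s) : ∃ r : Γ(VG.left, ⊤),
      pull qV (le_preimage_top qV ⊤) r = evalAt (𝟙 _) s :=
    (hqV.mem_range_pull isInvariantOpen_top (U := ⊤) rfl _).mpr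
      ((evalAt_id_mem_invariants_iff s).mpr hs)
  choose r hr using fun i : t => hr i.1 (hgG i)
  have hO (r : Γ(VG.left, ⊤)) (s : Sym A M)
      (h : pull qV (le_preimage_top qV ⊤) r = evalAt (𝟙 _) s) :
      bundleOpen k s = qV.left ⁻¹ᵁ VG.left.basicOpen r := by
    rw [bundleOpen, ← h, basicOpen_pull]
    exact top_inf_eq _
  have key := cls_openSub_of_weights hqV hqPV hVG hPVG hV.act_comm
    (N := fun i : t => Proj.basicOpen (symGrading A M) i.1) (O := fun i => bundleOpen k i.1)
    (U := U) (W := fun i => VG.left.basicOpen (r i)) (fun i => (hU i).symm)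
    (fun i => hO _ _ (hr i)) (fun i => Proj.isAffineOpen_basicOpen _ _ (hg i) (he i))
    (fun i => isAffineOpen_bundleOpen _) hNG (fun i => (hgG i).isInvariantOpen)
    (fun i => isInvariantOpen_bundleOpen (hg i))
    (fun i => span_weightSpace_bundleOpen (he i) (hg i)) (fun i => chartMap (he i) (hg i))
    (fun i => chartMap_injective _ _) (fun i => chartMap_algebraMap _ _)
    (fun i => mem_range_chartMap_iff _ _)
    (fun i => (hgG i).chartMap_mem_invariants_iff _ _ hind _ _)
    (fun i p hp => by
      obtain ⟨x, hx, hxb, hxg⟩ := exists_mem_basicOpen_iff (he i) (hg i) p hp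
      exact ⟨x, hx, hxb, fun j => hxg _ _ (he j) (hg j)⟩) Finset.univ
  have hUtop : Finset.univ.sup U = ⊤ := by
    rw [← top_le_iff, ← hqPV.preimage_le_preimage_iff]
    intro x _
    obtain ⟨i, hi⟩ := hcov x
    exact Finset.le_sup (f := U) (Finset.mem_univ i) ((hU i).ge hi)
  rw [cls_openSub_of_eq_top hPVG hUtop] at key
  have haff : IsAffineOpen (⊤ : VG.left.Opens) := hqV.isAffineOpen (isAffineOpen_top _)
  have := hVG.finiteType haff
  obtain ⟨φ, hφ⟩ := hV.exists_algHom hW hqV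
  have hsup := cls_openSub_sup hVG (Finset.univ.sup fun i => VG.left.basicOpen (r i)) haff
    (RingHom.ker φ) fun y _ => by
      rw [Finset.sup_univ_eq_iSup, TopologicalSpace.Opens.mem_iSup]
      constructor
      · rintro ⟨i, hi⟩
        exact ⟨r i, (hφ _ _ (hr i)).mpr (HomogeneousIdeal.mem_irrelevant_of_mem _ (he i) (hg i)), hi⟩
      · rintro ⟨a, ha, hya⟩
        obtain ⟨p, rfl⟩ := hqV.surjective.surj y
        obtain ⟨s, hs⟩ := evalAt_id_bijective.2 (pull qV (le_preimage_top qV ⊤) a)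
        have hp := (hO a s hs.symm).ge hya
        rw [bundleOpen_eq] at hp
        obtain ⟨i, hi⟩ := hprime _ (p : PrimeSpectrum (Sym A M)).isPrime s
          ((hφ a s hs.symm).mp ha) hp
        refine ⟨i, (hO _ _ (hr i)).le ?_⟩
        rw [bundleOpen_eq]
        exact hi
  rw [key, affCls_quotient_ker algebraMap_unit_bijective, cls_openSub_of_eq_top hVG (top_sup_eq _)]
    at hsup
  rw [hsup, add_comm]

end BundleQuotient

end GrothendieckQuotient

end

theorem proposition2p2 {k : Type u} [Field k] (G : SchemeOver k) [GrpObj G]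
    (hG : IsFiniteGroup G) :
    -- the class of the quotient of an equivariant torsor
    (∀ (X P : SchemeOver k) [ModObj G X] [ModObj G P] [ModObj (Gm k) P] (π : P ⟶ X),
      IsQuasiProjective X → IsEquivariantGmTorsor G π →
      ∀ (XG PG : SchemeOver k) (qX : X ⟶ XG) (qP : P ⟶ PG),
        IsQuotient G qX → IsQuotient G qP →
        ∃ (hX : IsSepFiniteType XG) (hP : IsSepFiniteType PG),
          K0Var.cls PG hP = (lefschetz k - 1) * K0Var.cls XG hX) ∧
    -- the class of the quotient of an equivariant vector bundle over a finite scheme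
    (∀ (A : Type u) [CommRing A] [Algebra k A] [Module.Finite k A]
      (M : Type u) [AddCommGroup M] [Module A M] [Module.Finite A M] [Module.Projective A M]
      [ModObj G (specOver k A)] [ModObj G (totalSpace k A M)] [ModObj G (projBundle k A M)],
      IsQuotient G (toUnit (specOver k A)) →
      IsEquivariantBundle (A := A) (M := M) G → IsInducedAction (A := A) (M := M) G →
      ∀ (VG PVG : SchemeOver k) (qV : totalSpace k A M ⟶ VG) (qPV : projBundle k A M ⟶ PVG),
        IsQuotient G qV → IsQuotient G qPV →
        ∃ (hV : IsSepFiniteType VG) (hPV : IsSepFiniteType PVG),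
          K0Var.cls VG hV = (lefschetz k - 1) * K0Var.cls PVG hPV + 1 ∧
          (Ideal.Quotient.mk (Ideal.span {lefschetz k}) (K0Var.cls PVG hPV) = 1 ↔
            Ideal.Quotient.mk (Ideal.span {lefschetz k}) (K0Var.cls VG hV) = 0)) := by
  have := hG.isFinite
  refine ⟨fun X P _ _ _ π hX hπ XG PG qX qP hqX hqP => ?_, ?_⟩
  · have hXG := hqX.isSepFiniteType hX.isSepFiniteType
    have hPG := hqP.isSepFiniteType (hπ.toIsGmTorsor.isSepFiniteType hX.isSepFiniteType)
    exact ⟨hXG, hPG, cls_quotient_torsor hπ hqX hqP hXG hPG⟩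
  · intro A _ _ _ M _ _ _ _ _ _ _ hW hV hind VG PVG qV qPV hqV hqPV
    have hVG := hqV.isSepFiniteType (isSepFiniteType_totalSpace k)
    have hPVG := hqPV.isSepFiniteType (isSepFiniteType_projBundle k)
    have key := cls_quotient_bundle hW hV hind hqV hqPV hVG hPVG
    refine ⟨hVG, hPVG, key, ?_⟩
    have hL : Ideal.Quotient.mk (Ideal.span {lefschetz k}) (lefschetz k) = 0 :=
      Ideal.Quotient.eq_zero_iff_mem.mpr (Ideal.mem_span_singleton_self _)
    rw [key, map_add, map_mul, map_sub, hL, map_one]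
    exact eq_one_iff_zero_sub_one_mul_add_one _
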